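/- Fix $T>0$ and let the set of players be $\Omega=[0,1]$ with Lebesgue measure. A (scalar, deterministic) mean field game is given by data $(f,L,\psi,\phi,\bar x)$, where $f,L:[0,T]\times\mathbb R^3\to\mathbb R$, $\psi:\mathbb R\to\mathbb R$, $\phi:[0,T]\times\mathbb R\to\mathbb R$ and $\bar x:\Omega\to\mathbb R$. Given $\eta\in\mathcal C([0,T])$, player $\xi$ minimizes $$\int_0^T L\bigl(t,x(t),u(t),\eta(t)\bigr)\,dt+\psi(x(T))\quad\text{subject to}\quad \dot x=f(t,x,u,\eta),\quad x(0)=\bar x(\xi),$$ over measurable controls $u:[0,T]\to\mathbb R$. * The moment of a family of trajectories $x(\cdot,\xi)$, $\xi\in\Omega$, is $\eta(t)=\int_\Omega\phi(t,x(t,\xi))\,d\xi$. A *solution* of the game is a family $x\in L^1(\Omega;\mathcal C([0,T]))$ such that, with $\eta$ the moment of $x$, for a.e. $\xi$ the trajectory $x(\cdot,\xi)$ (with some control $u(\cdot,\xi)$) is optimal for player $\xi$. * The (multivalued) best reply map $\Phi$ on $\mathcal C([0,T])$ sends $\eta$ to the set of the moments of all families $x\in L^1(\Omega;\mathcal C([0,T]))$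 for which $x(\cdot,\xi)$ is optimal, given $\eta$, for a.e. player $\xi$. * A solution with moment $\eta^*$ is *stable* if for every $\varepsilon>0$ there is $\delta>0$ such that every sequence with $\|\eta^{(0)}-\eta^*\|_{\mathcal C^0}<\delta$ and $\eta^{(k)}\in\Phi(\eta^{(k-1)})$ for all $k\ge1$ satisfies $\|\eta^{(k)}-\eta^*\|_{\mathcal C^0}<\varepsilon$ for all $k\geq 1$. Otherwise it is *unstable*. * A solution $x$ is *structurally stable* if for every $\varepsilon>0$ there is $\delta>0$ such that every game $(f^\dagger,L^\dagger,\psi^\dagger,\phi^\dagger,\bar x^\dagger)$ with $f^\dagger,L^\dagger,\psi^\dagger,\phi^\dagger$ of class $\mathcal C^2$, $\bar x^\dagger$ measurable, $$\max\bigl\{\|f^\dagger-f\|_{\mathcal C^2},\|L^\dagger-L\|_{\mathcal C^2},\|\psi^\dagger-\psi\|_{\mathcal C^2},\|\phi^\dagger-\phi\|_{\mathcal C^2}\bigr\}<\delta,\qquad \|\bar x^\dagger-\bar x\|_{L^\infty}<\delta$$ (the $\mathcal C^2$ norms being taken over the whole domains of the functions) has a solution $x^\dagger$ with $\sup_{t\in[0,T]}\int_\Omega|x^\dagger(t,\xi)-x(t,\xi)|\,d\xi<\varepsilon$.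 **Proposition.** Let $\kappa>1$ and $T>2$, and consider the game in which every player minimizes $$\int_0^T\Bigl[|u(t)|^2+\frac1{1+x^2(t)}+\kappa\,|x(t)-b(t)|^2\Bigr]dt,\qquad \dot x=u,\quad x(0,\xi)=0\ \text{ for all }\xi\in[0,1],$$ where $b(t)=\int_0^1x(t,\xi)\,d\xi$ is the barycenter of the players, i.e. $f=u$, $L=|u|^2+\frac{1}{1+x^2}+\kappa|x-\eta|^2$, $\psi=0$, $\phi(t,x)=x$, $\bar x=0$. 1. The game has at least three solutions, of the form $x_i(t,\xi)=y_i(t)$, $i=0,1,2$, with $y_0=0$, $y_1$ strictly increasing on $[0,T]$, and $y_2=-y_1$. 2. The zero solution $x_0$ is unstable. If $T\neq\frac{(2n-1)\pi}2$ for every integer $n\ge1$, it is structurally stable. 3. Both $x_1$ and $x_2$ are stable and structurally stable. -/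

import Mathlib

open MeasureTheory Set

noncomputable section

namespace MFG

/-- The time interval `[0, T]`. -/
abbrev Time (T : ℝ) : Type := Set.Icc (0 : ℝ) T

/-- Integrals over `[0, T]` are taken with respect to Lebesgue measure. -/
instance (T : ℝ) : MeasureSpace (Time T) := Measure.Subtype.measureSpace

/-- `𝒞([0, T]; ℝ)` with the supremum norm. -/
abbrev Path (T : ℝ) : Type := C(Time T, ℝ)

/-- The space of players: `[0, 1]` with Lebesgue measure. -/
abbrev Player : Type := unitInterval

/-- The data `(f, L, ψ, φ, x̄)` of a deterministic first order mean field game on `[0, T]` with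
scalar states, scalar controls and a single moment `η`.  Player `ξ` minimizes
`∫₀ᵀ L(t, x, u, η) dt + ψ(x(T))` subject to `ẋ = f(t, x, u, η)`, `x(0) = x̄(ξ)`, where
`η(t) = ∫ φ(t, x(t, ξ)) dξ`. -/
structure ScalarGame (T : ℝ) where
  /-- the horizon is nonnegative -/
  T_nonneg : 0 ≤ T
  /-- the dynamics `f(t, x, u, η)` -/
  f : ℝ → ℝ → ℝ → ℝ → ℝ
  /-- the running cost `L(t, x, u, η)` -/
  L : ℝ → ℝ → ℝ → ℝ → ℝ
  /-- the terminal cost `ψ(x)` -/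
  ψ : ℝ → ℝ
  /-- the function `φ(t, x)` defining the moment -/
  φ : ℝ → ℝ → ℝ
  /-- the initial datum `x̄(ξ)` -/
  xinit : Player → ℝ

namespace ScalarGame

variable {T : ℝ}

/-- The pair (trajectory `x`, control `u`) is admissible for the control problem with given moment
`η` and initial point `a`: the control is measurable, `x` is the Carathéodory solution of
`ẋ = f(t, x, u, η)`, `x(0) = a`, and the running cost is integrable. -/
structure IsAdmissible (G : ScalarGame T) (η : Path T) (a : ℝ) (x : Path T) (u : Time T → ℝ) :
    Prop where
  control_measurable : AEMeasurable u volume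
  velocity_integrable : Integrable (fun s : Time T => G.f s (x s) (u s) (η s)) volume
  trajectory : ∀ t : Time T, x t = a + ∫ s in Set.Iic t, G.f s (x s) (u s) (η s)
  cost_integrable : Integrable (fun s : Time T => G.L s (x s) (u s) (η s)) volume

/-- The cost `∫₀ᵀ L(t, x, u, η) dt + ψ(x(T))`. -/
def cost (G : ScalarGame T) (η x : Path T) (u : Time T → ℝ) : ℝ :=
  (∫ s : Time T, G.L s (x s) (u s) (η s)) + G.ψ (x ⟨T, G.T_nonneg, le_rfl⟩)

/-- `(x, u)` is an optimal pair for the control problem with given `η` and initial point `a`. -/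
def IsOptimal (G : ScalarGame T) (η : Path T) (a : ℝ) (x : Path T) (u : Time T → ℝ) : Prop :=
  G.IsAdmissible η a x u ∧
    ∀ (x' : Path T) (u' : Time T → ℝ), G.IsAdmissible η a x' u' → G.cost η x u ≤ G.cost η x' u'

/-- `η` is the (well defined) moment of the family of trajectories `x`:
`η(t) = ∫ φ(t, x(t, ξ)) dξ`. -/
def IsMoment (G : ScalarGame T) (x : Player → Path T) (η : Path T) : Prop :=
  ∀ t : Time T, Integrable (fun ξ : Player => G.φ t (x ξ t)) volume ∧
    η t = ∫ ξ : Player, G.φ t (x ξ t)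

/-- `x` is a strong solution of the game: `x ∈ L¹(Ω; 𝒞([0, T]))` and, together with some
controls `u(·, ξ)`, it is optimal for a.e. player `ξ`, the moment `η` being that of `x`. -/
def IsSolution (G : ScalarGame T) (x : Player → Path T) : Prop :=
  Integrable x volume ∧ ∃ (u : Player → Time T → ℝ) (η : Path T), G.IsMoment x η ∧
    ∀ᵐ ξ : Player, G.IsOptimal η (G.xinit ξ) (x ξ) (u ξ)

/-- The multivalued best reply map `Φ` on `𝒞([0, T])`: the moments of all families of
optimal trajectories for the given `η`. -/
def bestReply (G : ScalarGame T) (η : Path T) : Set (Path T) :=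
  {η' | ∃ (x : Player → Path T) (u : Player → Time T → ℝ), Integrable x volume ∧
    (∀ᵐ ξ : Player, G.IsOptimal η (G.xinit ξ) (x ξ) (u ξ)) ∧ G.IsMoment x η'}

end ScalarGame

/-- `p` is a (Lyapunov) stable fixed point of the multivalued map `Φ`. -/
def IsStableFixedPoint {E : Type*} [NormedAddCommGroup E] (Φ : E → Set E) (p : E) : Prop :=
  p ∈ Φ p ∧ ∀ ε > 0, ∃ δ > 0, ∀ η : ℕ → E, ‖η 0 - p‖ < δ → (∀ k ≥ 1, η k ∈ Φ (η (k - 1))) →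
    ∀ k ≥ 1, ‖η k - p‖ < ε

/-- `g` is of class `𝒞²` on `S` and `‖g - h‖_{𝒞²(S)} < δ`, the norm being the largest of the suprema
over `S` of the norms of the derivatives of order `0`, `1`, `2`. -/
def IsC2Near {E : Type*} [NormedAddCommGroup E] [NormedSpace ℝ E] (S : Set E) (g h : E → ℝ)
    (δ : ℝ) : Prop :=
  ContDiffOn ℝ 2 g S ∧ ∃ r < δ, ∀ k ≤ 2, ∀ z ∈ S,
    ‖iteratedFDerivWithin ℝ k (fun w => g w - h w) S z‖ ≤ r

namespace ScalarGame

variable {T : ℝ}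

/-- A solution is stable if its moment is a stable fixed point of the best reply map. -/
def IsStable (G : ScalarGame T) (x : Player → Path T) : Prop :=
  ∃ η : Path T, G.IsMoment x η ∧ IsStableFixedPoint G.bestReply η

/-- The data of `G'` are `δ`-close to those of `G`: in `𝒞²` for `f, L, ψ, φ` (on
`[0, T] × ℝ³`, `[0, T] × ℝ³`, `ℝ`, `[0, T] × ℝ` respectively) and in `L^∞` for the initial datum. -/
structure IsNear (G G' : ScalarGame T) (δ : ℝ) : Prop where
  f_near : IsC2Near (Set.Icc (0 : ℝ) T ×ˢ (Set.univ : Set (ℝ × ℝ × ℝ)))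
    (fun z => G'.f z.1 z.2.1 z.2.2.1 z.2.2.2) (fun z => G.f z.1 z.2.1 z.2.2.1 z.2.2.2) δ
  L_near : IsC2Near (Set.Icc (0 : ℝ) T ×ˢ (Set.univ : Set (ℝ × ℝ × ℝ)))
    (fun z => G'.L z.1 z.2.1 z.2.2.1 z.2.2.2) (fun z => G.L z.1 z.2.1 z.2.2.1 z.2.2.2) δ
  ψ_near : IsC2Near Set.univ G'.ψ G.ψ δ
  φ_near : IsC2Near (Set.Icc (0 : ℝ) T ×ˢ (Set.univ : Set ℝ))
    (fun z => G'.φ z.1 z.2) (fun z => G.φ z.1 z.2) δ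
  xinit_measurable : AEMeasurable G'.xinit volume
  xinit_near : eLpNorm (fun ξ => G'.xinit ξ - G.xinit ξ) ⊤ volume < ENNReal.ofReal δ

/-- The solution `x` of `G` is structurally stable (essential): every game sufficiently close to
`G` has a solution `x'` with `sup_t ∫ |x'(t, ξ) - x(t, ξ)| dξ < ε`. -/
def IsStructurallyStable (G : ScalarGame T) (x : Player → Path T) : Prop :=
  ∀ ε > 0, ∃ δ > 0, ∀ G' : ScalarGame T, G.IsNear G' δ →
    ∃ x' : Player → Path T, G'.IsSolution x' ∧
      (⨆ t : Time T, ∫ ξ : Player, |x' ξ t - x ξ t|) < ε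

end ScalarGame

/-- The game with cost `∫₀ᵀ |u|² + 1/(1+x²) + κ|x - b|² dt`, dynamics `ẋ = u`, `x(0) = 0`, where
`b(t) = ∫ x(t, ξ) dξ` is the barycenter. -/
def barycenterGame (κ T : ℝ) (hT : 0 ≤ T) : ScalarGame T where
  T_nonneg := hT
  f _ _ u _ := u
  L _ x u b := |u| ^ 2 + 1 / (1 + x ^ 2) + κ * |x - b| ^ 2
  ψ _ := 0
  φ _ x := x
  xinit _ := 0

end MFG

end

/-!
For `κ > 1` the cost is uniformly convex along trajectories, so the Pontryagin conditions are
sufficient for optimality and every `η` has a unique best reply `x`: the solution of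
`-x'' = x / (1 + x²)² + κ (η - x)`, `x(0) = 0`, `x'(T) = 0`. The reply is monotone in `η` by the
maximum principle, and its fixed points are the solutions of `-y'' = y / (1 + y²)²`,
`y(0) = 0`, `y'(T) = 0`.

When `T > π / 2` the linearization at `0` has an eigenvalue `(π / 2T)² < 1`, so small multiples of
its eigenfunction are subsolutions. They are pushed away from `0` by the best replies, which makes
`0` unstable, and monotone iteration above them produces a positive equilibrium `y`. As the force
divided by `z` decreases in `z > 0`, the order intervals `[(1 - ε) y, (1 + ε) y]` are
invariant under best replies; one reply suffices to enter such an interval from a uniform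
neighbourhood of `y`, by Hopf's lemma. Hence `y` is stable.

An equilibrium `y` persists under perturbations once the linearized problem
`-x'' = (1 - 3 y²) / (1 + y²)³ x`, `x(0) = 0`, `x'(T) = 0` has no nonzero solution. For `y = 0` this
means `cos T ≠ 0`, and for the positive equilibrium it follows from Sturm's comparison theorem.
The perturbed initial datum need not be constant, so one solves for the extremals
of all initial points `a` and for the moment at once, by a quantitative inverse function theorem
in `C(A, X) × E` whose linear part is inverted with a bound independent of the perturbation. The
convexity of the cost, which survives small perturbations, makes these extremals optimal.
-/

noncomputable section

namespace MFG

variable {T : ℝ}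

/-! ### Integration in time -/

theorem measurableEmbedding_time : MeasurableEmbedding (Subtype.val : Time T → ℝ) :=
  MeasurableEmbedding.subtype_coe measurableSet_Icc

theorem volume_time_apply (A : Set (Time T)) :
    (volume : Measure (Time T)) A = volume ((↑) '' A : Set ℝ) :=
  measurableEmbedding_time.comap_apply _ _

instance : IsFiniteMeasure (volume : Measure (Time T)) :=
  ⟨by
    rw [Measure.Subtype.volume_univ measurableSet_Icc.nullMeasurableSet]
    exact measure_Icc_lt_top⟩

instance : NullSingletonClass (volume : Measure (Time T)) :=
  ⟨fun t => by rw [volume_time_apply, image_singleton]; exact measure_singleton _⟩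

theorem volume_real_univ [hT : Fact (0 ≤ T)] : (volume : Measure (Time T)).real univ = T := by
  rw [Measure.real, Measure.Subtype.volume_univ measurableSet_Icc.nullMeasurableSet,
    Real.volume_Icc, sub_zero, ENNReal.toReal_ofReal hT.out]

theorem volume_real_Ioc {s t : Time T} (h : s ≤ t) :
    (volume : Measure (Time T)).real (Ioc s t) = t - s := by
  have : ((↑) '' Ioc s t : Set ℝ) = Ioc (s : ℝ) t :=
    Subset.antisymm (image_subset_iff.2 fun _ hr => hr) fun r hr =>
      ⟨⟨r, s.2.1.trans hr.1.le, hr.2.trans t.2.2⟩, hr, rfl⟩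
  rw [Measure.real, volume_time_apply, this, Real.volume_Ioc]
  exact ENNReal.toReal_ofReal (sub_nonneg.2 h)

theorem integrable_path (v : Path T) : Integrable v (volume : Measure (Time T)) :=
  .of_bound v.continuous.aestronglyMeasurable ‖v‖ (.of_forall v.norm_coe_le_norm)

theorem abs_apply_le_norm (v : Path T) (t : Time T) : |v t| ≤ ‖v‖ := v.norm_coe_le_norm t

theorem norm_path_le {v : Path T} {C : ℝ} (hC : 0 ≤ C) (h : ∀ t, |v t| ≤ C) : ‖v‖ ≤ C :=
  (ContinuousMap.norm_le v hC).2 h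

theorem norm_path_one_le : ‖(1 : Path T)‖ ≤ 1 := norm_path_le zero_le_one fun t => by simp

theorem setIntegral_Iic_sub {v : Time T → ℝ} (hv : Integrable v volume) {s t : Time T}
    (h : s ≤ t) : (∫ r in Iic t, v r) - ∫ r in Iic s, v r = ∫ r in Ioc s t, v r := by
  rw [← Iic_union_Ioc_eq_Iic h, setIntegral_union (Iic_disjoint_Ioc le_rfl) measurableSet_Ioc
    hv.integrableOn hv.integrableOn, add_sub_cancel_left]

theorem setIntegral_Ici {v : Time T → ℝ} (hv : Integrable v volume) (t : Time T) :
    ∫ r in Ici t, v r = (∫ r, v r) - ∫ r in Iic t, v r := by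
  rw [← setIntegral_congr_set Ioi_ae_eq_Ici, ← compl_Iic,
    ← integral_add_compl measurableSet_Iic hv, add_sub_cancel_left]

theorem lipschitzWith_setIntegral_Iic (v : Path T) :
    LipschitzWith ‖v‖₊ fun t : Time T => ∫ r in Iic t, v r := by
  have of_le {s t : Time T} (h : s ≤ t) :
      |(∫ r in Iic t, v r) - ∫ r in Iic s, v r| ≤ ‖v‖ * |(t : ℝ) - s| := by
    rw [setIntegral_Iic_sub (integrable_path v) h, abs_of_nonneg (sub_nonneg.2 h : (0 : ℝ) ≤ t - s),
      ← volume_real_Ioc h]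
    exact norm_setIntegral_le_of_norm_le_const (measure_lt_top _ _) fun r _ => v.norm_coe_le_norm r
  refine LipschitzWith.of_dist_le_mul fun t s => ?_
  rw [Real.dist_eq, Subtype.dist_eq, Real.dist_eq, coe_nnnorm]
  rcases le_total s t with h | h
  · exact of_le h
  · rw [abs_sub_comm, abs_sub_comm (t : ℝ)]
    exact of_le h

theorem abs_setIntegral_le (v : Path T) (A : Set (Time T)) :
    |∫ r in A, v r| ≤ (volume : Measure (Time T)).real univ * ‖v‖ := by
  have hle := norm_setIntegral_le_of_norm_le_const (μ := (volume : Measure (Time T)))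
    (measure_lt_top _ A) fun r _ => v.norm_coe_le_norm r
  rw [mul_comm]
  exact hle.trans (mul_le_mul_of_nonneg_left (measureReal_mono (subset_univ A)) (norm_nonneg v))

/-- The operator `v ↦ ∫₀ᵗ v(s) ds`. -/
def primitive (T : ℝ) : Path T →L[ℝ] Path T :=
  LinearMap.mkContinuous
    { toFun := fun v => ⟨fun t => ∫ r in Iic t, v r, (lipschitzWith_setIntegral_Iic v).continuous⟩
      map_add' := fun v w => ContinuousMap.ext fun _ =>
        integral_add (integrable_path v).integrableOn (integrable_path w).integrableOn
      map_smul' := fun c v => ContinuousMap.ext fun _ => integral_const_mul c v }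
    ((volume : Measure (Time T)).real univ) fun v =>
      norm_path_le (mul_nonneg measureReal_nonneg (norm_nonneg v)) fun _ => abs_setIntegral_le v _

/-- The operator `v ↦ ∫ₜᵀ v(s) ds`. -/
def tailPrimitive (T : ℝ) : Path T →L[ℝ] Path T :=
  LinearMap.mkContinuous
    { toFun := fun v => ⟨fun t => ∫ r in Ici t, v r, by
        simp only [setIntegral_Ici (integrable_path v)]
        exact continuous_const.sub (lipschitzWith_setIntegral_Iic v).continuous⟩
      map_add' := fun v w => ContinuousMap.ext fun _ =>
        integral_add (integrable_path v).integrableOn (integrable_path w).integrableOn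
      map_smul' := fun c v => ContinuousMap.ext fun _ => integral_const_mul c v }
    ((volume : Measure (Time T)).real univ) fun v =>
      norm_path_le (mul_nonneg measureReal_nonneg (norm_nonneg v)) fun _ => abs_setIntegral_le v _

theorem primitive_apply (v : Path T) (t : Time T) : primitive T v t = ∫ r in Iic t, v r := rfl

theorem tailPrimitive_apply (v : Path T) (t : Time T) :
    tailPrimitive T v t = ∫ r in Ici t, v r := rfl

theorem tailPrimitive_eq_sub (v : Path T) (t : Time T) :
    tailPrimitive T v t = (∫ r, v r) - primitive T v t := setIntegral_Ici (integrable_path v) t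

theorem primitive_mono : Monotone (primitive T) := fun v w h _ =>
  setIntegral_mono (integrable_path v).integrableOn (integrable_path w).integrableOn h

theorem tailPrimitive_mono : Monotone (tailPrimitive T) := fun v w h _ =>
  setIntegral_mono (integrable_path v).integrableOn (integrable_path w).integrableOn h

theorem norm_primitive_le [Fact (0 ≤ T)] (v : Path T) : ‖primitive T v‖ ≤ T * ‖v‖ := by
  refine (primitive T).le_of_opNorm_le ?_ v
  exact (LinearMap.mkContinuous_norm_le _ measureReal_nonneg _).trans_eq volume_real_univ

theorem norm_tailPrimitive_le [Fact (0 ≤ T)] (v : Path T) : ‖tailPrimitive T v‖ ≤ T * ‖v‖ := by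
  refine (tailPrimitive T).le_of_opNorm_le ?_ v
  exact (LinearMap.mkContinuous_norm_le _ measureReal_nonneg _).trans_eq volume_real_univ

theorem tailPrimitive_top [Fact (0 ≤ T)] (v : Path T) : tailPrimitive T v ⊤ = 0 := by
  rw [tailPrimitive_eq_sub, primitive_apply, Iic_top, setIntegral_univ, sub_self]

theorem primitive_bot [Fact (0 ≤ T)] (v : Path T) : primitive T v ⊥ = 0 := by
  rw [primitive_apply, Iic_bot]
  exact setIntegral_measure_zero _ (measure_singleton _)

theorem isCompact_setOf_lipschitzWith {α β : Type*} [PseudoMetricSpace α] [CompactSpace α]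
    [MetricSpace β] (K : NNReal) {s : Set β} (hs : IsCompact s) :
    IsCompact {f : C(α, β) | LipschitzWith K f ∧ ∀ a, f a ∈ s} := by
  refine ArzelaAscoli.isCompact_of_equicontinuous _ ?_
    (LipschitzWith.uniformEquicontinuous _ K fun f => f.2.1).equicontinuous
  have himage : ContinuousMap.toFun '' {f : C(α, β) | LipschitzWith K f ∧ ∀ a, f a ∈ s} =
      (univ.pi fun _ : α => s) ∩ {f | LipschitzWith K f} :=
    Subset.antisymm (image_subset_iff.2 fun _ hf => ⟨fun a _ => hf.2 a, hf.1⟩)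
      fun f hf => ⟨⟨f, hf.2.continuous⟩, ⟨hf.2, fun a => hf.1 a trivial⟩, rfl⟩
  rw [himage]
  refine (isCompact_univ_pi fun _ => hs).inter_right ?_
  simp only [lipschitzWith_iff_dist_le_mul, ofPred_forall]
  exact isClosed_iInter fun a => isClosed_iInter fun b =>
    isClosed_le ((continuous_apply a).dist (continuous_apply b)) continuous_const

theorem isCompactOperator_primitive : IsCompactOperator (primitive T) := by
  refine (isCompactOperator_iff_image_closedBall_subset_compact
    (primitive T : Path T →ₗ[ℝ] Path T) one_pos).2
    ⟨_, isCompact_setOf_lipschitzWith 1 (isCompact_closedBall (0 : ℝ)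
      ((volume : Measure (Time T)).real univ)), ?_⟩
  rintro _ ⟨v, hv, rfl⟩
  rw [mem_closedBall_zero_iff] at hv
  exact ⟨(lipschitzWith_setIntegral_Iic v).weaken hv, fun t => mem_closedBall_zero_iff.2 <|
    (abs_setIntegral_le v _).trans (mul_le_of_le_one_right measureReal_nonneg hv)⟩

/-- Fubini on the triangle `s ≤ t`: integration by parts against a merely integrable velocity. -/
theorem integral_tailPrimitive_mul {r : Path T} {v : Time T → ℝ} (hv : Integrable v volume) :
    ∫ s, tailPrimitive T r s * v s = ∫ t, r t * ∫ s in Iic t, v s := by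
  let triangle : Set (Time T × Time T) := {z | z.1 ≤ z.2}
  have hint : Integrable (triangle.indicator fun z => v z.1 * r z.2) (volume.prod volume) :=
    (hv.mul_prod (integrable_path r)).indicator
      (isClosed_le continuous_fst continuous_snd).measurableSet
  calc ∫ s, tailPrimitive T r s * v s
      = ∫ s, ∫ t, triangle.indicator (fun z => v z.1 * r z.2) (s, t) := by
        congr 1 with s
        rw [tailPrimitive_apply, ← integral_mul_const, ← integral_indicator measurableSet_Ici]
        congr 1 with t
        by_cases hst : s ≤ t <;> simp [triangle, indicator, hst, mul_comm]
    _ = ∫ t, ∫ s, triangle.indicator (fun z => v z.1 * r z.2) (s, t) :=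
        integral_integral_swap (f := fun s t => triangle.indicator _ (s, t)) hint
    _ = ∫ t, r t * ∫ s in Iic t, v s := by
        congr 1 with t
        rw [← integral_const_mul, ← integral_indicator measurableSet_Iic]
        congr 1 with s
        by_cases hst : s ≤ t <;> simp [triangle, indicator, hst, mul_comm]

/-! ### The boundary value problem `-x'' = r`, `x(0) = 0`, `x'(T) = 0` -/

theorem primitive_eq_intervalIntegral [hT : Fact (0 ≤ T)] (v : Path T) (t : Time T) :
    primitive T v t = ∫ s in (0 : ℝ)..t, IccExtend hT.out v s := by
  have hmap : Measure.map ((↑) : Time T → ℝ) volume = volume.restrict (Icc 0 T) :=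
    map_comap_subtype_coe measurableSet_Icc volume
  have hIcc : Iic (t : ℝ) ∩ Icc 0 T = Icc 0 (t : ℝ) :=
    ext fun z => ⟨fun h => ⟨h.2.1, h.1⟩, fun h => ⟨h.2, h.1, h.2.trans t.2.2⟩⟩
  have h := measurableEmbedding_time.setIntegral_map (μ := (volume : Measure (Time T)))
    (IccExtend hT.out v) (Iic (t : ℝ))
  rw [hmap, Measure.restrict_restrict measurableSet_Iic, hIcc, integral_Icc_eq_integral_Ioc,
    ← intervalIntegral.integral_of_le t.2.1] at h
  rw [h, primitive_apply]
  simp only [IccExtend_val]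
  rfl

/-- The path `x` is continuously differentiable with derivative `v`. One-sided derivatives at the
end points of `[0, T]` are avoided by extending `x` to a function on `ℝ`. -/
def HasVelocity (x v : Path T) : Prop :=
  ∃ F : ℝ → ℝ, (∀ t : Time T, HasDerivAt F (v t) t) ∧ ∀ t : Time T, F t = x t

namespace HasVelocity

variable {x y v w : Path T}

theorem mul (hx : HasVelocity x v) (hy : HasVelocity y w) :
    HasVelocity (x * y) (v * y + x * w) := by
  obtain ⟨F, hF, hFx⟩ := hx
  obtain ⟨G, hG, hGy⟩ := hy
  refine ⟨F * G, fun t => ?_, fun t => by simp [hFx, hGy]⟩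
  simpa [hFx, hGy] using (hF t).mul (hG t)

theorem add (hx : HasVelocity x v) (hy : HasVelocity y w) : HasVelocity (x + y) (v + w) := by
  obtain ⟨F, hF, hFx⟩ := hx
  obtain ⟨G, hG, hGy⟩ := hy
  exact ⟨F + G, fun t => (hF t).add (hG t), fun t => by simp [hFx, hGy]⟩

theorem neg (hx : HasVelocity x v) : HasVelocity (-x) (-v) := by
  obtain ⟨F, hF, hFx⟩ := hx
  exact ⟨-F, fun t => (hF t).neg, fun t => by simp [hFx]⟩

theorem sub (hx : HasVelocity x v) (hy : HasVelocity y w) : HasVelocity (x - y) (v - w) := by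
  rw [sub_eq_add_neg, sub_eq_add_neg]
  exact hx.add hy.neg

theorem le_of_nonneg (hx : HasVelocity x v) {s t : Time T} (hst : s ≤ t)
    (hv : ∀ r ∈ Ioo s t, 0 ≤ v r) : x s ≤ x t := by
  obtain ⟨F, hF, hFx⟩ := hx
  have mem_time {z : ℝ} (hz : z ∈ Icc (s : ℝ) t) : z ∈ Icc 0 T :=
    ⟨s.2.1.trans hz.1, hz.2.trans t.2.2⟩
  rw [← hFx, ← hFx]
  refine monotoneOn_of_hasDerivWithinAt_nonneg (f' := deriv F) (convex_Icc (s : ℝ) t)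
    (fun z hz => (hF ⟨z, mem_time hz⟩).continuousAt.continuousWithinAt) ?_ ?_
    (left_mem_Icc.2 hst) (right_mem_Icc.2 hst) hst
  all_goals
    rw [interior_Icc]
    intro z hz
    have hd := hF ⟨z, mem_time (Ioo_subset_Icc_self hz)⟩
  · exact hd.differentiableAt.hasDerivAt.hasDerivWithinAt
  · exact (hv ⟨z, _⟩ hz).trans_eq hd.deriv.symm

theorem lt_of_pos (hx : HasVelocity x v) {s t : Time T} (hst : s < t)
    (hv : ∀ r ∈ Ioo s t, 0 < v r) : x s < x t := by
  obtain ⟨F, hF, hFx⟩ := hx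
  have mem_time {z : ℝ} (hz : z ∈ Icc (s : ℝ) t) : z ∈ Icc 0 T :=
    ⟨s.2.1.trans hz.1, hz.2.trans t.2.2⟩
  rw [← hFx, ← hFx]
  refine strictMonoOn_of_deriv_pos (convex_Icc (s : ℝ) t)
    (fun z hz => (hF ⟨z, mem_time hz⟩).continuousAt.continuousWithinAt) (fun z hz => ?_)
    (left_mem_Icc.2 hst.le) (right_mem_Icc.2 hst.le) hst
  rw [interior_Icc] at hz
  exact (hv ⟨z, _⟩ hz).trans_eq (hF ⟨z, mem_time (Ioo_subset_Icc_self hz)⟩).deriv.symm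

theorem le_of_nonpos (hx : HasVelocity x v) {s t : Time T} (hst : s ≤ t)
    (hv : ∀ r ∈ Ioo s t, v r ≤ 0) : x t ≤ x s :=
  neg_le_neg_iff.1 (hx.neg.le_of_nonneg hst fun r hr => neg_nonneg.2 (hv r hr))

theorem eq_of_zero (hx : HasVelocity x 0) {s t : Time T} (hst : s ≤ t) : x s = x t :=
  le_antisymm (hx.le_of_nonneg hst fun _ _ => le_rfl) (hx.le_of_nonpos hst fun _ _ => le_rfl)

theorem eq_zero_of_isMaxOn (hx : HasVelocity x v) {b : Time T} (hb : IsMaxOn x univ b)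
    (h0 : 0 < (b : ℝ)) (h1 : (b : ℝ) < T) : v b = 0 := by
  obtain ⟨F, hF, hFx⟩ := hx
  refine IsLocalMax.hasDerivAt_eq_zero ?_ (hF b)
  filter_upwards [Ioo_mem_nhds h0 h1] with s hs
  have := hb (mem_univ ⟨s, hs.1.le, hs.2.le⟩)
  simpa [← hFx] using this

end HasVelocity

theorem hasVelocity_primitive [hT : Fact (0 ≤ T)] (v : Path T) :
    HasVelocity (primitive T v) v := by
  refine ⟨fun s => ∫ r in (0 : ℝ)..s, IccExtend hT.out v r, fun t => ?_,
    fun t => (primitive_eq_intervalIntegral v t).symm⟩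
  rw [← IccExtend_val hT.out v t]
  exact (v.continuous.Icc_extend'.integral_hasStrictDerivAt 0 (t : ℝ)).hasDerivAt

theorem hasVelocity_tailPrimitive [Fact (0 ≤ T)] (v : Path T) :
    HasVelocity (tailPrimitive T v) (-v) := by
  obtain ⟨F, hF, hFv⟩ := hasVelocity_primitive v
  exact ⟨fun s => (∫ r, v r) - F s, fun t => (hF t).const_sub _,
    fun t => by simp only [hFv, tailPrimitive_eq_sub]⟩

/-- Green's operator of the boundary value problem `-x'' = r`, `x(0) = 0`, `x'(T) = 0`. -/
def green (T : ℝ) : Path T →L[ℝ] Path T := (primitive T).comp (tailPrimitive T)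

theorem green_apply (r : Path T) : green T r = primitive T (tailPrimitive T r) := rfl

theorem green_mono : Monotone (green T) := primitive_mono.comp tailPrimitive_mono

theorem green_bot [Fact (0 ≤ T)] (r : Path T) : green T r ⊥ = 0 := primitive_bot _

theorem hasVelocity_green [Fact (0 ≤ T)] (r : Path T) :
    HasVelocity (green T r) (tailPrimitive T r) := hasVelocity_primitive _

theorem hasVelocity_of_eq_green [Fact (0 ≤ T)] {x r : Path T} (hx : x = green T r) :
    HasVelocity x (tailPrimitive T r) := hx ▸ hasVelocity_green r

theorem isCompactOperator_green : IsCompactOperator (green T) :=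
  isCompactOperator_primitive.comp_clm (tailPrimitive T)

theorem eq_primitive_of_hasVelocity [Fact (0 ≤ T)] {x v : Path T} (hx : HasVelocity x v)
    (h0 : x ⊥ = 0) : x = primitive T v := by
  have h := hx.sub (hasVelocity_primitive v)
  rw [sub_self] at h
  ext t
  have := h.eq_of_zero (bot_le : ⊥ ≤ t)
  simp only [ContinuousMap.sub_apply, h0, primitive_bot] at this
  linarith

theorem eq_tailPrimitive_of_hasVelocity [Fact (0 ≤ T)] {x v : Path T} (hx : HasVelocity x (-v))
    (h0 : x ⊤ = 0) : x = tailPrimitive T v := by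
  have h := hx.sub (hasVelocity_tailPrimitive v)
  rw [sub_self] at h
  ext t
  have := h.eq_of_zero (le_top : t ≤ ⊤)
  simp only [ContinuousMap.sub_apply, h0, tailPrimitive_top] at this
  linarith

theorem eq_green_of_hasVelocity [Fact (0 ≤ T)] {x g r : Path T} (hx : HasVelocity x g)
    (hg : HasVelocity g (-r)) (h0 : x ⊥ = 0) (h1 : g ⊤ = 0) : x = green T r := by
  rw [eq_primitive_of_hasVelocity hx h0, eq_tailPrimitive_of_hasVelocity hg h1, green_apply]

theorem hasVelocity_wronskian [Fact (0 ≤ T)] (r s : Path T) :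
    HasVelocity (green T s * tailPrimitive T r - green T r * tailPrimitive T s)
      (green T r * s - green T s * r) := by
  convert ((hasVelocity_green s).mul (hasVelocity_tailPrimitive r)).sub
    ((hasVelocity_green r).mul (hasVelocity_tailPrimitive s)) using 1
  ring

theorem exists_isGreatest_le (x : Path T) {a b : Time T} (hab : a ≤ b) {m : ℝ} (ha : x a ≤ m) :
    ∃ c, IsGreatest {s : Time T | s ≤ b ∧ x s ≤ m} c :=
  ((isClosed_le continuous_id continuous_const).inter
    (isClosed_le x.continuous continuous_const)).isCompact.exists_isGreatest ⟨a, hab, ha⟩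

theorem green_le_of_forall [Fact (0 ≤ T)] {x r : Path T} {m : ℝ} (hm : 0 ≤ m)
    (hx : x = green T r) (h : ∀ t, m < x t → r t ≤ 0) (t : Time T) : x t ≤ m := by
  by_contra! hlt
  have hx' : HasVelocity x (tailPrimitive T r) := hasVelocity_of_eq_green hx
  have hx0 : x ⊥ = 0 := hx ▸ green_bot r
  obtain ⟨b, -, hb⟩ := isCompact_univ.exists_isMaxOn ⟨t, mem_univ t⟩ x.continuous.continuousOn
  have hbm : m < x b := hlt.trans_le (hb (mem_univ t))
  have hgb : tailPrimitive T r b = 0 := by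
    rcases eq_top_or_lt_top b with rfl | hbT
    · exact tailPrimitive_top r
    · refine hx'.eq_zero_of_isMaxOn hb (bot_lt_iff_ne_bot.2 ?_ : ⊥ < b) hbT
      rintro rfl
      linarith
  obtain ⟨a, ⟨hab, ham⟩, ha⟩ := exists_isGreatest_le x (bot_le : ⊥ ≤ b) (hx0.trans_le hm)
  have hr : ∀ s ∈ Ioo a b, r s ≤ 0 := fun s hs =>
    h s (not_le.1 fun hs' => hs.1.not_ge (ha ⟨hs.2.le, hs'⟩))
  have hg : ∀ s ∈ Ioo a b, tailPrimitive T r s ≤ 0 := fun s hs =>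
    ((hasVelocity_tailPrimitive r).le_of_nonneg hs.2.le fun z hz =>
      neg_nonneg.2 (hr z ⟨hs.1.trans hz.1, hz.2⟩)).trans_eq hgb
  exact (hbm.trans_le (hx'.le_of_nonpos hab hg)).not_ge ham

theorem norm_le_of_eq_green [Fact (0 ≤ T)] {x r : Path T} {m : ℝ} (hm : 0 ≤ m)
    (hx : x = green T r) (h : ∀ t, m < |x t| → x t * r t ≤ 0) : ‖x‖ ≤ m := by
  have hneg : -x = green T (-r) := by rw [map_neg, ← hx]
  refine norm_path_le hm fun t => abs_le'.2
    ⟨green_le_of_forall hm hx (fun s hs => ?_) t, green_le_of_forall hm hneg (fun s hs => ?_) t⟩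
  · exact nonpos_of_mul_nonpos_right (h s (hs.trans_le (le_abs_self _))) (hm.trans_lt hs)
  · refine nonpos_of_mul_nonpos_right ?_ (hm.trans_lt hs)
    exact (neg_mul_neg _ _).trans_le (h s (hs.trans_le (neg_le_abs _)))

theorem norm_le_of_eq_green_sub_smul [Fact (0 ≤ T)] {κ : ℝ} (hκ : 0 < κ) {x r : Path T}
    (hx : x = green T (r - κ • x)) : ‖x‖ ≤ κ⁻¹ * ‖r‖ := by
  refine norm_le_of_eq_green (by positivity) hx fun t ht => ?_
  rw [inv_mul_lt_iff₀ hκ] at ht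
  calc x t * (r t - κ * x t) = x t * r t - |x t| * (κ * |x t|) := by
        rw [mul_sub, mul_left_comm |x t|, abs_mul_abs_self, mul_left_comm]
    _ ≤ |x t| * ‖r‖ - |x t| * (κ * |x t|) :=
        sub_le_sub_right ((le_abs_self _).trans ((abs_mul _ _).trans_le
          (mul_le_mul_of_nonneg_left (abs_apply_le_norm r t) (abs_nonneg _)))) _
    _ ≤ 0 := sub_nonpos.2 (mul_le_mul_of_nonneg_left ht.le (abs_nonneg _))

/-- The Jacobi equation `ẍ + c x = 0`, `x(0) = 0 = ẋ(T)`, here in integrated form, has only the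
trivial solution. -/
def IsNondegenerate (c : Path T) : Prop :=
  ∀ x : Path T, x = green T (c * x) → x = 0

theorem isNondegenerate_of_nonpos [Fact (0 ≤ T)] {c : Path T} (hc : c ≤ 0) : IsNondegenerate c :=
  fun x hx => norm_le_zero_iff.1 <| norm_le_of_eq_green le_rfl hx fun t _ => by
    rw [ContinuousMap.mul_apply, mul_left_comm]
    exact mul_nonpos_of_nonpos_of_nonneg (hc t) (mul_self_nonneg _)

theorem IsNondegenerate.surjective {c : Path T} (hc : IsNondegenerate c) :
    Function.Surjective fun x : Path T => x - green T (c * x) := by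
  intro r
  set K : Path T →L[ℝ] Path T := (green T).comp (ContinuousLinearMap.mul ℝ (Path T) c)
  have hK : IsCompactOperator K := isCompactOperator_green.comp_clm _
  rcases hK.hasEigenvalue_or_mem_resolventSet one_ne_zero with heig | hres
  · obtain ⟨x, hx⟩ := heig.exists_hasEigenvector
    exact absurd (hc x (by simpa [K] using hx.apply_eq_smul.symm)) hx.2
  · rw [spectrum.mem_resolventSet_iff] at hres
    obtain ⟨u, hu⟩ := hres
    refine ⟨(↑u⁻¹ : Path T →L[ℝ] Path T) r, ?_⟩
    simpa [K, hu] using congrArg (fun A : Path T →L[ℝ] Path T => A r) u.mul_inv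

theorem exists_eq_green_sub_smul [Fact (0 ≤ T)] {κ : ℝ} (hκ : 0 ≤ κ) (r : Path T) :
    ∃ x : Path T, x = green T (r - κ • x) := by
  have hmul (x : Path T) : ContinuousMap.const (Time T) (-κ) * x = -(κ • x) := by
    ext t
    simp
  have hκ' : ContinuousMap.const (Time T) (-κ) ≤ 0 := fun _ => neg_nonpos.2 hκ
  obtain ⟨x, hx⟩ := (isNondegenerate_of_nonpos hκ').surjective (green T r)
  exact ⟨x, by rw [sub_eq_add_neg, ← hmul, map_add, ← hx, sub_add_cancel]⟩

/-! ### The force field -/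

/-- `-½` times the derivative of `1 / (1 + x²)`. -/
def force : C(ℝ, ℝ) :=
  ⟨fun x => x / (1 + x ^ 2) ^ 2, continuous_id.div (by fun_prop) fun x => by positivity⟩

/-- The derivative of `force`. -/
def stiffness : C(ℝ, ℝ) :=
  ⟨fun x => (1 - 3 * x ^ 2) / (1 + x ^ 2) ^ 3,
    Continuous.div (by fun_prop) (by fun_prop) fun x => by positivity⟩

theorem force_apply (x : ℝ) : force x = x / (1 + x ^ 2) ^ 2 := rfl

theorem stiffness_apply (x : ℝ) : stiffness x = (1 - 3 * x ^ 2) / (1 + x ^ 2) ^ 3 := rfl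

theorem hasDerivAt_force (x : ℝ) : HasDerivAt force (stiffness x) x := by
  have hden : HasDerivAt (fun x : ℝ => (1 + x ^ 2) ^ 2) (2 * (1 + x ^ 2) * (2 * x)) x := by
    simpa using ((hasDerivAt_pow 2 x).const_add 1).fun_pow 2
  refine ((hasDerivAt_id x).div hden (by positivity)).congr_deriv ?_
  have : 1 + x ^ 2 ≠ 0 := by positivity
  simp only [stiffness_apply, id]
  field_simp
  ring

theorem hasDerivAt_stiffness (x : ℝ) :
    HasDerivAt stiffness ((12 * x ^ 3 - 12 * x) / (1 + x ^ 2) ^ 4) x := by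
  have hnum : HasDerivAt (fun x : ℝ => 1 - 3 * x ^ 2) (-(3 * (2 * x))) x := by
    simpa using ((hasDerivAt_pow 2 x).const_mul 3).const_sub 1
  have hden : HasDerivAt (fun x : ℝ => (1 + x ^ 2) ^ 3) (3 * (1 + x ^ 2) ^ 2 * (2 * x)) x := by
    simpa using ((hasDerivAt_pow 2 x).const_add 1).fun_pow 3
  refine (hnum.div hden (by positivity)).congr_deriv ?_
  have : 1 + x ^ 2 ≠ 0 := by positivity
  field_simp
  ring

theorem abs_stiffness_le (x : ℝ) : |stiffness x| ≤ 1 := by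
  rw [stiffness_apply, abs_div, abs_of_pos (by positivity : (0 : ℝ) < (1 + x ^ 2) ^ 3),
    div_le_one (by positivity), abs_le]
  have := sq_nonneg x
  constructor <;> nlinarith [pow_nonneg this 2, pow_nonneg this 3]

theorem abs_deriv_stiffness_le (x : ℝ) :
    |(12 * x ^ 3 - 12 * x) / (1 + x ^ 2) ^ 4| ≤ 12 := by
  rw [abs_div, abs_of_pos (by positivity : (0 : ℝ) < (1 + x ^ 2) ^ 4), div_le_iff₀ (by positivity)]
  have hx : |x| ≤ 1 + x ^ 2 := abs_le.2 ⟨by nlinarith, by nlinarith⟩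
  have hx' : |x ^ 2 - 1| ≤ 1 + x ^ 2 := abs_le.2 ⟨by linarith [sq_nonneg x], by linarith⟩
  calc |12 * x ^ 3 - 12 * x| = 12 * (|x| * |x ^ 2 - 1|) := by
        rw [show 12 * x ^ 3 - 12 * x = 12 * (x * (x ^ 2 - 1)) by ring, abs_mul, abs_mul,
          abs_of_pos (by norm_num : (0 : ℝ) < 12)]
    _ ≤ 12 * ((1 + x ^ 2) * (1 + x ^ 2)) := by gcongr
    _ = 12 * (1 + x ^ 2) ^ 2 := by ring
    _ ≤ 12 * (1 + x ^ 2) ^ 4 := by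
        gcongr
        · linarith [sq_nonneg x]
        · norm_num

theorem abs_force_sub_le (a b : ℝ) : |force a - force b| ≤ |a - b| := by
  simpa using convex_univ.norm_image_sub_le_of_norm_hasDerivWithin_le
    (fun x _ => (hasDerivAt_force x).hasDerivWithinAt) (fun x _ => abs_stiffness_le x)
    (mem_univ b) (mem_univ a)

theorem abs_stiffness_sub_le (a b : ℝ) : |stiffness a - stiffness b| ≤ 12 * |a - b| :=
  convex_univ.norm_image_sub_le_of_norm_hasDerivWithin_le
    (fun x _ => (hasDerivAt_stiffness x).hasDerivWithinAt) (fun x _ => abs_deriv_stiffness_le x)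
    (mem_univ b) (mem_univ a)

theorem abs_force_sub_sub_le {a b c ρ : ℝ} (ha : |a - c| ≤ ρ) (hb : |b - c| ≤ ρ) :
    |force a - force b - stiffness c * (a - b)| ≤ 12 * ρ * |a - b| := by
  have hderiv : ∀ x ∈ Metric.closedBall c ρ, HasDerivWithinAt (fun x => force x - stiffness c * x)
      (stiffness x - stiffness c) (Metric.closedBall c ρ) x := fun x _ => by
    simpa using ((hasDerivAt_force x).fun_sub
      ((hasDerivAt_id x).const_mul (stiffness c))).hasDerivWithinAt
  have hle : ∀ x ∈ Metric.closedBall c ρ, ‖stiffness x - stiffness c‖ ≤ 12 * ρ := fun x hx =>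
    (abs_stiffness_sub_le x c).trans (mul_le_mul_of_nonneg_left hx (by norm_num))
  have hsub := (convex_closedBall c ρ).norm_image_sub_le_of_norm_hasDerivWithin_le hderiv hle
    (show b ∈ _ from hb) (show a ∈ _ from ha)
  rwa [sub_sub_sub_comm, ← mul_sub] at hsub

theorem force_neg (x : ℝ) : force (-x) = -force x := by
  simp only [force_apply, neg_sq, neg_div]

theorem force_pos {x : ℝ} (hx : 0 < x) : 0 < force x := by
  rw [force_apply]
  positivity

theorem force_zero : force 0 = 0 := zero_div _

theorem force_le_one (x : ℝ) : force x ≤ 1 := by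
  rw [force_apply, div_le_one (by positivity)]
  nlinarith [sq_nonneg x, sq_nonneg (x - 1), sq_nonneg (x ^ 2)]

theorem le_force {z : ℝ} (hz : 0 ≤ z) : z * (1 - 2 * z ^ 2) ≤ force z := by
  rw [force_apply, le_div_iff₀ (by positivity), mul_assoc]
  refine mul_le_of_le_one_right hz ?_
  nlinarith [pow_nonneg hz 4, pow_nonneg hz 6]

theorem force_mul_le {l z : ℝ} (hl : 1 ≤ l) (hz : 0 ≤ z) : force (l * z) ≤ l * force z := by
  rw [force_apply, force_apply, ← mul_div_assoc]
  have : z ^ 2 ≤ (l * z) ^ 2 := pow_le_pow_left₀ hz (le_mul_of_one_le_left hz hl) 2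
  gcongr

theorem le_force_mul {l z : ℝ} (hl0 : 0 ≤ l) (hl : l ≤ 1) (hz : 0 ≤ z) :
    l * force z ≤ force (l * z) := by
  rw [force_apply, force_apply, ← mul_div_assoc]
  have : (l * z) ^ 2 ≤ z ^ 2 := pow_le_pow_left₀ (by positivity) (mul_le_of_le_one_left hz hl) 2
  gcongr

theorem stiffness_mul_lt_force {z : ℝ} (hz : 0 < z) : stiffness z * z < force z := by
  rw [force_apply, stiffness_apply, div_mul_eq_mul_div, div_lt_div_iff₀ (by positivity)
    (by positivity)]
  have : 0 < z * (1 + z ^ 2) ^ 2 * (4 * z ^ 2) := by positivity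
  nlinarith

theorem mul_force_sub_le (a b : ℝ) : (a - b) * (force a - force b) ≤ (a - b) * (a - b) :=
  (le_abs_self _).trans <| by
    rw [abs_mul, ← abs_mul_abs_self (a - b)]
    exact mul_le_mul_of_nonneg_left (abs_force_sub_le a b) (abs_nonneg _)

/-! ### Best replies -/

theorem norm_force_comp_sub_le (x x' : Path T) :
    ‖force.comp x - force.comp x'‖ ≤ ‖x - x'‖ :=
  norm_path_le (norm_nonneg _) fun t =>
    (abs_force_sub_le _ _).trans (abs_apply_le_norm (x - x') t)

theorem norm_force_comp_le_one (x : Path T) : ‖force.comp x‖ ≤ 1 :=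
  norm_path_le zero_le_one fun t => abs_le'.2
    ⟨force_le_one _, (force_neg (x t)).symm.trans_le (force_le_one _)⟩

theorem force_comp_neg (x : Path T) : force.comp (-x) = -force.comp x :=
  ContinuousMap.ext fun _ => force_neg _

/-- The Euler-Lagrange boundary value problem
`-x'' = x / (1 + x²)² + κ (η - x)`, `x(0) = 0`, `x'(T) = 0`. -/
def IsReply (κ : ℝ) (η x : Path T) : Prop := x = green T (force.comp x + κ • (η - x))

theorem sub_eq_green {x r x' r' : Path T} (hx : x = green T r) (hx' : x' = green T r') :
    x - x' = green T (r - r') := by rw [map_sub, ← hx, ← hx']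

theorem le_of_subsolution_of_supersolution [Fact (0 ≤ T)] {κ : ℝ} (hκ : 1 < κ)
    {η η' x x' r r' : Path T} (hη : η ≤ η')
    (hx : x = green T r) (hr : r ≤ force.comp x + κ • (η - x))
    (hx' : x' = green T r') (hr' : force.comp x' + κ • (η' - x') ≤ r') : x ≤ x' := by
  intro t
  refine sub_nonpos.1 (green_le_of_forall le_rfl (sub_eq_green hx hx') (fun s hs => ?_) t)
  rw [ContinuousMap.sub_apply] at hs ⊢
  have hforce := (le_abs_self _).trans (abs_force_sub_le (x s) (x' s))
  rw [abs_of_pos hs] at hforce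
  have hr : r s ≤ force (x s) + κ * (η s - x s) := hr s
  have hr' : force (x' s) + κ * (η' s - x' s) ≤ r' s := hr' s
  have hη : η s ≤ η' s := hη s
  nlinarith

theorem exists_reply [Fact (0 ≤ T)] {κ : ℝ} (hκ : 1 < κ) (η : Path T) : ∃ x, IsReply κ η x := by
  have hκ0 : 0 < κ := one_pos.trans hκ
  choose S hS using exists_eq_green_sub_smul (T := T) hκ0.le
  have hS_lip (r r' : Path T) : ‖S r - S r'‖ ≤ κ⁻¹ * ‖r - r'‖ := by
    refine norm_le_of_eq_green_sub_smul hκ0 ?_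
    rw [smul_sub, ← sub_sub_sub_comm]
    exact sub_eq_green (hS r) (hS r')
  have hcontract : ContractingWith (Real.toNNReal κ⁻¹) fun x => S (force.comp x + κ • η) := by
    refine ⟨Real.toNNReal_lt_one.2 (inv_lt_one_of_one_lt₀ hκ), LipschitzWith.of_dist_le_mul
      fun x x' => ?_⟩
    rw [Real.coe_toNNReal _ (by positivity), dist_eq_norm, dist_eq_norm]
    refine (hS_lip _ _).trans (mul_le_mul_of_nonneg_left ?_ (by positivity))
    rw [add_sub_add_right_eq_sub]
    exact norm_force_comp_sub_le x x'
  obtain ⟨x, hx⟩ : ∃ x, S (force.comp x + κ • η) = x := ⟨_, hcontract.fixedPoint_isFixedPt⟩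
  have hfix := hS (force.comp x + κ • η)
  rw [hx, add_sub_assoc, ← smul_sub] at hfix
  exact ⟨x, hfix⟩

theorem isReply_self_iff {κ : ℝ} {y : Path T} : IsReply κ y y ↔ y = green T (force.comp y) := by
  rw [IsReply, sub_self, smul_zero, add_zero]

namespace IsReply

variable [Fact (0 ≤ T)] {κ : ℝ} {η η' x x' : Path T}

theorem le_supersolution (hκ : 1 < κ) {r : Path T} (h : IsReply κ η x) (hx' : x' = green T r)
    (hr : force.comp x' + κ • (η - x') ≤ r) : x ≤ x' :=
  le_of_subsolution_of_supersolution hκ le_rfl h le_rfl hx' hr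

theorem subsolution_le (hκ : 1 < κ) {r : Path T} (h : IsReply κ η x) (hx' : x' = green T r)
    (hr : r ≤ force.comp x' + κ • (η - x')) : x' ≤ x :=
  le_of_subsolution_of_supersolution hκ le_rfl hx' hr h le_rfl

theorem mono (hκ : 1 < κ) (h : IsReply κ η x) (h' : IsReply κ η' x') (hη : η ≤ η') : x ≤ x' :=
  le_of_subsolution_of_supersolution hκ hη h le_rfl h' le_rfl

theorem unique (hκ : 1 < κ) (h : IsReply κ η x) (h' : IsReply κ η x') : x = x' :=
  le_antisymm (h.mono hκ h' le_rfl) (h'.mono hκ h le_rfl)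

theorem norm_sub_le (hκ : 1 < κ) (h : IsReply κ η x) (h' : IsReply κ η' x') :
    ‖x - x'‖ ≤ κ / (κ - 1) * ‖η - η'‖ := by
  have hκ1 : 0 < κ - 1 := sub_pos.2 hκ
  refine norm_le_of_eq_green (mul_nonneg (div_nonneg (by linarith) hκ1.le) (norm_nonneg _))
    (sub_eq_green h h') fun t ht => ?_
  rw [div_mul_eq_mul_div, div_lt_iff₀ hκ1, ContinuousMap.sub_apply] at ht
  have hforce := mul_force_sub_le (x t) (x' t)
  have hη : (x t - x' t) * (η t - η' t) ≤ |x t - x' t| * ‖η - η'‖ :=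
    (le_abs_self _).trans ((abs_mul _ _).trans_le
      (mul_le_mul_of_nonneg_left (abs_apply_le_norm (η - η') t) (abs_nonneg _)))
  simp only [ContinuousMap.sub_apply, ContinuousMap.add_apply, ContinuousMap.comp_apply,
    ContinuousMap.smul_apply, smul_eq_mul]
  nlinarith [abs_mul_abs_self (x t - x' t), abs_nonneg (x t - x' t)]

end IsReply

theorem IsReply.neg {κ : ℝ} {η x : Path T} (h : IsReply κ η x) : IsReply κ (-η) (-x) := by
  rw [IsReply, force_comp_neg, ← neg_sub', smul_neg, ← neg_add, map_neg, ← h]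

theorem exists_tendsto_of_monotone_of_isCompact {α : Type*} [TopologicalSpace α] [CompactSpace α]
    {K : Set C(α, ℝ)} (hK : IsCompact K) {u : ℕ → C(α, ℝ)} (hu : Monotone u)
    (hmem : ∀ k, u k ∈ K) : ∃ y, Filter.Tendsto u Filter.atTop (nhds y) := by
  obtain ⟨y, -, φ, hφ, hlim⟩ := hK.tendsto_subseq hmem
  refine ⟨y, ContinuousMap.tendsto_of_monotone_of_pointwise (fun i j hij x => hu hij x) fun x => ?_⟩
  refine (tendsto_iff_tendsto_subseq_of_monotone (fun i j hij => hu hij x) hφ.tendsto_atTop).2 ?_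
  exact ((continuous_eval_const x).tendsto y).comp hlim

theorem monotone_of_isReply_succ [Fact (0 ≤ T)] {κ : ℝ} (hκ : 1 < κ) {X : ℕ → Path T}
    (hX : ∀ k, IsReply κ (X k) (X (k + 1))) (h : X 0 ≤ X 1) : Monotone X :=
  monotone_nat_of_le_succ fun k => by
    induction k with
    | zero => exact h
    | succ k ih => exact (hX k).mono hκ (hX (k + 1)) ih

theorem exists_tendsto_of_isReply_succ {κ : ℝ} (hκ : 0 ≤ κ) {X : ℕ → Path T}
    (hX : ∀ k, IsReply κ (X k) (X (k + 1))) (hmono : Monotone X) {b : Path T}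
    (hb : ∀ k, X k ≤ b) : ∃ y, Filter.Tendsto (fun k => X (k + 1)) Filter.atTop (nhds y) := by
  have hsub (k : ℕ) : ‖X k - X (k + 1)‖ ≤ ‖b - X 0‖ :=
    norm_path_le (norm_nonneg _) fun t => (abs_sub_le_of_le_of_le (hmono k.zero_le t) (hb k t)
      (hmono (k + 1).zero_le t) (hb (k + 1) t)).trans
        ((le_abs_self _).trans (abs_apply_le_norm (b - X 0) t))
  refine exists_tendsto_of_monotone_of_isCompact
    (IsCompactOperator.isCompact_closure_image_closedBall (f := (green T : Path T →ₗ[ℝ] Path T))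
      isCompactOperator_green (1 + κ * ‖b - X 0‖)) (fun _ _ hij => hmono (Nat.succ_le_succ hij))
    fun k => subset_closure ⟨_, mem_closedBall_zero_iff.2 ?_, (hX k).symm⟩
  refine norm_add_le_of_le (norm_force_comp_le_one _) ?_
  rw [norm_smul, Real.norm_of_nonneg hκ]
  exact mul_le_mul_of_nonneg_left (hsub k) hκ

theorem eq_green_of_tendsto_of_isReply {κ : ℝ} {X X' : ℕ → Path T} {y : Path T}
    (hX : ∀ k, IsReply κ (X k) (X' k)) (hy : Filter.Tendsto X Filter.atTop (nhds y))
    (hy' : Filter.Tendsto X' Filter.atTop (nhds y)) : y = green T (force.comp y) := by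
  refine isReply_self_iff.1 (tendsto_nhds_unique (hy'.congr hX) ?_ : IsReply κ y y)
  exact ((green T).continuous.tendsto _).comp
    ((((ContinuousMap.continuous_postcomp force).tendsto _).comp hy').add
      ((hy.sub hy').const_smul κ))

/-- The method of sub- and supersolutions: the successive best replies starting from the moment `a`
increase to an equilibrium. -/
theorem exists_equilibrium_mem_Icc [Fact (0 ≤ T)] {a b r r' : Path T} (hab : a ≤ b)
    (ha : a = green T r) (hr : r ≤ force.comp a) (hb : b = green T r')
    (hr' : force.comp b ≤ r') : ∃ y ∈ Icc a b, y = green T (force.comp y) := by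
  obtain ⟨κ, hκ⟩ := exists_gt (1 : ℝ)
  choose Φ hΦ using exists_reply (T := T) hκ
  let X : ℕ → Path T := fun k => Φ^[k] a
  have hX (k : ℕ) : IsReply κ (X k) (X (k + 1)) := by
    rw [show X (k + 1) = Φ (X k) from Function.iterate_succ_apply' _ _ _]
    exact hΦ _
  have hmono : Monotone X := monotone_of_isReply_succ hκ hX <|
    (hX 0).subsolution_le hκ ha <| hr.trans_eq <| by
      rw [show X 0 = a from rfl, sub_self, smul_zero, add_zero]
  have hle (k : ℕ) : X k ≤ b := by
    induction k with
    | zero => exact hab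
    | succ k ih =>
      refine (hX k).le_supersolution hκ hb fun t => (add_le_of_nonpos_right ?_).trans (hr' t)
      exact mul_nonpos_of_nonneg_of_nonpos (by linarith) (sub_nonpos.2 (ih t))
  obtain ⟨y, hy⟩ := exists_tendsto_of_isReply_succ (by linarith) hX hmono hle
  have hy_apply (t : Time T) := ((continuous_eval_const t).tendsto y).comp hy
  exact ⟨y, ⟨fun t => ge_of_tendsto' (hy_apply t) fun k => hmono (k + 1).zero_le t,
      fun t => le_of_tendsto' (hy_apply t) fun k => hle (k + 1) t⟩,
    eq_green_of_tendsto_of_isReply (fun k => hX (k + 1)) hy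
      (hy.comp (Filter.tendsto_add_atTop_nat 1))⟩

/-! ### The positive equilibrium -/

/-- The frequency `ω` for which `sin (ω t)` satisfies `x'(T) = 0`. -/
def freq (T : ℝ) : ℝ := Real.pi / (2 * T)

/-- The first eigenfunction `sin (π t / (2 T))` of `-x'' = λ x`, `x(0) = 0`, `x'(T) = 0`. -/
def sine (T : ℝ) : Path T := ⟨fun t => Real.sin (freq T * t), by fun_prop⟩

theorem sine_apply (t : Time T) : sine T t = Real.sin (freq T * t) := rfl

theorem freq_mul (hT : T ≠ 0) : freq T * T = Real.pi / 2 := by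
  rw [freq]
  field_simp

theorem freq_nonneg (hT : 0 ≤ T) : 0 ≤ freq T :=
  div_nonneg Real.pi_pos.le (mul_nonneg zero_le_two hT)

theorem freq_sq_lt_one (hT : Real.pi / 2 < T) : freq T ^ 2 < 1 := by
  have hT0 : 0 < T := Real.pi_div_two_pos.trans hT
  refine pow_lt_one₀ (freq_nonneg hT0.le) ?_ two_ne_zero
  rw [freq, ← div_div, div_lt_one hT0]
  exact hT

theorem sine_eq_green (hT : 0 < T) : sine T = green T (freq T ^ 2 • sine T) := by
  have : Fact (0 ≤ T) := ⟨hT.le⟩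
  have hlin (t : ℝ) : HasDerivAt (fun s => freq T * s) (freq T) t := by
    simpa using (hasDerivAt_id t).const_mul (freq T)
  refine eq_green_of_hasVelocity (g := ⟨fun t => freq T * Real.cos (freq T * t), by fun_prop⟩)
    ⟨fun s => Real.sin (freq T * s), fun t => ?_, fun _ => rfl⟩
    ⟨fun s => freq T * Real.cos (freq T * s), fun t => ?_, fun _ => rfl⟩ ?_ ?_
  · exact (hlin t).sin.congr_deriv (mul_comm _ _)
  · refine ((hlin t).cos.const_mul (freq T)).congr_deriv ?_
    simp only [ContinuousMap.neg_apply, ContinuousMap.smul_apply, sine_apply, smul_eq_mul]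
    ring
  · exact (congrArg Real.sin (mul_zero _)).trans Real.sin_zero
  · change freq T * Real.cos (freq T * T) = 0
    rw [freq_mul hT.ne', Real.cos_pi_div_two, mul_zero]

theorem freq_mul_le_pi_div_two (hT : 0 < T) (t : Time T) : freq T * t ≤ Real.pi / 2 := by
  rw [← freq_mul hT.ne']
  exact mul_le_mul_of_nonneg_left t.2.2 (freq_nonneg hT.le)

theorem sine_nonneg (hT : 0 < T) (t : Time T) : 0 ≤ sine T t :=
  Real.sin_nonneg_of_nonneg_of_le_pi (mul_nonneg (freq_nonneg hT.le) t.2.1)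
    ((freq_mul_le_pi_div_two hT t).trans (half_le_self Real.pi_pos.le))

theorem sine_le_one (t : Time T) : sine T t ≤ 1 := Real.sin_le_one _

theorem sine_top [Fact (0 ≤ T)] (hT : T ≠ 0) : sine T ⊤ = 1 := by
  change Real.sin (freq T * T) = 1
  rw [freq_mul hT, Real.sin_pi_div_two]

theorem le_mul_sine (hT : 0 < T) (t : Time T) : (t : ℝ) ≤ T * sine T t := by
  have h := Real.mul_le_sin (mul_nonneg (freq_nonneg hT.le) t.2.1) (freq_mul_le_pi_div_two hT t)
  rwa [show 2 / Real.pi * (freq T * t) = t / T by rw [freq]; field_simp, div_le_iff₀' hT] at h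

theorem green_one_le (hT : 0 < T) : green T 1 ≤ T ^ 2 • sine T := by
  have : Fact (0 ≤ T) := ⟨hT.le⟩
  have htail : tailPrimitive T 1 ≤ ContinuousMap.const (Time T) T := fun t =>
    (le_abs_self _).trans <| (abs_apply_le_norm _ t).trans <| (norm_tailPrimitive_le 1).trans <|
      mul_le_of_le_one_right hT.le norm_path_one_le
  have hlinear : (⟨fun t => T * t, by fun_prop⟩ : Path T) = primitive T (.const (Time T) T) :=
    eq_primitive_of_hasVelocity
      ⟨fun s => T * s, fun t => by simpa using (hasDerivAt_id (t : ℝ)).const_mul T, fun _ => rfl⟩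
      (mul_zero _)
  intro t
  calc green T 1 t ≤ T * t := (primitive_mono htail t).trans_eq (by rw [← hlinear])
    _ ≤ T * (T * sine T t) := mul_le_mul_of_nonneg_left (le_mul_sine hT t) hT.le
    _ = T ^ 2 * sine T t := by ring

theorem sine_le_green_one (hT : Real.pi / 2 < T) {c : ℝ} (hc : c ≤ 1) :
    c • sine T ≤ green T 1 := by
  have hT0 : 0 < T := Real.pi_div_two_pos.trans hT
  rw [sine_eq_green hT0, ← map_smul]
  refine green_mono fun t => mul_le_one₀ hc ?_ (mul_le_one₀ ?_ (sine_nonneg hT0 t) (sine_le_one t))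
  · exact mul_nonneg (sq_nonneg _) (sine_nonneg hT0 t)
  · exact (freq_sq_lt_one hT).le

/-- The gap between `ω²` and `force'(0) = 1` is what makes small multiples of the first
eigenfunction strict subsolutions. -/
theorem exists_smul_sine_le_force (hT : Real.pi / 2 < T) : ∃ b > (0 : ℝ), ∃ d > 0,
    ∀ c, 0 ≤ c → c ≤ b → (freq T ^ 2 + d) • c • sine T ≤ force.comp (c • sine T) := by
  have hT0 : 0 < T := Real.pi_div_two_pos.trans hT
  obtain ⟨d, hd⟩ : ∃ d, d = (1 - freq T ^ 2) / 2 := ⟨_, rfl⟩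
  have hd0 : 0 < d := hd ▸ half_pos (sub_pos.2 (freq_sq_lt_one hT))
  refine ⟨√(d / 2), by positivity, d, hd0, fun c hc hcb t => ?_⟩
  have hz : 0 ≤ c * sine T t := mul_nonneg hc (sine_nonneg hT0 t)
  have hz_sq : (c * sine T t) ^ 2 ≤ d / 2 :=
    (Real.le_sqrt hz (by positivity)).1 ((mul_le_of_le_one_right hc (sine_le_one t)).trans hcb)
  calc (freq T ^ 2 + d) * (c * sine T t) = c * sine T t * (1 - d) := by rw [hd]; ring
    _ ≤ c * sine T t * (1 - 2 * (c * sine T t) ^ 2) :=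
        mul_le_mul_of_nonneg_left (by linarith) hz
    _ ≤ force (c * sine T t) := le_force hz

theorem exists_smul_sine_le_reply (hT : Real.pi / 2 < T) {κ : ℝ} (hκ : 1 < κ) :
    ∃ l > (1 : ℝ), ∃ b > (0 : ℝ), ∀ c, 0 ≤ c → l * c ≤ b → ∀ η x : Path T, IsReply κ η x →
      c • sine T ≤ η → (l * c) • sine T ≤ x := by
  have hT0 : 0 < T := Real.pi_div_two_pos.trans hT
  have : Fact (0 ≤ T) := ⟨hT0.le⟩
  have hκ0 : 0 < κ := one_pos.trans hκ
  obtain ⟨b, hb, d, hd, hsub⟩ := exists_smul_sine_le_force hT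
  obtain ⟨l, hl⟩ : ∃ l, l = 1 + d / κ := ⟨_, rfl⟩
  have hl1 : 1 < l := by rw [hl, lt_add_iff_pos_right]; positivity
  have hκl : κ * (l - 1) = d := by rw [hl]; field_simp; ring
  refine ⟨l, hl1, b, hb, fun c hc hlc η x hx hη => ?_⟩
  refine hx.subsolution_le hκ (r := (l * c) • freq T ^ 2 • sine T) ?_ fun t => ?_
  · rw [map_smul, ← sine_eq_green hT0]
  have hforce := hsub (l * c) (by positivity) hlc t
  have hηt : c * sine T t ≤ η t := hη t
  have hz : 0 ≤ c * sine T t := mul_nonneg hc (sine_nonneg hT0 t)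
  change (freq T ^ 2 + d) * (l * c * sine T t) ≤ force (l * c * sine T t) at hforce
  change l * c * (freq T ^ 2 * sine T t) ≤
    force (l * c * sine T t) + κ * (η t - l * c * sine T t)
  calc l * c * (freq T ^ 2 * sine T t)
      ≤ (freq T ^ 2 + d) * (l * c * sine T t) + κ * (c * sine T t - l * c * sine T t) := by
        have : 0 ≤ (l - 1) * d * (c * sine T t) := by
          have := sub_nonneg.2 hl1.le
          positivity
        rw [← hκl] at this ⊢
        linarith
    _ ≤ force (l * c * sine T t) + κ * (η t - l * c * sine T t) :=
        add_le_add hforce (mul_le_mul_of_nonneg_left (sub_le_sub_right hηt _) hκ0.le)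

theorem exists_forall_exists_le_norm_reply (hT : Real.pi / 2 < T) {κ : ℝ} (hκ : 1 < κ) :
    ∃ ε > (0 : ℝ), ∀ c > (0 : ℝ), ∀ η : ℕ → Path T, c • sine T ≤ η 0 →
      (∀ k, IsReply κ (η k) (η (k + 1))) → ∃ k, ε ≤ ‖η (k + 1)‖ := by
  have hT0 : 0 < T := Real.pi_div_two_pos.trans hT
  have : Fact (0 ≤ T) := ⟨hT0.le⟩
  obtain ⟨l, hl, b, hb, hgrow⟩ := exists_smul_sine_le_reply hT hκ
  have hl0 : 0 < l := by linarith
  refine ⟨b / l, by positivity, fun c hc η h0 hη => ?_⟩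
  by_contra! hsmall
  set d := min c (b / l)
  have hd : 0 < d := lt_min hc (by positivity)
  have hpow (k : ℕ) : l ^ k * d ≤ b / l ∧ (l ^ k * d) • sine T ≤ η k := by
    induction k with
    | zero =>
      rw [pow_zero, one_mul]
      exact ⟨min_le_right _ _, fun t => (mul_le_mul_of_nonneg_right (min_le_left c (b / l))
        (sine_nonneg hT0 t)).trans (h0 t)⟩
    | succ k ih =>
      have hle : l * (l ^ k * d) ≤ b := by
        rw [mul_comm, ← le_div_iff₀ hl0]
        exact ih.1
      have hnext := hgrow _ (by positivity) hle _ _ (hη k) ih.2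
      rw [← mul_assoc, ← pow_succ'] at hnext
      refine ⟨?_, hnext⟩
      calc l ^ (k + 1) * d = (l ^ (k + 1) * d) * sine T ⊤ := by rw [sine_top hT0.ne', mul_one]
        _ ≤ η (k + 1) ⊤ := hnext ⊤
        _ ≤ ‖η (k + 1)‖ := (le_abs_self _).trans (abs_apply_le_norm _ _)
        _ ≤ b / l := (hsmall k).le
  obtain ⟨n, hn⟩ := pow_unbounded_of_one_lt (b / l / d) hl
  rw [div_lt_iff₀ hd] at hn
  exact absurd (hpow n).1 (not_le.2 hn)

theorem tailPrimitive_pos [Fact (0 ≤ T)] {v : Path T} {t : Time T} (ht : t < ⊤)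
    (hv : ∀ r ∈ Ioo t ⊤, 0 < v r) : 0 < tailPrimitive T v t := by
  have h := (hasVelocity_tailPrimitive v).neg
  rw [neg_neg] at h
  have hlt := h.lt_of_pos ht hv
  rw [ContinuousMap.neg_apply, ContinuousMap.neg_apply, tailPrimitive_top, neg_lt_neg_iff] at hlt
  exact hlt

theorem strictMono_green [Fact (0 ≤ T)] {r : Path T} (hr : ∀ t, ⊥ < t → 0 < r t) :
    StrictMono (green T r) := fun _ _ hst =>
  (hasVelocity_green r).lt_of_pos hst fun _ hz =>
    tailPrimitive_pos (hz.2.trans_le le_top) fun _ hs => hr _ ((bot_le.trans_lt hz.1).trans hs.1)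

theorem abs_green_apply_le (r : Path T) (t : Time T) : |green T r t| ≤ ‖r‖ * green T 1 t := by
  have le_of_norm_le {v : Path T} (hv : ‖v‖ ≤ ‖r‖) : green T v t ≤ ‖r‖ * green T 1 t := by
    rw [← smul_eq_mul, ← ContinuousMap.smul_apply, ← map_smul]
    refine green_mono (fun s => ?_) t
    exact ((le_abs_self _).trans (abs_apply_le_norm v s)).trans
      (hv.trans_eq (mul_one ‖r‖).symm)
  refine abs_le'.2 ⟨le_of_norm_le le_rfl, ?_⟩
  rw [← ContinuousMap.neg_apply, ← map_neg]
  exact le_of_norm_le (norm_neg r).le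

/-- A solution of `-y'' = y / (1 + y²)²`, `y(0) = 0`, `y'(T) = 0` that is positive on `(0, T]`, in
the quantitative form given by Hopf's lemma: comparison with `green T 1`, which vanishes to first
order at `0`, controls the quotients by `y` near `0`. -/
structure IsPositiveEquilibrium (y : Path T) : Prop where
  eq_green : y = green T (force.comp y)
  exists_smul_green_one_le : ∃ c > (0 : ℝ), c • green T 1 ≤ y

theorem exists_isPositiveEquilibrium (hT : Real.pi / 2 < T) :
    ∃ y : Path T, IsPositiveEquilibrium y := by
  have hT0 : 0 < T := Real.pi_div_two_pos.trans hT
  have : Fact (0 ≤ T) := ⟨hT0.le⟩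
  obtain ⟨b, hb, d, hd, hsub⟩ := exists_smul_sine_le_force hT
  obtain ⟨c, hc, hc1, hcb⟩ : ∃ c > 0, c ≤ 1 ∧ c ≤ b :=
    ⟨min 1 b, lt_min one_pos hb, min_le_left _ _, min_le_right _ _⟩
  have hgreen : c • sine T = green T (freq T ^ 2 • c • sine T) := by
    rw [smul_comm, map_smul, ← sine_eq_green hT0]
  have hsource : freq T ^ 2 • c • sine T ≤ force.comp (c • sine T) := fun t =>
    (mul_le_mul_of_nonneg_right (le_add_of_nonneg_right hd.le)
      (mul_nonneg hc.le (sine_nonneg hT0 t))).trans (hsub c hc.le hcb t)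
  obtain ⟨y, ⟨hcy, -⟩, hy⟩ := exists_equilibrium_mem_Icc (sine_le_green_one hT hc1) hgreen hsource
    rfl fun t => force_le_one _
  refine ⟨y, hy, c / T ^ 2, by positivity, fun t => (?_ : _ ≤ c * sine T t).trans (hcy t)⟩
  calc c / T ^ 2 * green T 1 t ≤ c / T ^ 2 * (T ^ 2 * sine T t) :=
        mul_le_mul_of_nonneg_left (green_one_le hT0 t) (by positivity)
    _ = c * sine T t := by field_simp

namespace IsPositiveEquilibrium

variable [Fact (0 ≤ T)] {y : Path T}

theorem pos (hy : IsPositiveEquilibrium y) {t : Time T} (ht : ⊥ < t) : 0 < y t := by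
  obtain ⟨c, hc, h⟩ := hy.exists_smul_green_one_le
  have hgreen := strictMono_green (r := (1 : Path T)) (fun _ _ => one_pos) ht
  rw [green_bot] at hgreen
  exact (mul_pos hc hgreen).trans_le (h t)

theorem nonneg (hy : IsPositiveEquilibrium y) (t : Time T) : 0 ≤ y t := by
  rcases eq_bot_or_bot_lt t with rfl | h
  · rw [hy.eq_green, green_bot]
  · exact (hy.pos h).le

theorem strictMono (hy : IsPositiveEquilibrium y) : StrictMono y := by
  rw [hy.eq_green]
  exact strictMono_green fun t ht => force_pos (hy.pos ht)

variable {κ : ℝ} {η x : Path T}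

/-- The cone spanned by `y` is well behaved because `force z / z` is decreasing, so that multiples
of `y` above `y` are supersolutions and multiples below `y` are subsolutions. -/
theorem reply_mem_Icc (hκ : 1 < κ) (hy : IsPositiveEquilibrium y) {ε : ℝ} (hε : 0 ≤ ε)
    (hε1 : ε ≤ 1) (hx : IsReply κ η x) (hη : η ∈ Icc ((1 - ε) • y) ((1 + ε) • y)) :
    x ∈ Icc ((1 - ε) • y) ((1 + ε) • y) := by
  have hκ0 : 0 ≤ κ := (zero_lt_one.trans hκ).le
  have hgreen (l : ℝ) : l • y = green T (l • force.comp y) := by rw [map_smul, ← hy.eq_green]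
  constructor
  · refine hx.subsolution_le hκ (hgreen _) fun t => le_add_of_le_of_nonneg ?_ ?_
    · exact le_force_mul (sub_nonneg.2 hε1) (sub_le_self 1 hε) (hy.nonneg t)
    · exact mul_nonneg hκ0 (sub_nonneg.2 (hη.1 t))
  · refine hx.le_supersolution hκ (hgreen _) fun t => add_le_of_le_of_nonpos ?_ ?_
    · exact force_mul_le (le_add_of_nonneg_right hε) (hy.nonneg t)
    · exact mul_nonpos_of_nonneg_of_nonpos hκ0 (sub_nonpos.2 (hη.2 t))

theorem exists_abs_reply_sub_le (hκ : 1 < κ) (hy : IsPositiveEquilibrium y) :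
    ∃ C > 0, ∀ η x : Path T, IsReply κ η x → ∀ t, |x t - y t| ≤ C * ‖η - y‖ * y t := by
  have hκ0 : 0 < κ := one_pos.trans hκ
  have : 0 < κ - 1 := sub_pos.2 hκ
  obtain ⟨c, hc, hcy⟩ := hy.exists_smul_green_one_le
  obtain ⟨A, hA⟩ : ∃ A, A = (1 + κ) * (κ / (κ - 1)) + κ := ⟨_, rfl⟩
  refine ⟨A / c, by rw [hA]; positivity, fun η x hx t => ?_⟩
  have hsub := hx.norm_sub_le hκ (isReply_self_iff.2 hy.eq_green)
  have hsource : ‖force.comp x + κ • (η - x) - force.comp y‖ ≤ A * ‖η - y‖ := by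
    rw [show force.comp x + κ • (η - x) - force.comp y =
      force.comp x - force.comp y + κ • (η - y) + κ • (y - x) by module]
    calc _ ≤ ‖x - y‖ + κ * ‖η - y‖ + κ * ‖x - y‖ := by
          refine norm_add_le_of_le (norm_add_le_of_le (norm_force_comp_sub_le x y) ?_) ?_
          · rw [norm_smul, Real.norm_of_nonneg hκ0.le]
          · rw [norm_smul, Real.norm_of_nonneg hκ0.le, norm_sub_rev]
      _ = (1 + κ) * ‖x - y‖ + κ * ‖η - y‖ := by ring
      _ ≤ (1 + κ) * (κ / (κ - 1) * ‖η - y‖) + κ * ‖η - y‖ := by gcongr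
      _ = A * ‖η - y‖ := by rw [hA]; ring
  calc |x t - y t| = |green T (force.comp x + κ • (η - x) - force.comp y) t| := by
        rw [← sub_eq_green hx hy.eq_green]; rfl
    _ ≤ A * ‖η - y‖ * green T 1 t := (abs_green_apply_le _ t).trans <|
        mul_le_mul_of_nonneg_right hsource ((green_bot 1).ge.trans
          ((strictMono_green fun _ _ => one_pos).monotone bot_le))
    _ ≤ A * ‖η - y‖ * (y t / c) := by
        refine mul_le_mul_of_nonneg_left ?_ ((norm_nonneg _).trans hsource)
        rw [le_div_iff₀' hc]
        exact hcy t
    _ = A / c * ‖η - y‖ * y t := by ring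

theorem exists_forall_reply_mem_Icc (hκ : 1 < κ) (hy : IsPositiveEquilibrium y) {ε : ℝ}
    (hε : 0 < ε) : ∃ δ > 0, ∀ η x : Path T, IsReply κ η x → ‖η - y‖ < δ →
      x ∈ Icc ((1 - ε) • y) ((1 + ε) • y) := by
  obtain ⟨C, hC, h⟩ := hy.exists_abs_reply_sub_le hκ
  refine ⟨ε / C, by positivity, fun η x hx hη => ?_⟩
  have hle (t : Time T) : |x t - y t| ≤ ε * y t := (h η x hx t).trans <|
    mul_le_mul_of_nonneg_right ((lt_div_iff₀' hC).1 hη).le (hy.nonneg t)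
  constructor <;> intro t
  · exact (by linarith [neg_le_of_abs_le (hle t)] : (1 - ε) * y t ≤ x t)
  · exact (by linarith [le_of_abs_le (hle t)] : x t ≤ (1 + ε) * y t)

theorem stable (hκ : 1 < κ) (hy : IsPositiveEquilibrium y) {ε : ℝ} (hε : 0 < ε) :
    ∃ δ > 0, ∀ η : ℕ → Path T, ‖η 0 - y‖ < δ → (∀ k, IsReply κ (η k) (η (k + 1))) →
      ∀ k, ‖η (k + 1) - y‖ < ε := by
  obtain ⟨ρ, hρ, hρ1, hρε⟩ : ∃ ρ > 0, ρ ≤ 1 ∧ ρ * ‖y‖ < ε := by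
    refine ⟨min 1 (ε / (‖y‖ + 1)), by positivity, min_le_left _ _, ?_⟩
    calc min 1 (ε / (‖y‖ + 1)) * ‖y‖ ≤ ε / (‖y‖ + 1) * ‖y‖ :=
          mul_le_mul_of_nonneg_right (min_le_right _ _) (norm_nonneg y)
      _ < ε := by
          rw [div_mul_eq_mul_div, div_lt_iff₀ (by positivity)]
          exact mul_lt_mul_of_pos_left (lt_add_one _) hε
  obtain ⟨δ, hδ, hfirst⟩ := hy.exists_forall_reply_mem_Icc hκ hρ
  refine ⟨δ, hδ, fun η h0 hη k => ?_⟩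
  have hmem : η (k + 1) ∈ Icc ((1 - ρ) • y) ((1 + ρ) • y) := by
    induction k with
    | zero => exact hfirst _ _ (hη 0) h0
    | succ k ih => exact hy.reply_mem_Icc hκ hρ.le hρ1 (hη (k + 1)) ih
  refine (norm_path_le (by positivity) fun t => ?_).trans_lt hρε
  have hlower : (1 - ρ) * y t ≤ η (k + 1) t := hmem.1 t
  have hupper : η (k + 1) t ≤ (1 + ρ) * y t := hmem.2 t
  have hyt : ρ * y t ≤ ρ * ‖y‖ :=
    mul_le_mul_of_nonneg_left ((le_abs_self _).trans (abs_apply_le_norm y t)) hρ.le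
  rw [ContinuousMap.sub_apply]
  exact abs_le.2 ⟨by linarith, by linarith⟩

end IsPositiveEquilibrium

/-! ### Nondegeneracy of the equilibria -/

theorem hasVelocity_exp (a : ℝ) :
    HasVelocity (⟨fun t => Real.exp (a * t), by fun_prop⟩ : Path T)
      ⟨fun t => a * Real.exp (a * t), by fun_prop⟩ :=
  ⟨fun s => Real.exp (a * s), fun t => by
    simpa [mul_comm] using ((hasDerivAt_id (t : ℝ)).const_mul a).exp, fun _ => rfl⟩

/-- Backward uniqueness: `(x² + x'²) e^{2t}` is nondecreasing. -/
theorem eq_zero_of_eq_green_mul_of_apply_top [Fact (0 ≤ T)] {q x : Path T} (hq : ∀ t, |q t| ≤ 1)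
    (hx : x = green T (q * x)) (htop : x ⊤ = 0) : x = 0 := by
  obtain ⟨g, hg⟩ : ∃ g, g = tailPrimitive T (q * x) := ⟨_, rfl⟩
  have hxg : HasVelocity x g := hg ▸ hasVelocity_of_eq_green hx
  have hgq : HasVelocity g (-(q * x)) := hg ▸ hasVelocity_tailPrimitive _
  have henergy := ((hxg.mul hxg).add (hgq.mul hgq)).mul (hasVelocity_exp 2)
  ext t
  have hle := henergy.le_of_nonneg (le_top : t ≤ ⊤) fun s _ => by
    have hqs : |(1 - q s) * (x s * g s)| ≤ x s ^ 2 + g s ^ 2 :=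
      calc |(1 - q s) * (x s * g s)| ≤ 2 * |x s * g s| := by
            rw [abs_mul]
            exact mul_le_mul_of_nonneg_right
              ((abs_sub _ _).trans (by linarith [hq s, abs_one (α := ℝ)])) (abs_nonneg _)
        _ ≤ x s ^ 2 + g s ^ 2 := by
            rw [abs_mul, ← mul_assoc, ← sq_abs (x s), ← sq_abs (g s)]
            exact two_mul_le_add_sq _ _
    have : 0 ≤ (x s * g s * (1 - q s) + (x s ^ 2 + g s ^ 2)) * Real.exp (2 * s) :=
      mul_nonneg (by linarith [neg_le_of_abs_le hqs]) (Real.exp_pos _).le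
    simp only [ContinuousMap.add_apply, ContinuousMap.mul_apply, ContinuousMap.neg_apply,
      ContinuousMap.coe_mk]
    linarith
  simp only [ContinuousMap.add_apply, ContinuousMap.mul_apply, ContinuousMap.coe_mk, htop, hg,
    tailPrimitive_top, mul_zero, add_zero, zero_mul] at hle
  have := nonpos_of_mul_nonpos_left hle (Real.exp_pos _)
  exact mul_self_eq_zero.1 (le_antisymm (by linarith [mul_self_nonneg (tailPrimitive T (q * x) t)])
    (mul_self_nonneg _))

theorem HasVelocity.nonneg_of_forall_lt {x v : Path T} (hx : HasVelocity x v) {a b : Time T}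
    (hab : a < b) (h : ∀ t ∈ Ioo a b, x a ≤ x t) : 0 ≤ v a := by
  obtain ⟨F, hF, hFx⟩ := hx
  have hslope := (hF a).hasDerivWithinAt (s := Ioi (a : ℝ))
  rw [hasDerivWithinAt_iff_tendsto_slope' self_notMem_Ioi] at hslope
  refine ge_of_tendsto hslope ?_
  filter_upwards [Ioo_mem_nhdsGT (show (a : ℝ) < b from hab)] with s hs
  have hle := h ⟨s, a.2.1.trans hs.1.le, hs.2.le.trans b.2.2⟩ hs
  rw [← hFx, ← hFx] at hle
  rw [slope_def_field]
  exact div_nonneg (sub_nonneg.2 hle) (sub_pos.2 hs.1).le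

/-- Sturm comparison: `stiffness y < force y / y`, so on the last interval on which `x > 0` the
Wronskian of `x` and `y` would increase strictly from a nonnegative value to `0`. -/
theorem IsPositiveEquilibrium.apply_top_nonpos [Fact (0 ≤ T)] {y x : Path T}
    (hy : IsPositiveEquilibrium y) (hx : x = green T (stiffness.comp y * x)) : x ⊤ ≤ 0 := by
  by_contra! hpos
  obtain ⟨a, ⟨-, ha⟩, hlast⟩ := exists_isGreatest_le x (bot_le : ⊥ ≤ ⊤)
    (hx ▸ (green_bot _).le : x ⊥ ≤ 0)
  have hatop : a < ⊤ := lt_top_iff_ne_top.2 (by rintro rfl; exact ha.not_gt hpos)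
  have hx_pos : ∀ s, a < s → 0 < x s := fun s hs => not_le.1 fun h => hs.not_ge (hlast ⟨le_top, h⟩)
  have hy_pos : ∀ s, a < s → 0 < y s := fun s hs => hy.pos (bot_le.trans_lt hs)
  obtain ⟨x', hx'⟩ : ∃ x', x' = tailPrimitive T (stiffness.comp y * x) := ⟨_, rfl⟩
  obtain ⟨y', hy'⟩ : ∃ y', y' = tailPrimitive T (force.comp y) := ⟨_, rfl⟩
  have hx'a : 0 ≤ x' a := by
    rw [hx']
    exact (hasVelocity_of_eq_green hx).nonneg_of_forall_lt hatop fun s hs =>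
      ha.trans (hx_pos s hs.1).le
  have hy'a : 0 < y' a := by
    rw [hy']
    exact tailPrimitive_pos hatop fun s hs => force_pos (hy_pos s hs.1)
  have hwronskian := hasVelocity_wronskian (stiffness.comp y * x) (force.comp y)
  rw [← hx, ← hy.eq_green, ← hx', ← hy'] at hwronskian
  have hlt := hwronskian.lt_of_pos hatop fun s hs => by
    have := mul_pos (hx_pos s hs.1) (sub_pos.2 (stiffness_mul_lt_force (hy_pos s hs.1)))
    change 0 < x s * force (y s) - y s * (stiffness (y s) * x s)
    linarith
  simp only [ContinuousMap.sub_apply, ContinuousMap.mul_apply, hx', hy', tailPrimitive_top] at hlt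
  rw [← hx', ← hy'] at hlt
  linarith [mul_nonneg (hy.nonneg a) hx'a, mul_nonpos_of_nonpos_of_nonneg ha hy'a.le]

theorem IsPositiveEquilibrium.isNondegenerate [Fact (0 ≤ T)] {y : Path T}
    (hy : IsPositiveEquilibrium y) : IsNondegenerate (stiffness.comp y) := by
  refine fun x hx => eq_zero_of_eq_green_mul_of_apply_top (fun t => abs_stiffness_le _) hx
    (le_antisymm (hy.apply_top_nonpos hx) (neg_nonpos.1 ?_))
  refine hy.apply_top_nonpos (x := -x) ?_
  rw [mul_neg, map_neg, ← hx]

theorem isNondegenerate_one [Fact (0 ≤ T)] (hcos : Real.cos T ≠ 0) :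
    IsNondegenerate (1 : Path T) := by
  intro x hx
  rw [one_mul] at hx
  let cosine : Path T := ⟨fun t => Real.cos t, by fun_prop⟩
  let sine : Path T := ⟨fun t => Real.sin t, by fun_prop⟩
  have hcosine : HasVelocity cosine (-sine) :=
    ⟨Real.cos, fun t => Real.hasDerivAt_cos t, fun _ => rfl⟩
  have hsine : HasVelocity sine cosine := ⟨Real.sin, fun t => Real.hasDerivAt_sin t, fun _ => rfl⟩
  have hconst :=
    ((hasVelocity_of_eq_green hx).mul hcosine).sub ((hasVelocity_tailPrimitive x).mul hsine)
  rw [show tailPrimitive T x * cosine + x * -sine - (-x * sine + tailPrimitive T x * cosine) = 0 by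
    ring] at hconst
  have heq := hconst.eq_of_zero (bot_le : (⊥ : Time T) ≤ ⊤)
  have hx0 : x ⊥ = 0 := hx ▸ green_bot x
  have hsin0 : sine ⊥ = 0 := Real.sin_zero
  simp only [ContinuousMap.sub_apply, ContinuousMap.mul_apply, tailPrimitive_top, hx0, hsin0,
    zero_mul, mul_zero, sub_zero] at heq
  refine eq_zero_of_eq_green_mul_of_apply_top (q := 1) (fun t => abs_one.le) ?_
    ((mul_eq_zero.1 heq.symm).resolve_right hcos)
  rwa [one_mul]

/-! ### Small perturbations -/

/-- `N` is bounded by `c` and Lipschitz with constant `c` on `S`: the form in which perturbations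
of the data, and of the optimality system, are estimated. -/
structure IsSmallOn {Z E : Type*} [NormedAddCommGroup Z] [NormedAddCommGroup E] (c : ℝ)
    (N : Z → E) (S : Set Z) : Prop where
  norm_le : ∀ z ∈ S, ‖N z‖ ≤ c
  norm_sub_le : ∀ z ∈ S, ∀ z' ∈ S, ‖N z - N z'‖ ≤ c * ‖z - z'‖

namespace IsSmallOn
variable {Z E E' : Type*} [NormedAddCommGroup Z] [NormedAddCommGroup E] [NormedAddCommGroup E']
  {c c' : ℝ} {N M : Z → E} {S : Set Z}

theorem zero (hc : 0 ≤ c) : IsSmallOn c (0 : Z → E) S where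
  norm_le _ _ := by simpa
  norm_sub_le z _ z' _ := by
    rw [Pi.zero_apply, Pi.zero_apply, sub_self, norm_zero]
    positivity

theorem lipschitzOnWith (h : IsSmallOn c N S) : LipschitzOnWith c.toNNReal N S :=
  .of_dist_le_mul fun z hz z' hz' => by
    rw [dist_eq_norm, dist_eq_norm]
    exact (h.norm_sub_le z hz z' hz').trans
      (mul_le_mul_of_nonneg_right (Real.le_coe_toNNReal c) (norm_nonneg _))

theorem continuousOn (h : IsSmallOn c N S) : ContinuousOn N S := h.lipschitzOnWith.continuousOn

theorem continuous (h : IsSmallOn c N univ) : Continuous N := continuousOn_univ.1 h.continuousOn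

theorem subset {S' : Set Z} (h : IsSmallOn c N S) (hS : S' ⊆ S) : IsSmallOn c N S' where
  norm_le z hz := h.norm_le z (hS hz)
  norm_sub_le z hz z' hz' := h.norm_sub_le z (hS hz) z' (hS hz')

theorem weaken (h : IsSmallOn c N S) (hcc' : c ≤ c') : IsSmallOn c' N S where
  norm_le z hz := (h.norm_le z hz).trans hcc'
  norm_sub_le z hz z' hz' := (h.norm_sub_le z hz z' hz').trans
    (mul_le_mul_of_nonneg_right hcc' (norm_nonneg _))

theorem neg (h : IsSmallOn c N S) : IsSmallOn c (fun z => -N z) S where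
  norm_le z hz := (norm_neg _).trans_le (h.norm_le z hz)
  norm_sub_le z hz z' hz' := by
    rw [neg_sub_neg, norm_sub_rev]
    exact h.norm_sub_le z hz z' hz'

theorem add (h : IsSmallOn c N S) (h' : IsSmallOn c' M S) :
    IsSmallOn (c + c') (fun z => N z + M z) S where
  norm_le z hz := norm_add_le_of_le (h.norm_le z hz) (h'.norm_le z hz)
  norm_sub_le z hz z' hz' := by
    rw [add_sub_add_comm, add_mul]
    exact norm_add_le_of_le (h.norm_sub_le z hz z' hz') (h'.norm_sub_le z hz z' hz')

theorem prodMk {M : Z → E'} (h : IsSmallOn c N S) (h' : IsSmallOn c M S) :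
    IsSmallOn c (fun z => (N z, M z)) S where
  norm_le z hz := max_le (h.norm_le z hz) (h'.norm_le z hz)
  norm_sub_le z hz z' hz' := max_le (h.norm_sub_le z hz z' hz') (h'.norm_sub_le z hz z' hz')

theorem clm_comp [NormedSpace ℝ E] [NormedSpace ℝ E'] {K : ℝ} (h : IsSmallOn c N S)
    (L : E →L[ℝ] E') (hK : 0 ≤ K) (hL : ∀ v, ‖L v‖ ≤ K * ‖v‖) :
    IsSmallOn (K * c) (fun z => L (N z)) S where
  norm_le z hz := (hL _).trans (mul_le_mul_of_nonneg_left (h.norm_le z hz) hK)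
  norm_sub_le z hz z' hz' := by
    rw [← map_sub, mul_assoc]
    exact (hL _).trans (mul_le_mul_of_nonneg_left (h.norm_sub_le z hz z' hz') hK)

theorem comp {Z' : Type*} [NormedAddCommGroup Z'] {ι : Z' → Z} {S' : Set Z'}
    (h : IsSmallOn c N S) (hc : 0 ≤ c) (hmaps : MapsTo ι S' S)
    (hι : ∀ z z', ‖ι z - ι z'‖ ≤ ‖z - z'‖) : IsSmallOn c (fun z => N (ι z)) S' where
  norm_le _ hz := h.norm_le _ (hmaps hz)
  norm_sub_le z hz z' hz' := (h.norm_sub_le _ (hmaps hz) _ (hmaps hz')).trans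
    (mul_le_mul_of_nonneg_left (hι z z') hc)

theorem mul {R : Type*} [NormedRing R] {q N : Z → R} {P : ℝ} (h : IsSmallOn c N S)
    (hq : ∀ z ∈ S, ‖q z‖ ≤ P) (hq_lip : ∀ z z', ‖q z - q z'‖ ≤ ‖z - z'‖) :
    IsSmallOn ((P + 1) * c) (fun z => q z * N z) S where
  norm_le z hz := by
    have hP : 0 ≤ P := (norm_nonneg _).trans (hq z hz)
    have hc : 0 ≤ c := (norm_nonneg _).trans (h.norm_le z hz)
    calc ‖q z * N z‖ ≤ ‖q z‖ * ‖N z‖ := norm_mul_le _ _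
      _ ≤ P * c := mul_le_mul (hq z hz) (h.norm_le z hz) (norm_nonneg _) hP
      _ ≤ (P + 1) * c := by gcongr; exact le_add_of_nonneg_right zero_le_one
  norm_sub_le z hz z' hz' := by
    have hP : 0 ≤ P := (norm_nonneg _).trans (hq z hz)
    calc ‖q z * N z - q z' * N z'‖ = ‖q z * (N z - N z') + (q z - q z') * N z'‖ := by
          congr 1; noncomm_ring
      _ ≤ ‖q z‖ * ‖N z - N z'‖ + ‖q z - q z'‖ * ‖N z'‖ :=
        norm_add_le_of_le (norm_mul_le _ _) (norm_mul_le _ _)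
      _ ≤ P * (c * ‖z - z'‖) + ‖z - z'‖ * c :=
        add_le_add (mul_le_mul (hq z hz) (h.norm_sub_le z hz z' hz') (norm_nonneg _) hP)
          (mul_le_mul (hq_lip z z') (h.norm_le z' hz') (norm_nonneg _) (norm_nonneg _))
      _ = (P + 1) * c * ‖z - z'‖ := by ring

theorem clm_apply [NormedSpace ℝ E] [NormedSpace ℝ E'] {D : Z → E →L[ℝ] E'}
    (h : IsSmallOn c D S) {v : E} (hv : ‖v‖ ≤ 1) : IsSmallOn c (fun z => D z v) S where
  norm_le z hz := ((D z).le_of_opNorm_le (h.norm_le z hz) v).trans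
    (mul_le_of_le_one_right ((norm_nonneg _).trans (h.norm_le z hz)) hv)
  norm_sub_le z hz z' hz' := by
    have hle := h.norm_sub_le z hz z' hz'
    exact ((D z - D z').le_of_opNorm_le hle v).trans
      (mul_le_of_le_one_right ((norm_nonneg _).trans hle) hv)

end IsSmallOn

/-- `g` is differentiable on `S`, and `g` and its derivative are small in the sense of
`IsSmallOn`. -/
structure IsC2Small {E : Type*} [NormedAddCommGroup E] [NormedSpace ℝ E] (c : ℝ) (g : E → ℝ)
    (S : Set E) : Prop where
  differentiableOn : DifferentiableOn ℝ g S
  isSmallOn : IsSmallOn c g S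
  isSmallOn_fderivWithin : IsSmallOn c (fderivWithin ℝ g S) S

section C2
variable {E : Type*} [NormedAddCommGroup E] [NormedSpace ℝ E] {S : Set E} {c : ℝ}

theorem IsC2Small.zero (hc : 0 ≤ c) : IsC2Small c (0 : E → ℝ) S where
  differentiableOn := differentiableOn_const 0
  isSmallOn := .zero hc
  isSmallOn_fderivWithin := by
    rw [fderivWithin_zero]
    exact .zero hc

theorem IsC2Small.abs_sub_sub_le {g : E → ℝ} (h : IsC2Small c g S) (hS : Convex ℝ S) {z z' : E}
    (hz : z ∈ S) (hz' : z' ∈ S) :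
    |g z' - g z - fderivWithin ℝ g S z (z' - z)| ≤ c * ‖z' - z‖ ^ 2 := by
  have hsub : segment ℝ z z' ⊆ S := hS.segment_subset hz hz'
  have hc : 0 ≤ c := (norm_nonneg _).trans (h.isSmallOn.norm_le z hz)
  rw [sq, ← mul_assoc, ← Real.norm_eq_abs]
  refine (convex_segment z z').norm_image_sub_le_of_norm_hasFDerivWithin_le'
    (fun w hw => ((h.differentiableOn w (hsub hw)).hasFDerivWithinAt).mono hsub) (fun w hw => ?_)
    (left_mem_segment ℝ z z') (right_mem_segment ℝ z z')
  exact (h.isSmallOn_fderivWithin.norm_sub_le w (hsub hw) z hz).trans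
    (mul_le_mul_of_nonneg_left (norm_sub_le_of_mem_segment hw) hc)

theorem isSmallOn_of_norm_fderivWithin_le {F : Type*} [NormedAddCommGroup F] [NormedSpace ℝ F]
    {g : E → F} (hS : Convex ℝ S) (hg : DifferentiableOn ℝ g S) (h : ∀ z ∈ S, ‖g z‖ ≤ c)
    (h' : ∀ z ∈ S, ‖fderivWithin ℝ g S z‖ ≤ c) : IsSmallOn c g S where
  norm_le := h
  norm_sub_le _ hz _ hz' := hS.norm_image_sub_le_of_norm_fderivWithin_le hg h' hz' hz

theorem IsC2Near.isC2Small (hS : UniqueDiffOn ℝ S) (hconv : Convex ℝ S) {g h : E → ℝ}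
    (hg : IsC2Near S g h c) (hh : ContDiffOn ℝ 2 h S) : IsC2Small c (fun z => g z - h z) S := by
  obtain ⟨hgC, r, hrc, hr⟩ := hg
  have hC : ContDiffOn ℝ 2 (fun z => g z - h z) S := hgC.sub hh
  have hd : DifferentiableOn ℝ (fun z => g z - h z) S := hC.differentiableOn (by norm_num)
  have hfderiv : ∀ z ∈ S, ‖fderivWithin ℝ (fun z => g z - h z) S z‖ ≤ c := fun z hz => by
    rw [← norm_iteratedFDerivWithin_one _ (hS z hz)]
    exact (hr 1 one_le_two z hz).trans hrc.le
  refine ⟨hd, isSmallOn_of_norm_fderivWithin_le hconv hd (fun z hz => ?_) hfderiv,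
    isSmallOn_of_norm_fderivWithin_le hconv
      ((hC.fderivWithin hS (m := 1) (by norm_num)).differentiableOn (by norm_num)) hfderiv
      fun z hz => ?_⟩
  · have h₀ := hr 0 zero_le_two z hz
    rw [norm_iteratedFDerivWithin_zero] at h₀
    exact h₀.trans hrc.le
  · rw [← norm_iteratedFDerivWithin_one _ (hS z hz), norm_iteratedFDerivWithin_fderivWithin hS hz]
    exact (hr 2 le_rfl z hz).trans hrc.le

end C2

/-- `[0, T] × E`, the domain of the data of a game, with `E` a space of values `(x, u, η)`
or `x`. -/
def strip (T : ℝ) (E : Type*) : Set (ℝ × E) := Icc (0 : ℝ) T ×ˢ univ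

section Strip
variable {E : Type*}

theorem mem_strip (t : Time T) (v : E) : ((t : ℝ), v) ∈ strip T E := ⟨t.2, trivial⟩

variable [NormedAddCommGroup E] [NormedSpace ℝ E]

theorem convex_strip : Convex ℝ (strip T E) := (convex_Icc 0 T).prod convex_univ

theorem uniqueDiffOn_strip (hT : 0 < T) : UniqueDiffOn ℝ (strip T E) :=
  (uniqueDiffOn_Icc hT).prod uniqueDiffOn_univ

end Strip

/-- The superposition operator `v ↦ g(t, v(t))`. -/
def superpose {E : Type*} [TopologicalSpace E] {g : ℝ × E → ℝ} (hg : ContinuousOn g (strip T E))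
    (v : C(Time T, E)) : Path T :=
  ⟨fun t => g (t, v t), hg.comp_continuous (by fun_prop) fun t => mem_strip t _⟩

theorem IsSmallOn.superpose {E : Type*} [NormedAddCommGroup E] {c : ℝ} (hc : 0 ≤ c)
    {g : ℝ × E → ℝ} (h : IsSmallOn c g (strip T E)) :
    IsSmallOn c (superpose h.continuousOn) univ where
  norm_le v _ := norm_path_le hc fun t => h.norm_le _ (mem_strip t _)
  norm_sub_le v _ v' _ := norm_path_le (by positivity) fun t =>
    (h.norm_sub_le _ (mem_strip t _) _ (mem_strip t _)).trans <| by
      rw [Prod.mk_sub_mk, sub_self]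
      exact mul_le_mul_of_nonneg_left
        (max_le (norm_zero.trans_le (norm_nonneg _)) ((v - v').norm_coe_le_norm t)) hc

/-! ### Perturbations of the barycenter game -/

/-- The running cost of the barycenter game at `(t, x, u, η)`. -/
def runningCost (κ : ℝ) (z : ℝ × ℝ × ℝ × ℝ) : ℝ :=
  z.2.2.1 ^ 2 + 1 / (1 + z.2.1 ^ 2) + κ * (z.2.1 - z.2.2.2) ^ 2

theorem contDiff_runningCost (κ : ℝ) {n : WithTop ℕ∞} : ContDiff ℝ n (runningCost κ) :=
  .add (.add (by fun_prop) (contDiff_const.div (by fun_prop) fun z => by positivity))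
    (by fun_prop)

namespace ScalarGame

/-- The deviation of the dynamics of `G` from `ẋ = u`. -/
def dynamicsDefect (G : ScalarGame T) (z : ℝ × ℝ × ℝ × ℝ) : ℝ :=
  G.f z.1 z.2.1 z.2.2.1 z.2.2.2 - z.2.2.1

/-- The deviation of the running cost of `G` from that of the barycenter game. -/
def costDefect (κ : ℝ) (G : ScalarGame T) (z : ℝ × ℝ × ℝ × ℝ) : ℝ :=
  G.L z.1 z.2.1 z.2.2.1 z.2.2.2 - runningCost κ z

/-- The deviation of the moment function of `G` from `φ(t, x) = x`. -/
def momentDefect (G : ScalarGame T) (z : ℝ × ℝ) : ℝ := G.φ z.1 z.2 - z.2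

theorem f_eq (G : ScalarGame T) (t x u η : ℝ) :
    G.f t x u η = u + G.dynamicsDefect (t, x, u, η) := (add_sub_cancel _ _).symm

theorem L_eq (κ : ℝ) (G : ScalarGame T) (t x u η : ℝ) :
    G.L t x u η = runningCost κ (t, x, u, η) + G.costDefect κ (t, x, u, η) :=
  (add_sub_cancel _ _).symm

theorem φ_eq (G : ScalarGame T) (t x : ℝ) : G.φ t x = x + G.momentDefect (t, x) :=
  (add_sub_cancel _ _).symm

end ScalarGame

/-- The data of `G` differ from those of the barycenter game, initial datum apart, by
perturbations of size `δ` in `𝒞²`. -/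
structure IsPerturbation (κ δ : ℝ) (G : ScalarGame T) : Prop where
  dynamics : IsC2Small δ G.dynamicsDefect (strip T (ℝ × ℝ × ℝ))
  cost : IsC2Small δ (G.costDefect κ) (strip T (ℝ × ℝ × ℝ))
  terminal : IsC2Small δ G.ψ univ
  moment : IsC2Small δ G.momentDefect (strip T ℝ)

theorem IsPerturbation.nonneg {κ δ : ℝ} {G : ScalarGame T} (hG : IsPerturbation κ δ G) : 0 ≤ δ :=
  (norm_nonneg _).trans (hG.terminal.isSmallOn.norm_le 0 trivial)

section BarycenterGame
variable {κ δ : ℝ} {hT : 0 ≤ T}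

theorem barycenterGame_L_eq (t x u η : ℝ) :
    (barycenterGame κ T hT).L t x u η = runningCost κ (t, x, u, η) := by
  simp only [barycenterGame, runningCost, sq_abs]

theorem ScalarGame.IsNear.isPerturbation {G : ScalarGame T} (hT0 : 0 < T)
    (h : (barycenterGame κ T hT).IsNear G δ) : IsPerturbation κ δ G where
  dynamics := h.f_near.isC2Small (uniqueDiffOn_strip hT0) convex_strip
    (ContDiff.contDiffOn (by simp only [barycenterGame]; fun_prop))
  cost := by
    have hL := h.L_near
    simp only [barycenterGame_L_eq] at hL
    exact hL.isC2Small (uniqueDiffOn_strip hT0) convex_strip (contDiff_runningCost κ).contDiffOn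
  terminal := by
    simpa only [barycenterGame, sub_zero] using
      h.ψ_near.isC2Small uniqueDiffOn_univ convex_univ contDiffOn_const
  moment := h.φ_near.isC2Small (uniqueDiffOn_strip hT0) convex_strip
    (ContDiff.contDiffOn (by simp only [barycenterGame]; fun_prop))

theorem dynamicsDefect_barycenterGame : (barycenterGame κ T hT).dynamicsDefect = 0 :=
  funext fun _ => sub_self _

theorem costDefect_barycenterGame : (barycenterGame κ T hT).costDefect κ = 0 :=
  funext fun _ => sub_eq_zero.2 (barycenterGame_L_eq _ _ _ _)

theorem momentDefect_barycenterGame : (barycenterGame κ T hT).momentDefect = 0 :=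
  funext fun _ => sub_self _

theorem isPerturbation_barycenterGame : IsPerturbation κ 0 (barycenterGame κ T hT) where
  dynamics := dynamicsDefect_barycenterGame ▸ .zero le_rfl
  cost := costDefect_barycenterGame ▸ .zero le_rfl
  terminal := .zero le_rfl
  moment := momentDefect_barycenterGame ▸ .zero le_rfl

end BarycenterGame

/-- The partial derivative of `g(t, x, u, η)` with respect to the state `x`. -/
def stateDeriv (T : ℝ) (g : ℝ × ℝ × ℝ × ℝ → ℝ) (z : ℝ × ℝ × ℝ × ℝ) : ℝ :=
  fderivWithin ℝ g (strip T (ℝ × ℝ × ℝ)) z (0, 1, 0, 0)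

/-- The partial derivative of `g(t, x, u, η)` with respect to the control `u`. -/
def controlDeriv (T : ℝ) (g : ℝ × ℝ × ℝ × ℝ → ℝ) (z : ℝ × ℝ × ℝ × ℝ) : ℝ :=
  fderivWithin ℝ g (strip T (ℝ × ℝ × ℝ)) z (0, 0, 1, 0)

section IncrementBounds
variable {c : ℝ} {g : ℝ × ℝ × ℝ × ℝ → ℝ}

theorem IsC2Small.isSmallOn_stateDeriv (h : IsC2Small c g (strip T (ℝ × ℝ × ℝ))) :
    IsSmallOn c (stateDeriv T g) (strip T (ℝ × ℝ × ℝ)) :=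
  h.isSmallOn_fderivWithin.clm_apply (by simp)

theorem IsC2Small.isSmallOn_controlDeriv (h : IsC2Small c g (strip T (ℝ × ℝ × ℝ))) :
    IsSmallOn c (controlDeriv T g) (strip T (ℝ × ℝ × ℝ)) :=
  h.isSmallOn_fderivWithin.clm_apply (by simp)

theorem IsC2Small.abs_increment_sub_le (h : IsC2Small c g (strip T (ℝ × ℝ × ℝ))) (t : Time T)
    (x x' u u' η : ℝ) :
    |g (t, x', u', η) - g (t, x, u, η) - ((x' - x) * stateDeriv T g (t, x, u, η) +
      (u' - u) * controlDeriv T g (t, x, u, η))| ≤ c * ((x' - x) ^ 2 + (u' - u) ^ 2) := by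
  have hc : 0 ≤ c := (norm_nonneg _).trans (h.isSmallOn.norm_le _ (mem_strip t (x, u, η)))
  have hincr : ((t : ℝ), x', u', η) - ((t : ℝ), x, u, η) =
      (x' - x) • ((0, 1, 0, 0) : ℝ × ℝ × ℝ × ℝ) + (u' - u) • (0, 0, 1, 0) := by simp
  have hnorm : ‖((t : ℝ), x', u', η) - ((t : ℝ), x, u, η)‖ = max |x' - x| |u' - u| := by
    simp [Prod.norm_def]
  have htaylor := h.abs_sub_sub_le convex_strip (mem_strip t (x, u, η)) (mem_strip t (x', u', η))
  rw [hnorm, hincr, map_add, map_smul, map_smul] at htaylor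
  refine htaylor.trans (mul_le_mul_of_nonneg_left ?_ hc)
  rw [← sq_abs (x' - x), ← sq_abs (u' - u)]
  rcases max_choice |x' - x| |u' - u| with hmax | hmax <;> rw [hmax]
  exacts [le_add_of_nonneg_right (sq_nonneg _), le_add_of_nonneg_left (sq_nonneg _)]

theorem IsSmallOn.abs_increment_le (h : IsSmallOn c g (strip T (ℝ × ℝ × ℝ))) (t : Time T)
    (x x' u u' η : ℝ) :
    |g (t, x', u', η) - g (t, x, u, η)| ≤ c * (|x' - x| + |u' - u|) := by
  have hc : 0 ≤ c := (norm_nonneg _).trans (h.norm_le _ (mem_strip t (x, u, η)))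
  refine (h.norm_sub_le _ (mem_strip t (x', u', η)) _ (mem_strip t (x, u, η))).trans
    (mul_le_mul_of_nonneg_left ?_ hc)
  simp [Prod.norm_def]

end IncrementBounds

theorem one_div_one_add_sq_sub_ge (a b : ℝ) :
    -(b - a) ^ 2 ≤ 1 / (1 + b ^ 2) - 1 / (1 + a ^ 2) + 2 * force a * (b - a) := by
  have hfactor : 1 / (1 + b ^ 2) - 1 / (1 + a ^ 2) + 2 * force a * (b - a) + (b - a) ^ 2 =
      (b - a) ^ 2 * ((1 + a ^ 2) ^ 2 * (1 + b ^ 2) - (1 - 2 * a * b - a ^ 2)) /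
        ((1 + a ^ 2) ^ 2 * (1 + b ^ 2)) := by
    rw [force_apply]
    field_simp
    ring
  have hnum : 0 ≤ (1 + a ^ 2) ^ 2 * (1 + b ^ 2) - (1 - 2 * a * b - a ^ 2) := by
    nlinarith [sq_nonneg (a + b), sq_nonneg a, sq_nonneg b, sq_nonneg (a * b), sq_nonneg (a ^ 2),
      sq_nonneg (a ^ 2 * b)]
  have : 0 ≤ (b - a) ^ 2 * ((1 + a ^ 2) ^ 2 * (1 + b ^ 2) - (1 - 2 * a * b - a ^ 2)) /
      ((1 + a ^ 2) ^ 2 * (1 + b ^ 2)) := by positivity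
  linarith

theorem sq_integral_le {Ω : Type*} [MeasurableSpace Ω] {μ : Measure Ω} [IsFiniteMeasure μ]
    {w : Ω → ℝ} (hw : Integrable w μ) (hw2 : Integrable (fun t => w t ^ 2) μ) :
    (∫ t, w t ∂μ) ^ 2 ≤ μ.real univ * ∫ t, w t ^ 2 ∂μ := by
  have hquad (s : ℝ) : 0 ≤ μ.real univ * (s * s) + -2 * (∫ t, w t ∂μ) * s + ∫ t, w t ^ 2 ∂μ :=
    calc 0 ≤ ∫ t, (w t ^ 2 - 2 * s * w t + s ^ 2) ∂μ :=
          integral_nonneg fun t => (sq_nonneg (w t - s)).trans_eq (by ring)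
      _ = μ.real univ * (s * s) + -2 * (∫ t, w t ∂μ) * s + ∫ t, w t ^ 2 ∂μ := by
          rw [integral_add (f := fun t => w t ^ 2 - 2 * s * w t) (hw2.sub (hw.const_mul _))
            (integrable_const _), integral_sub hw2 (hw.const_mul _), integral_const_mul,
            integral_const, smul_eq_mul]
          ring
  have := discrim_le_zero hquad
  rw [discrim] at this
  linarith

/-! ### Sufficiency of the Pontryagin conditions -/

/-- The Pontryagin system of a player starting at `a`: `x` is the state, `u` the control and `p`
the costate. The path `ρ` is `-p'`, so that the costate equation is in integrated form. -/
structure IsExtremal [Fact (0 ≤ T)] (κ : ℝ) (G : ScalarGame T) (η : Path T) (a : ℝ)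
    (x p u ρ : Path T) : Prop where
  state : ∀ t, x t = a + ∫ s in Iic t, G.f s (x s) (u s) (η s)
  force_eq : ∀ t : Time T, ρ t = -2 * (force (x t) + κ * (η t - x t)) +
    (stateDeriv T (G.costDefect κ) (t, x t, u t, η t) +
      p t * stateDeriv T G.dynamicsDefect (t, x t, u t, η t))
  costate : ∀ t, p t = deriv G.ψ (x ⊤) + tailPrimitive T ρ t
  stationary : ∀ t : Time T, 2 * u t + p t +
    (controlDeriv T (G.costDefect κ) (t, x t, u t, η t) +
      p t * controlDeriv T G.dynamicsDefect (t, x t, u t, η t)) = 0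

theorem IsPerturbation.isAdmissible {κ δ : ℝ} {G : ScalarGame T} (hG : IsPerturbation κ δ G)
    {η x u : Path T} {a : ℝ} (h : ∀ t, x t = a + ∫ s in Iic t, G.f s (x s) (u s) (η s)) :
    G.IsAdmissible η a x u where
  control_measurable := u.continuous.aestronglyMeasurable.aemeasurable
  trajectory := h
  velocity_integrable := by
    simp only [G.f_eq]
    exact integrable_path (u +
      superpose hG.dynamics.isSmallOn.continuousOn (x.prodMk (u.prodMk η)))
  cost_integrable := by
    simp only [G.L_eq κ]
    exact integrable_path (superpose (contDiff_runningCost κ (n := 0)).continuous.continuousOn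
      (x.prodMk (u.prodMk η)) +
        superpose hG.cost.isSmallOn.continuousOn (x.prodMk (u.prodMk η)))

namespace ScalarGame

/-- The increment of the velocity from the pair `(x, u)` to a competitor `(x', u')`. -/
def velocityGap (G : ScalarGame T) (η x : Path T) (u : Time T → ℝ) (x' : Path T)
    (u' : Time T → ℝ) (t : Time T) : ℝ :=
  G.f t (x' t) (u' t) (η t) - G.f t (x t) (u t) (η t)

/-- The increment of the Hamiltonian `L + p f` from the pair `(x, u)` to a competitor `(x', u')`,
minus its linear part in the state, which has the slope `ρ`. -/
def hamiltonianGap (G : ScalarGame T) (η x p u ρ x' : Path T) (u' : Time T → ℝ) (t : Time T) : ℝ :=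
  G.L t (x' t) (u' t) (η t) - G.L t (x t) (u t) (η t) + p t * G.velocityGap η x u x' u' t -
    ρ t * (x' t - x t)

theorem cost_eq [Fact (0 ≤ T)] (G : ScalarGame T) (η x : Path T) (u : Time T → ℝ) :
    G.cost η x u = (∫ s : Time T, G.L s (x s) (u s) (η s)) + G.ψ (x ⊤) := rfl

namespace IsAdmissible
variable {G : ScalarGame T} {η x x' : Path T} {a : ℝ} {u u' : Time T → ℝ}

theorem integrable_velocityGap (h : G.IsAdmissible η a x u) (h' : G.IsAdmissible η a x' u') :
    Integrable (G.velocityGap η x u x' u') volume :=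
  h'.velocity_integrable.sub h.velocity_integrable

theorem sub_eq_setIntegral_velocityGap (h : G.IsAdmissible η a x u)
    (h' : G.IsAdmissible η a x' u') (t : Time T) :
    x' t - x t = ∫ s in Iic t, G.velocityGap η x u x' u' s := by
  simp only [velocityGap]
  rw [h'.trajectory t, h.trajectory t, add_sub_add_left_eq_sub,
    integral_sub h'.velocity_integrable.integrableOn h.velocity_integrable.integrableOn]

theorem sub_top_eq_integral_velocityGap [Fact (0 ≤ T)] (h : G.IsAdmissible η a x u)
    (h' : G.IsAdmissible η a x' u') : x' ⊤ - x ⊤ = ∫ s, G.velocityGap η x u x' u' s := by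
  rw [h.sub_eq_setIntegral_velocityGap h', Iic_top, setIntegral_univ]

end IsAdmissible

end ScalarGame

theorem integrable_path_mul (p : Path T) {w : Time T → ℝ} (hw : Integrable w volume) :
    Integrable (fun s => p s * w s) volume :=
  hw.bdd_mul p.continuous.aestronglyMeasurable (.of_forall p.norm_coe_le_norm)

theorem hamiltonian_increment_ge {κ δ P : ℝ} {G : ScalarGame T} (hG : IsPerturbation κ δ G)
    (t : Time T) {x u η p x' u' : ℝ} (hp : |p| ≤ P)
    (hst : 2 * u + p + (controlDeriv T (G.costDefect κ) (t, x, u, η) +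
      p * controlDeriv T G.dynamicsDefect (t, x, u, η)) = 0) :
    (κ - 1 - δ * (1 + P)) * (x' - x) ^ 2 + (1 - δ * (1 + P)) * (u' - u) ^ 2 ≤
      G.L t x' u' η - G.L t x u η + p * (G.f t x' u' η - G.f t x u η) -
      (-2 * (force x + κ * (η - x)) + (stateDeriv T (G.costDefect κ) (t, x, u, η) +
        p * stateDeriv T G.dynamicsDefect (t, x, u, η))) * (x' - x) := by
  have hcost := (abs_le.1 (hG.cost.abs_increment_sub_le t x x' u u' η)).1
  have hdyn : |p * (G.dynamicsDefect (t, x', u', η) - G.dynamicsDefect (t, x, u, η) -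
      ((x' - x) * stateDeriv T G.dynamicsDefect (t, x, u, η) +
        (u' - u) * controlDeriv T G.dynamicsDefect (t, x, u, η)))| ≤
      P * (δ * ((x' - x) ^ 2 + (u' - u) ^ 2)) := by
    rw [abs_mul]
    exact mul_le_mul hp (hG.dynamics.abs_increment_sub_le t x x' u u' η) (abs_nonneg _)
      ((abs_nonneg _).trans hp)
  have hpotential := one_div_one_add_sq_sub_ge x x'
  have hcontrol := congrArg ((u' - u) * ·) hst
  simp only [G.f_eq, G.L_eq κ, runningCost]
  linarith [(abs_le.1 hdyn).1]

section HamiltonianGap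
variable {G : ScalarGame T} {η x p u ρ x' : Path T} {a : ℝ} {u' : Time T → ℝ}

theorem integrable_hamiltonianGap (hx : G.IsAdmissible η a x u) (hx' : G.IsAdmissible η a x' u') :
    Integrable (G.hamiltonianGap η x p u ρ x' u') volume :=
  ((hx'.cost_integrable.sub hx.cost_integrable).add
    (integrable_path_mul p (hx.integrable_velocityGap hx'))).sub (integrable_path (ρ * (x' - x)))

theorem integral_hamiltonianGap (hx : G.IsAdmissible η a x u) (hx' : G.IsAdmissible η a x' u') :
    ∫ t, G.hamiltonianGap η x p u ρ x' u' t =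
      (∫ s : Time T, G.L s (x' s) (u' s) (η s)) - (∫ s : Time T, G.L s (x s) (u s) (η s)) +
        (∫ t, p t * G.velocityGap η x u x' u' t) - ∫ t, ρ t * (x' t - x t) := by
  have hL : Integrable (fun s : Time T => G.L s (x' s) (u' s) (η s) - G.L s (x s) (u s) (η s))
    volume := hx'.cost_integrable.sub hx.cost_integrable
  have hpw := integrable_path_mul p (hx.integrable_velocityGap hx')
  have hLpw : Integrable (fun s : Time T => G.L s (x' s) (u' s) (η s) - G.L s (x s) (u s) (η s) +
    p s * G.velocityGap η x u x' u' s) volume := hL.add hpw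
  have hρ : Integrable (fun s => ρ s * (x' s - x s)) volume := integrable_path (ρ * (x' - x))
  simp only [ScalarGame.hamiltonianGap]
  rw [integral_sub hLpw hρ, integral_add hL hpw,
    integral_sub hx'.cost_integrable hx.cost_integrable]

end HamiltonianGap

namespace IsExtremal
variable [hT : Fact (0 ≤ T)] {κ δ P : ℝ} {G : ScalarGame T} {η x p u ρ x' : Path T} {a : ℝ}
  {u' : Time T → ℝ}

theorem integral_costate_mul_velocityGap (h : IsExtremal κ G η a x p u ρ)
    (hx : G.IsAdmissible η a x u) (hx' : G.IsAdmissible η a x' u') :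
    ∫ s, p s * G.velocityGap η x u x' u' s =
      deriv G.ψ (x ⊤) * (x' ⊤ - x ⊤) + ∫ t, ρ t * (x' t - x t) := by
  have hw := hx.integrable_velocityGap hx'
  simp only [h.costate, add_mul]
  rw [integral_add (hw.const_mul _) (integrable_path_mul _ hw), integral_const_mul,
    integral_tailPrimitive_mul hw, hx.sub_top_eq_integral_velocityGap hx']
  simp only [hx.sub_eq_setIntegral_velocityGap hx']

theorem cost_sub_cost_eq (h : IsExtremal κ G η a x p u ρ) (hx : G.IsAdmissible η a x u)
    (hx' : G.IsAdmissible η a x' u') :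
    G.cost η x' u' - G.cost η x u = (∫ t, G.hamiltonianGap η x p u ρ x' u' t) +
      (G.ψ (x' ⊤) - G.ψ (x ⊤) - deriv G.ψ (x ⊤) * (x' ⊤ - x ⊤)) := by
  rw [integral_hamiltonianGap hx hx', h.integral_costate_mul_velocityGap hx hx']
  rw [ScalarGame.cost_eq, ScalarGame.cost_eq]
  ring

theorem hamiltonianGap_ge (h : IsExtremal κ G η a x p u ρ) (hG : IsPerturbation κ δ G)
    (hp : ‖p‖ ≤ P) (t : Time T) :
    (κ - 1 - δ * (1 + P)) * (x' t - x t) ^ 2 + (1 - δ * (1 + P)) * (u' t - u t) ^ 2 ≤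
      G.hamiltonianGap η x p u ρ x' u' t := by
  rw [ScalarGame.hamiltonianGap, ScalarGame.velocityGap, h.force_eq]
  exact hamiltonian_increment_ge hG t ((abs_apply_le_norm p t).trans hp) (h.stationary t)

theorem integrable_sq_control_sub (h : IsExtremal κ G η a x p u ρ) (hG : IsPerturbation κ δ G)
    (hp : ‖p‖ ≤ P) (hδ : δ * (1 + P) ≤ 1 / 2) (hδκ : δ * (1 + P) ≤ κ - 1)
    (hx' : G.IsAdmissible η a x' u') : Integrable (fun t => (u' t - u t) ^ 2) volume := by
  refine ((integrable_hamiltonianGap (p := p) (ρ := ρ) (hG.isAdmissible h.state) hx').const_mul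
    2).mono' ((hx'.control_measurable.sub
      u.continuous.aestronglyMeasurable.aemeasurable).pow_const 2).aestronglyMeasurable
    (.of_forall fun t => ?_)
  have hgap := h.hamiltonianGap_ge (x' := x') (u' := u') hG hp t
  rw [Real.norm_eq_abs, abs_of_nonneg (sq_nonneg _)]
  linarith [mul_nonneg (sub_nonneg.2 hδκ) (sq_nonneg (x' t - x t)),
    mul_le_mul_of_nonneg_right (by linarith : 1 / 2 ≤ 1 - δ * (1 + P)) (sq_nonneg (u' t - u t))]

end IsExtremal

theorem IsPerturbation.sq_velocityGap_le {κ δ : ℝ} {G : ScalarGame T} (hG : IsPerturbation κ δ G)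
    (hδ : δ ≤ 1) (η x : Path T) (u : Time T → ℝ) (x' : Path T) (u' : Time T → ℝ) (t : Time T) :
    G.velocityGap η x u x' u' t ^ 2 ≤ 8 * (u' t - u t) ^ 2 + 2 * (x' t - x t) ^ 2 := by
  have hdefect := (hG.dynamics.isSmallOn.abs_increment_le t (x t) (x' t) (u t) (u' t) (η t)).trans
    (mul_le_of_le_one_left (by positivity) hδ)
  have hsplit : G.velocityGap η x u x' u' t = (u' t - u t) +
      (G.dynamicsDefect (t, x' t, u' t, η t) - G.dynamicsDefect (t, x t, u t, η t)) := by
    rw [ScalarGame.velocityGap, G.f_eq, G.f_eq]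
    ring
  have habs : |G.velocityGap η x u x' u' t| ≤ 2 * |u' t - u t| + |x' t - x t| := by
    rw [hsplit]
    linarith [abs_add_le (u' t - u t)
      (G.dynamicsDefect (t, x' t, u' t, η t) - G.dynamicsDefect (t, x t, u t, η t))]
  rw [← sq_abs, ← sq_abs (u' t - u t), ← sq_abs (x' t - x t)]
  nlinarith [pow_le_pow_left₀ (abs_nonneg _) habs 2,
    sq_nonneg (2 * |u' t - u t| - |x' t - x t|)]

theorem IsPerturbation.sq_sub_top_le [Fact (0 ≤ T)] {κ δ : ℝ} {G : ScalarGame T}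
    (hG : IsPerturbation κ δ G) (hδ : δ ≤ 1) {η x u x' : Path T} {a : ℝ} {u' : Time T → ℝ}
    (hx : G.IsAdmissible η a x u) (hx' : G.IsAdmissible η a x' u')
    (hu : Integrable (fun t => (u' t - u t) ^ 2) volume) :
    (x' ⊤ - x ⊤) ^ 2 ≤ T * (8 * (∫ t, (u' t - u t) ^ 2) + 2 * ∫ t, (x' t - x t) ^ 2) := by
  have hw := hx.integrable_velocityGap hx'
  have he : Integrable (fun t => (x' t - x t) ^ 2) volume := integrable_path ((x' - x) ^ 2)
  have hbound := (hu.const_mul 8).add (he.const_mul 2)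
  have hle := hG.sq_velocityGap_le hδ η x u x' u'
  have hw2 : Integrable (fun t => G.velocityGap η x u x' u' t ^ 2) volume :=
    hbound.mono' (hw.aestronglyMeasurable.pow 2) (.of_forall fun t => by
      rw [Real.norm_eq_abs, abs_of_nonneg (sq_nonneg _)]; exact hle t)
  calc (x' ⊤ - x ⊤) ^ 2 ≤ T * ∫ t, G.velocityGap η x u x' u' t ^ 2 := by
        rw [hx.sub_top_eq_integral_velocityGap hx']
        simpa only [volume_real_univ] using sq_integral_le hw hw2
    _ ≤ T * ∫ t, (8 * (u' t - u t) ^ 2 + 2 * (x' t - x t) ^ 2) :=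
        mul_le_mul_of_nonneg_left (integral_mono hw2 hbound hle) (Fact.out : 0 ≤ T)
    _ = _ := by
        rw [integral_add (hu.const_mul 8) (he.const_mul 2), integral_const_mul,
          integral_const_mul]

theorem IsPerturbation.terminal_increment_ge {κ δ : ℝ} {G : ScalarGame T}
    (hG : IsPerturbation κ δ G) (x x' : ℝ) :
    -(δ * (x' - x) ^ 2) ≤ G.ψ x' - G.ψ x - deriv G.ψ x * (x' - x) := by
  have htaylor := hG.terminal.abs_sub_sub_le convex_univ (mem_univ x) (mem_univ x')
  rw [fderivWithin_univ, fderiv_eq_smul_deriv, smul_eq_mul, Real.norm_eq_abs, sq_abs,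
    mul_comm (x' - x)] at htaylor
  exact (abs_le.1 htaylor).1

section Optimality
variable [hT : Fact (0 ≤ T)] {κ δ P : ℝ} {G : ScalarGame T} {η x p u ρ : Path T} {a : ℝ}

theorem IsExtremal.cost_gain (h : IsExtremal κ G η a x p u ρ) (hG : IsPerturbation κ δ G)
    (hp : ‖p‖ ≤ P) (hδ : δ * (1 + P + 8 * T) ≤ 1 / 2) (hδκ : δ * (1 + P + 8 * T) ≤ (κ - 1) / 2)
    {x' : Path T} {u' : Time T → ℝ} (hx' : G.IsAdmissible η a x' u') :
    (κ - 1) / 2 * ∫ t, (x' t - x t) ^ 2 ≤ G.cost η x' u' - G.cost η x u := by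
  have hδ0 := hG.nonneg
  have hP : 0 ≤ P := (norm_nonneg p).trans hp
  have hδT : 0 ≤ δ * T := mul_nonneg hδ0 hT.out
  have hδP : 0 ≤ δ * P := mul_nonneg hδ0 hP
  have hx := hG.isAdmissible h.state
  have he : Integrable (fun t => (x' t - x t) ^ 2) volume := integrable_path ((x' - x) ^ 2)
  have hu := h.integrable_sq_control_sub hG hp (by linarith) (by linarith) hx'
  have hgap : (κ - 1 - δ * (1 + P)) * (∫ t, (x' t - x t) ^ 2) +
      (1 - δ * (1 + P)) * (∫ t, (u' t - u t) ^ 2) ≤ ∫ t, G.hamiltonianGap η x p u ρ x' u' t := by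
    rw [← integral_const_mul, ← integral_const_mul,
      ← integral_add (he.const_mul _) (hu.const_mul _)]
    exact integral_mono ((he.const_mul _).add (hu.const_mul _)) (integrable_hamiltonianGap hx hx')
      (h.hamiltonianGap_ge hG hp)
  have htop := mul_le_mul_of_nonneg_left (hG.sq_sub_top_le (by linarith) hx hx' hu) hδ0
  have hE : 0 ≤ ∫ t, (x' t - x t) ^ 2 := integral_nonneg fun t => sq_nonneg _
  have hV : 0 ≤ ∫ t, (u' t - u t) ^ 2 := integral_nonneg fun t => sq_nonneg _
  rw [h.cost_sub_cost_eq hx hx']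
  linarith [hG.terminal_increment_ge (x ⊤) (x' ⊤),
    mul_nonneg (by linarith : 0 ≤ (κ - 1) / 2 - δ * (1 + P + 2 * T)) hE,
    mul_nonneg (by linarith : 0 ≤ 1 - δ * (1 + P + 8 * T)) hV]

theorem IsExtremal.isOptimal (hκ : 1 < κ) (h : IsExtremal κ G η a x p u ρ)
    (hG : IsPerturbation κ δ G) (hp : ‖p‖ ≤ P) (hδ : δ * (1 + P + 8 * T) ≤ 1 / 2)
    (hδκ : δ * (1 + P + 8 * T) ≤ (κ - 1) / 2) : G.IsOptimal η a x u :=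
  ⟨hG.isAdmissible h.state, fun _ _ hx' => sub_nonneg.1 <| (h.cost_gain hG hp hδ hδκ hx').trans' <|
    mul_nonneg (by linarith) (integral_nonneg fun _ => sq_nonneg _)⟩

end Optimality

/-! ### Stability in the barycenter game -/

section BestReply
variable {κ : ℝ} {hT : 0 ≤ T}

theorem IsReply.isExtremal [Fact (0 ≤ T)] {η x : Path T} (h : IsReply κ η x) :
    IsExtremal κ (barycenterGame κ T hT) η 0 x
      ((-2 : ℝ) • tailPrimitive T (force.comp x + κ • (η - x)))
      (tailPrimitive T (force.comp x + κ • (η - x)))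
      ((-2 : ℝ) • (force.comp x + κ • (η - x))) where
  state t := by
    rw [zero_add]
    exact DFunLike.congr_fun h t
  force_eq t := by
    simp [stateDeriv, dynamicsDefect_barycenterGame, costDefect_barycenterGame, mul_add]
  costate t := by simp [barycenterGame]
  stationary t := by
    simp [-map_add, controlDeriv, dynamicsDefect_barycenterGame, costDefect_barycenterGame]

theorem eq_zero_of_integral_sq_nonpos (hT : 0 < T) {v : Path T} (h : ∫ t, v t ^ 2 ≤ 0) :
    v = 0 := by
  have : Fact (0 ≤ T) := ⟨hT.le⟩
  by_contra hne
  obtain ⟨t, ht⟩ := DFunLike.ne_iff.1 hne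
  have hpos : 0 < ∫ s in (0 : ℝ)..T, IccExtend hT.le (⇑(v ^ 2)) s := by
    refine intervalIntegral.integral_pos hT
      ((v ^ 2).continuous.Icc_extend' (h := hT.le)).continuousOn
      (fun s _ => sq_nonneg _) ⟨t, t.2, ?_⟩
    rw [IccExtend_val]
    exact sq_pos_of_ne_zero ht
  have htop := primitive_eq_intervalIntegral (v ^ 2) ⊤
  rw [primitive_apply, Iic_top, setIntegral_univ] at htop
  exact h.not_gt (hpos.trans_eq htop.symm)

theorem neg_eq_green_force_comp_neg {y : Path T} (hy : y = green T (force.comp y)) :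
    -y = green T (force.comp (-y)) := by
  rw [force_comp_neg, map_neg, ← hy]

theorem zero_eq_green_force_comp_zero : (0 : Path T) = green T (force.comp 0) := by
  rw [show force.comp (0 : Path T) = 0 from ContinuousMap.ext fun _ => force_zero, map_zero]

namespace barycenterGame

theorem isOptimal_of_isReply (hκ : 1 < κ) {η x : Path T} (h : IsReply κ η x) :
    (barycenterGame κ T hT).IsOptimal η 0 x (tailPrimitive T (force.comp x + κ • (η - x))) :=
  have : Fact (0 ≤ T) := ⟨hT⟩
  h.isExtremal.isOptimal hκ isPerturbation_barycenterGame le_rfl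
    (by rw [zero_mul]; norm_num) (by rw [zero_mul]; linarith)

theorem isReply_of_isOptimal (hT0 : 0 < T) (hκ : 1 < κ) {η x : Path T} {u : Time T → ℝ}
    (h : (barycenterGame κ T hT).IsOptimal η 0 x u) : IsReply κ η x := by
  have : Fact (0 ≤ T) := ⟨hT⟩
  obtain ⟨z, hz⟩ := exists_reply hκ η
  have hgain := (hz.isExtremal (hT := hT)).cost_gain isPerturbation_barycenterGame le_rfl
    (by rw [zero_mul]; norm_num) (by rw [zero_mul]; linarith) h.1
  have hle := h.2 _ _ (isOptimal_of_isReply hκ hz).1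
  have hzero : ∫ t, (x - z) t ^ 2 ≤ 0 :=
    nonpos_of_mul_nonpos_right (hgain.trans (sub_nonpos.2 hle)) (by linarith)
  rwa [sub_eq_zero.1 (eq_zero_of_integral_sq_nonpos hT0 hzero)]

theorem isMoment_const_iff {y η : Path T} :
    (barycenterGame κ T hT).IsMoment (fun _ => y) η ↔ η = y := by
  simp [ScalarGame.IsMoment, barycenterGame, ContinuousMap.ext_iff]

theorem mem_bestReply_iff (hT0 : 0 < T) (hκ : 1 < κ) {η η' : Path T} :
    η' ∈ (barycenterGame κ T hT).bestReply η ↔ IsReply κ η η' := by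
  have : Fact (0 ≤ T) := ⟨hT⟩
  constructor
  · rintro ⟨x, u, -, hopt, hmom⟩
    obtain ⟨z, hz⟩ := exists_reply hκ η
    have hx : ∀ᵐ ξ, x ξ = z := hopt.mono fun ξ h => (isReply_of_isOptimal hT0 hκ h).unique hκ hz
    have hη' : η' = z := (isMoment_const_iff (κ := κ) (hT := hT)).1 fun t =>
      have hφ : (fun ξ => (barycenterGame κ T hT).φ t (x ξ t)) =ᵐ[volume] fun _ => z t :=
        hx.mono fun ξ hξ => congr_arg (fun w : Path T => w t) hξ
      ⟨(hmom t).1.congr hφ, (hmom t).2.trans (integral_congr_ae hφ)⟩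
    rwa [hη']
  · exact fun h => ⟨fun _ => η', fun _ => _, integrable_const _,
      .of_forall fun _ => isOptimal_of_isReply hκ h, isMoment_const_iff.2 rfl⟩

theorem isSolution_const (hκ : 1 < κ) {y : Path T} (hy : y = green T (force.comp y)) :
    (barycenterGame κ T hT).IsSolution fun _ => y :=
  ⟨integrable_const _, fun _ => _, y, isMoment_const_iff.2 rfl,
    .of_forall fun _ => isOptimal_of_isReply hκ (isReply_self_iff.2 hy)⟩

theorem isStable_const_iff (hT0 : 0 < T) (hκ : 1 < κ) {y : Path T}
    (hy : y = green T (force.comp y)) :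
    (barycenterGame κ T hT).IsStable (fun _ => y) ↔ ∀ ε > 0, ∃ δ > 0, ∀ η : ℕ → Path T,
      ‖η 0 - y‖ < δ → (∀ k, IsReply κ (η k) (η (k + 1))) → ∀ k, ‖η (k + 1) - y‖ < ε := by
  have hshift {P : ℕ → Prop} : (∀ k ≥ 1, P k) ↔ ∀ k, P (k + 1) :=
    ⟨fun h k => h _ k.succ_pos, fun h k hk => Nat.sub_add_cancel hk ▸ h (k - 1)⟩
  simp only [ScalarGame.IsStable, isMoment_const_iff, exists_eq_left, IsStableFixedPoint, hshift,
    Nat.add_sub_cancel, mem_bestReply_iff hT0 hκ, isReply_self_iff.2 hy, true_and]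

theorem isStable_of_isPositiveEquilibrium (hT0 : 0 < T) (hκ : 1 < κ) {y : Path T}
    (hy : IsPositiveEquilibrium y) : (barycenterGame κ T hT).IsStable fun _ => y :=
  have : Fact (0 ≤ T) := ⟨hT⟩
  (isStable_const_iff hT0 hκ hy.eq_green).2 fun _ hε => hy.stable hκ hε

theorem isStable_neg_of_isPositiveEquilibrium (hT0 : 0 < T) (hκ : 1 < κ) {y : Path T}
    (hy : IsPositiveEquilibrium y) : (barycenterGame κ T hT).IsStable fun _ => -y := by
  have hneg (z : Path T) : ‖z - -y‖ = ‖-z - y‖ := by rw [← norm_neg, neg_sub', neg_neg]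
  refine (isStable_const_iff hT0 hκ (neg_eq_green_force_comp_neg hy.eq_green)).2 fun ε hε => ?_
  have : Fact (0 ≤ T) := ⟨hT⟩
  obtain ⟨δ, hδ, h⟩ := hy.stable hκ hε
  simp only [hneg]
  exact ⟨δ, hδ, fun η h0 hη => h (fun k => -η k) h0 fun k => (hη k).neg⟩

theorem not_isStable_zero (hT' : Real.pi / 2 < T) (hκ : 1 < κ) :
    ¬ (barycenterGame κ T hT).IsStable fun _ => 0 := by
  have hT0 : 0 < T := Real.pi_div_two_pos.trans hT'
  have : Fact (0 ≤ T) := ⟨hT⟩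
  obtain ⟨ε, hε, hescape⟩ := exists_forall_exists_le_norm_reply hT' hκ
  rw [isStable_const_iff hT0 hκ zero_eq_green_force_comp_zero]
  intro hstable
  obtain ⟨δ, hδ, hstable⟩ := hstable ε hε
  choose Φ hΦ using exists_reply (T := T) hκ
  obtain ⟨η, hη0, hη⟩ : ∃ η : ℕ → Path T, η 0 = (δ / 2) • sine T ∧
      ∀ k, IsReply κ (η k) (η (k + 1)) :=
    ⟨fun k => Φ^[k] ((δ / 2) • sine T), rfl, fun k => by
      simpa only [Function.iterate_succ_apply'] using hΦ _⟩
  have hsine : ‖sine T‖ ≤ 1 := norm_path_le zero_le_one fun t =>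
    (abs_of_nonneg (sine_nonneg hT0 t)).trans_le (sine_le_one t)
  have hstart : ‖η 0 - 0‖ < δ := by
    rw [hη0, sub_zero, norm_smul, Real.norm_of_nonneg (half_pos hδ).le]
    exact (mul_le_of_le_one_right (half_pos hδ).le hsine).trans_lt (half_lt_self hδ)
  obtain ⟨k, hk⟩ := hescape (δ / 2) (half_pos hδ) η hη0.ge hη
  refine hk.not_gt ?_
  simpa only [sub_zero] using hstable η hstart hη k

end barycenterGame

end BestReply

/-! ### Equations coupled through an average -/

section Average
variable {A Ω X Y : Type*} [TopologicalSpace A] [CompactSpace A] [MeasurableSpace Ω]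
  {μ : Measure Ω} {π : Ω → A} [NormedAddCommGroup X]

theorem integrable_continuousMap_comp [IsFiniteMeasure μ] (hπ : AEStronglyMeasurable π μ)
    (w : C(A, X)) : Integrable (fun ξ => w (π ξ)) μ :=
  .of_bound (w.continuous.comp_aestronglyMeasurable hπ) ‖w‖
    (.of_forall fun ξ => w.norm_coe_le_norm (π ξ))

variable [NormedSpace ℝ X] [NormedAddCommGroup Y] [NormedSpace ℝ Y] [IsProbabilityMeasure μ]

theorem norm_integral_continuousMap_comp_le (w : C(A, X)) : ‖∫ ξ, w (π ξ) ∂μ‖ ≤ ‖w‖ := by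
  simpa using norm_integral_le_of_norm_le_const (μ := μ)
    (.of_forall fun ξ => w.norm_coe_le_norm (π ξ))

/-- The average of a continuous function along a random point `π`, as a continuous linear
functional of the function. -/
def average (hπ : AEStronglyMeasurable π μ) : C(A, X) →L[ℝ] X :=
  LinearMap.mkContinuous
    { toFun := fun w => ∫ ξ, w (π ξ) ∂μ
      map_add' := fun v w => integral_add (integrable_continuousMap_comp hπ v)
        (integrable_continuousMap_comp hπ w)
      map_smul' := fun _ _ => integral_smul _ _ }
    1 fun w => (norm_integral_continuousMap_comp_le w).trans_eq (one_mul _).symm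

variable {hπ : AEStronglyMeasurable π μ}

theorem average_apply (w : C(A, X)) : average hπ w = ∫ ξ, w (π ξ) ∂μ := rfl

theorem norm_average_le (w : C(A, X)) : ‖average hπ w‖ ≤ ‖w‖ :=
  norm_integral_continuousMap_comp_le w

variable [CompleteSpace X]

theorem average_comp [CompleteSpace Y] (L : X →L[ℝ] Y) (w : C(A, X)) :
    average hπ ((L : C(X, Y)).comp w) = L (average hπ w) :=
  L.integral_comp_comm (integrable_continuousMap_comp hπ w)

theorem average_const (x : X) : average hπ (ContinuousMap.const A x) = x := by
  simp [average_apply]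

end Average

theorem exists_eq_zero_of_approximatesLinearOn {V W : Type*} [NormedAddCommGroup V]
    [NormedSpace ℝ V] [CompleteSpace V] [NormedAddCommGroup W] [NormedSpace ℝ W] {N : V → W}
    {L : V →L[ℝ] W} (R : L.NonlinearRightInverse) (hR : 0 < R.nnnorm) {z₀ : V} {ε : ℝ}
    {c : NNReal} (hN : ApproximatesLinearOn N L (Metric.closedBall z₀ ε) c)
    (hc : (R.nnnorm * c : ℝ) ≤ 1 / 2) (hε : 2 * R.nnnorm * ‖N z₀‖ ≤ ε) :
    ∃ z ∈ Metric.closedBall z₀ ε, N z = 0 := by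
  have hε0 : 0 ≤ ε := hε.trans' (by positivity)
  refine hN.surjOn_closedBall_of_nonlinearRightInverse R hε0 le_rfl ?_
  have hR0 : (0 : ℝ) < R.nnnorm := hR
  rw [mem_closedBall_iff_norm, zero_sub, norm_neg]
  refine le_of_mul_le_mul_left ?_ hR0
  calc R.nnnorm * ‖N z₀‖ ≤ ε / 2 := by linarith
    _ ≤ (1 - R.nnnorm * c) * ε := by nlinarith
    _ = R.nnnorm * (((R.nnnorm : ℝ)⁻¹ - c) * ε) := by field_simp

theorem norm_apply_prod_le {A X E : Type*} [TopologicalSpace A] [CompactSpace A]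
    [NormedAddCommGroup X] [NormedAddCommGroup E] (z : C(A, X) × E) (a : A) :
    ‖(z.1 a, z.2)‖ ≤ ‖z‖ :=
  max_le ((z.1.norm_coe_le_norm a).trans (norm_fst_le z)) (norm_snd_le z)

theorem apply_mem_closedBall {A X E : Type*} [TopologicalSpace A] [CompactSpace A]
    [NormedAddCommGroup X] [NormedAddCommGroup E] {z₀ : X × E} {z : C(A, X) × E} {ε : ℝ}
    (hz : z ∈ Metric.closedBall (.const A z₀.1, z₀.2) ε) (a : A) :
    (z.1 a, z.2) ∈ Metric.closedBall z₀ ε := by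
  rw [mem_closedBall_iff_norm] at hz ⊢
  exact (norm_apply_prod_le _ a).trans hz

section CoupledSystem
variable {A Ω X E : Type*} [TopologicalSpace A] [CompactSpace A] [MeasurableSpace Ω]
  {μ : Measure Ω} [IsProbabilityMeasure μ] {π : Ω → A} {hπ : AEStronglyMeasurable π μ}
  [NormedAddCommGroup X] [NormedSpace ℝ X] [NormedAddCommGroup E] [NormedSpace ℝ E]

/-- The map whose zeros are the solutions of a family of equations `F(a, w(a), η) = 0` coupled
through the average `η = ∫ φ(w(π ξ)) dξ`. -/
def coupledResidual (hπ : AEStronglyMeasurable π μ) (F : C(A × X × E, X)) (φ : C(X, E))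
    (z : C(A, X) × E) : C(A, X) × E :=
  (F.comp (.prodMk (.id A) (z.1.prodMk (.const A z.2))), z.2 - average hπ (φ.comp z.1))

/-- The linear model of `coupledResidual`: the family of equations `A₀ w(a) + B η = 0` coupled
through the average `η = Q (∫ w(π ξ) dξ)`. -/
def coupledLinear (hπ : AEStronglyMeasurable π μ) (A₀ : X →L[ℝ] X) (B : E →L[ℝ] X) (Q : X →L[ℝ] E) :
    C(A, X) × E →L[ℝ] C(A, X) × E :=
  ((A₀.compLeftContinuous ℝ A).coprod ((ContinuousLinearMap.const ℝ A).comp B)).prod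
    (.snd ℝ _ _ - (Q.comp (average hπ)).comp (.fst ℝ _ _))

/-- The moment component of the inverse of `coupledLinear`, where `M` is the operator
`1 + Q A₀⁻¹ B`. -/
def coupledMoment (hπ : AEStronglyMeasurable π μ) (A₀ : X ≃L[ℝ] X) (Q : X →L[ℝ] E) (M : E ≃L[ℝ] E)
    (z : C(A, X) × E) : E :=
  M.symm (z.2 + Q (A₀.symm (average hπ z.1)))

/-- A bound for the norm of `coupledMoment`. -/
def coupledMomentBound (A₀ : X ≃L[ℝ] X) (Q : X →L[ℝ] E) (M : E ≃L[ℝ] E) : NNReal :=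
  ‖(M.symm : E →L[ℝ] E)‖₊ * (1 + ‖Q‖₊ * ‖(A₀.symm : X →L[ℝ] X)‖₊)

/-- A positive bound for the norm of the inverse of `coupledLinear`. The point is that it depends
neither on the parameter space `A` nor on `π`. -/
def coupledBound (A₀ : X ≃L[ℝ] X) (B : E →L[ℝ] X) (Q : X →L[ℝ] E) (M : E ≃L[ℝ] E) : NNReal :=
  ‖(A₀.symm : X →L[ℝ] X)‖₊ * (1 + ‖B‖₊ * coupledMomentBound A₀ Q M) +
    coupledMomentBound A₀ Q M + 1

variable {A₀ : X ≃L[ℝ] X} {B : E →L[ℝ] X} {Q : X →L[ℝ] E} {M : E ≃L[ℝ] E}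

theorem norm_coupledMoment_le (z : C(A, X) × E) :
    ‖coupledMoment hπ A₀ Q M z‖ ≤ coupledMomentBound A₀ Q M * ‖z‖ := by
  have hQ : ‖Q (A₀.symm (average hπ z.1))‖ ≤ ‖Q‖ * (‖(A₀.symm : X →L[ℝ] X)‖ * ‖z‖) :=
    Q.le_opNorm_of_le <| (A₀.symm : X →L[ℝ] X).le_opNorm_of_le <|
      (norm_average_le z.1).trans (norm_fst_le z)
  calc ‖coupledMoment hπ A₀ Q M z‖
      ≤ ‖(M.symm : E →L[ℝ] E)‖ * (‖z‖ + ‖Q‖ * (‖(A₀.symm : X →L[ℝ] X)‖ * ‖z‖)) :=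
        (M.symm : E →L[ℝ] E).le_opNorm_of_le <| norm_add_le_of_le (norm_snd_le z) hQ
    _ = coupledMomentBound A₀ Q M * ‖z‖ := by
        simp only [coupledMomentBound, NNReal.coe_mul, NNReal.coe_add, NNReal.coe_one, coe_nnnorm]
        ring

/-- The state component of the inverse of `coupledLinear`. -/
def coupledState (hπ : AEStronglyMeasurable π μ) (A₀ : X ≃L[ℝ] X) (B : E →L[ℝ] X) (Q : X →L[ℝ] E)
    (M : E ≃L[ℝ] E) (z : C(A, X) × E) : C(A, X) :=
  ((A₀.symm : X →L[ℝ] X) : C(X, X)).comp (z.1 - .const A (B (coupledMoment hπ A₀ Q M z)))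

theorem norm_coupledState_le (z : C(A, X) × E) :
    ‖coupledState hπ A₀ B Q M z‖ ≤
      ‖(A₀.symm : X →L[ℝ] X)‖ * (1 + ‖B‖ * coupledMomentBound A₀ Q M) * ‖z‖ := by
  refine (ContinuousMap.norm_le _ (by positivity)).2 fun a => ?_
  have hB : ‖B (coupledMoment hπ A₀ Q M z)‖ ≤ ‖B‖ * (coupledMomentBound A₀ Q M * ‖z‖) :=
    B.le_opNorm_of_le (norm_coupledMoment_le z)
  calc ‖A₀.symm (z.1 a - B (coupledMoment hπ A₀ Q M z))‖
      ≤ ‖(A₀.symm : X →L[ℝ] X)‖ * (‖z‖ + ‖B‖ * (coupledMomentBound A₀ Q M * ‖z‖)) :=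
        (A₀.symm : X →L[ℝ] X).le_opNorm_of_le <|
          norm_sub_le_of_le ((z.1.norm_coe_le_norm a).trans (norm_fst_le z)) hB
    _ = ‖(A₀.symm : X →L[ℝ] X)‖ * (1 + ‖B‖ * coupledMomentBound A₀ Q M) * ‖z‖ := by ring

variable [CompleteSpace X]

theorem average_coupledState (z : C(A, X) × E) :
    average hπ (coupledState hπ A₀ B Q M z) =
      A₀.symm (average hπ z.1 - B (coupledMoment hπ A₀ Q M z)) := by
  rw [coupledState, average_comp, map_sub (average hπ), average_const]
  rfl

variable [CompleteSpace E]

/-- The inverse of `coupledLinear`, as a right inverse of norm at most `coupledBound`. -/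
def coupledRightInverse (hπ : AEStronglyMeasurable π μ) (hM : ∀ η, M η = η + Q (A₀.symm (B η))) :
    (coupledLinear hπ A₀ B Q).NonlinearRightInverse where
  toFun z := (coupledState hπ A₀ B Q M z, coupledMoment hπ A₀ Q M z)
  nnnorm := coupledBound A₀ B Q M
  bound' z := by
    rw [coupledBound, NNReal.coe_add, NNReal.coe_add, NNReal.coe_one, add_mul, add_mul, one_mul]
    have hstate := norm_coupledState_le (hπ := hπ) (A₀ := A₀) (B := B) (Q := Q) (M := M) z
    have hmoment := norm_coupledMoment_le (hπ := hπ) (A₀ := A₀) (Q := Q) (M := M) z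
    refine max_le (hstate.trans ?_) (hmoment.trans ?_)
    · exact le_add_of_le_of_nonneg (le_add_of_nonneg_right (by positivity)) (norm_nonneg z)
    · exact le_add_of_le_of_nonneg (le_add_of_nonneg_left (by positivity)) (norm_nonneg z)
  right_inv' z := by
    refine Prod.ext (ContinuousMap.ext fun a => ?_) ?_
    · simp [coupledLinear, coupledState]
    · have hmoment : M (coupledMoment hπ A₀ Q M z) = z.2 + Q (A₀.symm (average hπ z.1)) :=
        M.apply_symm_apply _
      rw [hM] at hmoment
      change coupledMoment hπ A₀ Q M z - Q (average hπ (coupledState hπ A₀ B Q M z)) = z.2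
      rw [average_coupledState, map_sub, map_sub, sub_sub_eq_add_sub, hmoment,
        add_sub_cancel_right]

theorem snd_coupledResidual_sub_sub (F : C(A × X × E, X)) (φ : C(X, E)) (z z' : C(A, X) × E) :
    (coupledResidual hπ F φ z - coupledResidual hπ F φ z' - coupledLinear hπ A₀ B Q (z - z')).2 =
      -average hπ (φ.comp z.1 - φ.comp z'.1 - (Q : C(X, E)).comp (z.1 - z'.1)) := by
  rw [map_sub (average hπ), map_sub (average hπ), average_comp]
  simp only [coupledResidual, coupledLinear, Prod.snd_sub, ContinuousLinearMap.prod_apply,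
    sub_apply, ContinuousLinearMap.comp_apply, ContinuousLinearMap.coe_fst',
    ContinuousLinearMap.coe_snd', Prod.fst_sub]
  abel

theorem approximatesLinearOn_coupledResidual {F : C(A × X × E, X)} {φ : C(X, E)} {z₀ : X × E}
    {ε : ℝ} {c : NNReal}
    (hF : ∀ a, ApproximatesLinearOn (fun z => F (a, z)) ((A₀ : X →L[ℝ] X).coprod B)
      (Metric.closedBall z₀ ε) c)
    (hφ : ApproximatesLinearOn φ Q (Metric.closedBall z₀.1 ε) c) :
    ApproximatesLinearOn (coupledResidual hπ F φ) (coupledLinear hπ A₀ B Q)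
      (Metric.closedBall (.const A z₀.1, z₀.2) ε) c := by
  intro z hz z' hz'
  refine max_le ((ContinuousMap.norm_le _ (by positivity)).2 fun a => ?_) ?_
  · exact (hF a _ (apply_mem_closedBall hz a) _ (apply_mem_closedBall hz' a)).trans
      (mul_le_mul_of_nonneg_left (norm_apply_prod_le (z - z') a) c.2)
  · have hfst {w : X × E} (hw : w ∈ Metric.closedBall z₀ ε) : w.1 ∈ Metric.closedBall z₀.1 ε :=
      Metric.mem_closedBall.2 ((le_max_left _ _).trans (Metric.mem_closedBall.1 hw))
    rw [snd_coupledResidual_sub_sub, norm_neg]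
    refine (norm_average_le _).trans ((ContinuousMap.norm_le _ (by positivity)).2 fun a => ?_)
    exact (hφ _ (hfst (apply_mem_closedBall hz a)) _ (hfst (apply_mem_closedBall hz' a))).trans
      (mul_le_mul_of_nonneg_left ((norm_fst_le _).trans (norm_apply_prod_le (z - z') a)) c.2)

theorem exists_coupled_eq_zero (hπ : AEStronglyMeasurable π μ)
    (hM : ∀ η, M η = η + Q (A₀.symm (B η))) {F : C(A × X × E, X)} {φ : C(X, E)} {z₀ : X × E}
    {ε b : ℝ} {c : NNReal}
    (hF : ∀ a, ApproximatesLinearOn (fun z => F (a, z)) ((A₀ : X →L[ℝ] X).coprod B)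
      (Metric.closedBall z₀ ε) c)
    (hφ : ApproximatesLinearOn φ Q (Metric.closedBall z₀.1 ε) c) (hFb : ∀ a, ‖F (a, z₀)‖ ≤ b)
    (hφb : ‖z₀.2 - φ z₀.1‖ ≤ b) (hc : coupledBound A₀ B Q M * c ≤ (1 / 2 : ℝ))
    (hb : 2 * coupledBound A₀ B Q M * b ≤ ε) :
    ∃ (w : C(A, X)) (η : E), (∀ a, F (a, w a, η) = 0) ∧ η = ∫ ξ, φ (w (π ξ)) ∂μ ∧
      ∀ a, (w a, η) ∈ Metric.closedBall z₀ ε := by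
  have hres : ‖coupledResidual hπ F φ (.const A z₀.1, z₀.2)‖ ≤ b := by
    refine max_le ((ContinuousMap.norm_le _ ((norm_nonneg _).trans hφb)).2 hFb) ?_
    change ‖z₀.2 - average hπ (.const A (φ z₀.1))‖ ≤ b
    rwa [average_const]
  obtain ⟨⟨w, η⟩, hz, hzero⟩ := exists_eq_zero_of_approximatesLinearOn
    (coupledRightInverse hπ hM) (add_pos_of_nonneg_of_pos zero_le one_pos)
    (approximatesLinearOn_coupledResidual hF hφ) hc
    ((mul_le_mul_of_nonneg_left hres (by positivity)).trans hb)
  refine ⟨w, η, fun a => DFunLike.congr_fun (congr_arg Prod.fst hzero) a,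
    sub_eq_zero.1 (congr_arg Prod.snd hzero), apply_mem_closedBall hz⟩

end CoupledSystem

/-! ### The Pontryagin system -/

section Linearization
variable {κ : ℝ} {c : Path T}

/-- The triples (state, costate, control). -/
abbrev Triple (T : ℝ) : Type := Path T × Path T × Path T

/-- The linearization of the Pontryagin system of a player around an extremal, for a frozen moment;
the costate is scaled so that eliminating it and the control leaves the Jacobi equation
`ẍ + c x = 0`. -/
def linearized (c : Path T) : Triple T →L[ℝ] Triple T :=
  let x := ContinuousLinearMap.fst ℝ (Path T) (Path T × Path T)
  let p := (ContinuousLinearMap.fst ℝ (Path T) (Path T)).comp (.snd ℝ (Path T) (Path T × Path T))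
  let u := (ContinuousLinearMap.snd ℝ (Path T) (Path T)).comp (.snd ℝ (Path T) (Path T × Path T))
  (x - (primitive T).comp u).prod
    ((p + (2 : ℝ) • (tailPrimitive T).comp ((ContinuousLinearMap.mul ℝ (Path T) c).comp x)).prod
      ((2 : ℝ) • u + p))

theorem linearized_apply (c x p u : Path T) : linearized c (x, p, u) =
    (x - primitive T u, p + (2 : ℝ) • tailPrimitive T (c * x), (2 : ℝ) • u + p) :=
  rfl

theorem linearized_eq_iff {x p u r s v : Path T} : linearized c (x, p, u) = (r, s, v) ↔
    x - green T (c * x) = r + primitive T ((1 / 2 : ℝ) • (v - s)) ∧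
      p = s - (2 : ℝ) • tailPrimitive T (c * x) ∧ u = (1 / 2 : ℝ) • (v - p) := by
  have hu : (2 : ℝ) • u + p = v ↔ u = (1 / 2 : ℝ) • (v - p) := by
    constructor <;> rintro rfl <;> module
  rw [linearized_apply, Prod.mk.injEq, Prod.mk.injEq, ← eq_sub_iff_add_eq, hu]
  refine and_congr_left ?_
  rintro ⟨rfl, rfl⟩
  have hstate : primitive T ((1 / 2 : ℝ) • (v - (s - (2 : ℝ) • tailPrimitive T (c * x)))) =
      primitive T ((1 / 2 : ℝ) • (v - s)) + green T (c * x) := by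
    rw [green_apply, ← map_add]
    congr 1
    module
  rw [hstate, sub_eq_iff_eq_add, sub_eq_iff_eq_add, add_assoc]

theorem IsNondegenerate.bijective_linearized (hc : IsNondegenerate c) :
    Function.Bijective (linearized c) := by
  refine ⟨(injective_iff_map_eq_zero _).2 ?_, ?_⟩
  · rintro ⟨x, p, u⟩ h
    obtain ⟨hx, rfl, rfl⟩ := linearized_eq_iff.1 (h.trans (rfl : 0 = ((0, 0, 0) : Triple T)))
    obtain rfl : x = 0 := hc x (sub_eq_zero.1 (by simpa using hx))
    simp
  · rintro ⟨r, s, v⟩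
    obtain ⟨x, hx⟩ := hc.surjective (r + primitive T ((1 / 2 : ℝ) • (v - s)))
    exact ⟨(x, _, _), linearized_eq_iff.2 ⟨hx, rfl, rfl⟩⟩

/-- `linearized`, as a linear isomorphism. -/
def IsNondegenerate.linearizedEquiv (hc : IsNondegenerate c) : Triple T ≃L[ℝ] Triple T :=
  .ofBijective (linearized c) (LinearMap.ker_eq_bot.2 hc.bijective_linearized.1)
    (LinearMap.range_eq_top.2 hc.bijective_linearized.2)

theorem IsNondegenerate.coe_linearizedEquiv (hc : IsNondegenerate c) :
    (hc.linearizedEquiv : Triple T →L[ℝ] Triple T) = linearized c := rfl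

/-- The influence of the moment on the linearized Pontryagin system. -/
def momentInfluence (κ : ℝ) : Path T →L[ℝ] Triple T :=
  (0 : Path T →L[ℝ] Path T).prod (((2 * κ) • tailPrimitive T).prod 0)

theorem momentInfluence_apply (η : Path T) :
    momentInfluence κ η = (0, (2 * κ) • tailPrimitive T η, 0) := rfl

theorem fst_linearizedEquiv_symm_eq_iff (hc : IsNondegenerate c) {η x : Path T} :
    (hc.linearizedEquiv.symm (momentInfluence κ η)).1 = x ↔ x = green T (c * x - κ • η) := by
  have hiff : x = green T (c * x - κ • η) ↔
      x - green T (c * x) =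
        0 + primitive T ((1 / 2 : ℝ) • (0 - (2 * κ) • tailPrimitive T η)) := by
    have hmoment : primitive T ((1 / 2 : ℝ) • (0 - (2 * κ) • tailPrimitive T η)) =
        -green T (κ • η) := by
      have hcostate : (1 / 2 : ℝ) • (0 - (2 * κ) • tailPrimitive T η) =
          tailPrimitive T (-(κ • η)) := by
        rw [map_neg, map_smul]
        module
      rw [hcostate, ← green_apply, map_neg]
    rw [hmoment, map_sub, sub_eq_iff_eq_add', zero_add, ← sub_eq_add_neg]
  rw [hiff]
  constructor
  · rintro rfl
    have h : linearized c (hc.linearizedEquiv.symm (momentInfluence κ η)) = momentInfluence κ η :=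
      hc.linearizedEquiv.apply_symm_apply _
    exact (linearized_eq_iff.1 h).1
  · intro hx
    exact congr_arg Prod.fst (hc.linearizedEquiv.symm_apply_eq.2
      (linearized_eq_iff.2 ⟨hx, rfl, rfl⟩).symm)

/-- The linearization of the equilibrium equation with respect to the moment: the operator
`1 + x A₀⁻¹ B`, where `A₀` is the linearized Pontryagin system, `B` the influence of the moment, and
`x` the state component. -/
def linearizedMoment (κ : ℝ) (hc : IsNondegenerate c) : Path T →L[ℝ] Path T :=
  .id ℝ _ + (ContinuousLinearMap.fst ℝ _ _).comp
    ((hc.linearizedEquiv.symm : Triple T →L[ℝ] Triple T).comp (momentInfluence κ))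

theorem linearizedMoment_eq_iff (hc : IsNondegenerate c) {η r : Path T} :
    linearizedMoment κ hc η = r ↔ (η - r) - green T ((c + κ • 1) * (η - r)) = κ • green T r := by
  have h : linearizedMoment κ hc η = r ↔
      (hc.linearizedEquiv.symm (momentInfluence κ η)).1 = -(η - r) := by
    rw [neg_sub, eq_sub_iff_add_eq']
    rfl
  have hr : c * -(η - r) - κ • η = -((c + κ • 1) * (η - r)) - κ • r := by
    rw [add_mul, smul_mul_assoc, one_mul, mul_neg, smul_sub]
    abel
  rw [h, fst_linearizedEquiv_symm_eq_iff, hr, map_sub, map_neg, map_smul, ← neg_inj, neg_neg,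
    neg_sub, sub_neg_eq_add]
  exact sub_eq_iff_eq_add.symm

theorem bijective_linearizedMoment (hc : IsNondegenerate c) (hcκ : IsNondegenerate (c + κ • 1)) :
    Function.Bijective (linearizedMoment κ hc) := by
  refine ⟨(injective_iff_map_eq_zero _).2 fun η hη => hcκ η ?_, fun r => ?_⟩
  · simpa [sub_eq_zero] using (linearizedMoment_eq_iff hc).1 hη
  · obtain ⟨x, hx⟩ := hcκ.surjective (κ • green T r)
    exact ⟨x + r, (linearizedMoment_eq_iff hc).2 (by rwa [add_sub_cancel_right])⟩

/-- `linearizedMoment`, as a linear isomorphism. -/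
def linearizedMomentEquiv (hc : IsNondegenerate c) (hcκ : IsNondegenerate (c + κ • 1)) :
    Path T ≃L[ℝ] Path T :=
  .ofBijective (linearizedMoment κ hc)
    (LinearMap.ker_eq_bot.2 (bijective_linearizedMoment hc hcκ).1)
    (LinearMap.range_eq_top.2 (bijective_linearizedMoment hc hcκ).2)

theorem linearizedMomentEquiv_apply (hc : IsNondegenerate c) (hcκ : IsNondegenerate (c + κ • 1))
    (η : Path T) : linearizedMomentEquiv hc hcκ η =
      η + ContinuousLinearMap.fst ℝ (Path T) (Path T × Path T)
        (hc.linearizedEquiv.symm (momentInfluence κ η)) := rfl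

end Linearization

section PontryaginSystem
variable {κ δ P : ℝ} {G : ScalarGame T}

/-- The left-hand side of the Pontryagin system of the barycenter game, as an operator on a triple
(state, costate, control) and a moment. -/
def pontryagin (κ : ℝ) (z : Triple T × Path T) : Triple T :=
  (z.1.1 - primitive T z.1.2.2,
    z.1.2.1 + (2 : ℝ) • tailPrimitive T (force.comp z.1.1 + κ • (z.2 - z.1.1)),
    (2 : ℝ) • z.1.2.2 + z.1.2.1)

theorem continuous_pontryagin : Continuous (pontryagin (T := T) κ) := by
  have : Continuous fun z : Triple T × Path T => force.comp z.1.1 :=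
    force.continuous_postcomp.comp (by fun_prop)
  unfold pontryagin
  fun_prop

/-- The extremal of the barycenter game with state `y`, when `y` is an equilibrium. -/
def equilibriumTriple (y : Path T) : Triple T :=
  (y, (-2 : ℝ) • tailPrimitive T (force.comp y), tailPrimitive T (force.comp y))

theorem pontryagin_equilibriumTriple {y : Path T} (hy : y = green T (force.comp y)) :
    pontryagin κ (equilibriumTriple y, y) = 0 := by
  refine Prod.ext (sub_eq_zero.2 hy) (Prod.ext ?_ ?_) <;>
    simp [pontryagin, equilibriumTriple]

theorem norm_force_comp_sub_sub_le {y x x' : Path T} {ε : ℝ} (hx : ‖x - y‖ ≤ ε)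
    (hx' : ‖x' - y‖ ≤ ε) :
    ‖force.comp x - force.comp x' - stiffness.comp y * (x - x')‖ ≤ 12 * ε * ‖x - x'‖ := by
  have hε : 0 ≤ ε := (norm_nonneg _).trans hx
  exact norm_path_le (by positivity) fun t =>
    (abs_force_sub_sub_le ((abs_apply_le_norm (x - y) t).trans hx)
      ((abs_apply_le_norm (x' - y) t).trans hx')).trans
        (mul_le_mul_of_nonneg_left (abs_apply_le_norm (x - x') t) (by positivity))

theorem norm_pontryagin_sub_sub_le [Fact (0 ≤ T)] {y : Path T} {z z' : Triple T × Path T} {ε : ℝ}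
    (hz : ‖z.1.1 - y‖ ≤ ε) (hz' : ‖z'.1.1 - y‖ ≤ ε) :
    ‖pontryagin κ z - pontryagin κ z' -
      (linearized (stiffness.comp y - κ • 1)).coprod (momentInfluence κ) (z - z')‖ ≤
        24 * T * ε * ‖z - z'‖ := by
  have hT : 0 ≤ T := Fact.out
  have hε : 0 ≤ ε := (norm_nonneg _).trans hz
  have hremainder : pontryagin κ z - pontryagin κ z' -
      (linearized (stiffness.comp y - κ • 1)).coprod (momentInfluence κ) (z - z') =
      (0, (2 : ℝ) • tailPrimitive T (force.comp z.1.1 - force.comp z'.1.1 -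
        stiffness.comp y * (z.1.1 - z'.1.1)), 0) := by
    obtain ⟨⟨x, p, u⟩, η⟩ := z
    obtain ⟨⟨x', p', u'⟩, η'⟩ := z'
    simp only [pontryagin, ContinuousLinearMap.coprod_apply, Prod.mk_sub_mk, linearized_apply,
      momentInfluence_apply, Prod.mk_add_mk, Prod.mk.injEq, sub_mul, smul_mul_assoc, one_mul,
      map_sub, map_add, map_smul]
    refine ⟨?_, ?_, ?_⟩ <;> module
  have hx : ‖z.1.1 - z'.1.1‖ ≤ ‖z - z'‖ := (norm_fst_le (z.1 - z'.1)).trans (norm_fst_le (z - z'))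
  rw [hremainder, Prod.norm_mk, Prod.norm_mk, norm_zero, max_eq_left (norm_nonneg _),
    max_eq_right (norm_nonneg _), norm_smul, Real.norm_ofNat]
  calc _ ≤ 2 * (T * (12 * ε * ‖z - z'‖)) := by
        refine mul_le_mul_of_nonneg_left ((norm_tailPrimitive_le _).trans ?_) zero_le_two
        refine mul_le_mul_of_nonneg_left ((norm_force_comp_sub_sub_le hz hz').trans ?_) hT
        exact mul_le_mul_of_nonneg_left hx (by positivity)
    _ = 24 * T * ε * ‖z - z'‖ := by ring

/-- The path `(x, u, η)` at which the data of a game are evaluated. -/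
def profile (z : Triple T × Path T) : C(Time T, ℝ × ℝ × ℝ) := z.1.1.prodMk (z.1.2.2.prodMk z.2)

theorem norm_profile_sub_le (z z' : Triple T × Path T) :
    ‖profile z - profile z'‖ ≤ ‖z - z'‖ := by
  have hx : ‖z.1.1 - z'.1.1‖ ≤ ‖z - z'‖ := (norm_fst_le (z.1 - z'.1)).trans (norm_fst_le (z - z'))
  have hu : ‖z.1.2.2 - z'.1.2.2‖ ≤ ‖z - z'‖ := (norm_snd_le (z.1.2 - z'.1.2)).trans <|
    (norm_snd_le (z.1 - z'.1)).trans (norm_fst_le (z - z'))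
  have hη : ‖z.2 - z'.2‖ ≤ ‖z - z'‖ := norm_snd_le (z - z')
  exact (ContinuousMap.norm_le _ (norm_nonneg _)).2 fun t =>
    max_le ((abs_apply_le_norm (z.1.1 - z'.1.1) t).trans hx) <|
      max_le ((abs_apply_le_norm (z.1.2.2 - z'.1.2.2) t).trans hu)
        ((abs_apply_le_norm (z.2 - z'.2) t).trans hη)

theorem IsSmallOn.superpose_profile {c : ℝ} (hc : 0 ≤ c) {g : ℝ × ℝ × ℝ × ℝ → ℝ}
    (h : IsSmallOn c g (strip T (ℝ × ℝ × ℝ))) (S : Set (Triple T × Path T)) :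
    IsSmallOn c (fun z => MFG.superpose h.continuousOn (profile z)) S :=
  (h.superpose hc).comp hc (mapsTo_univ _ _) norm_profile_sub_le

theorem IsC2Small.isSmallOn_deriv {c : ℝ} {g : ℝ → ℝ} (h : IsC2Small c g univ) :
    IsSmallOn c (deriv g) univ := by
  have hderiv := h.isSmallOn_fderivWithin.clm_apply (v := 1) norm_one.le
  simp only [fderivWithin_univ, fderiv_apply_one_eq_deriv] at hderiv
  exact hderiv

/-- The contribution of the defects of a perturbed game to its Pontryagin system. -/
def pontryaginDefect [Fact (0 ≤ T)] (hG : IsPerturbation κ δ G) (z : Triple T × Path T) :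
    Triple T :=
  (-primitive T (superpose hG.dynamics.isSmallOn.continuousOn (profile z)),
    -(deriv G.ψ (z.1.1 ⊤) • 1 + tailPrimitive T
      (superpose hG.cost.isSmallOn_stateDeriv.continuousOn (profile z) +
        z.1.2.1 * superpose hG.dynamics.isSmallOn_stateDeriv.continuousOn (profile z))),
    superpose hG.cost.isSmallOn_controlDeriv.continuousOn (profile z) +
      z.1.2.1 * superpose hG.dynamics.isSmallOn_controlDeriv.continuousOn (profile z))

theorem isSmallOn_pontryaginDefect [Fact (0 ≤ T)] (hG : IsPerturbation κ δ G) (hP : 0 ≤ P) :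
    IsSmallOn ((1 + T) * (3 + P) * δ) (pontryaginDefect hG) {z | ‖z.1.2.1‖ ≤ P} := by
  have hT : 0 ≤ T := Fact.out
  have hδ : 0 ≤ δ := hG.nonneg
  have hp_lip (z z' : Triple T × Path T) : ‖z.1.2.1 - z'.1.2.1‖ ≤ ‖z - z'‖ :=
    (norm_fst_le (z.1.2 - z'.1.2)).trans <| (norm_snd_le (z.1 - z'.1)).trans (norm_fst_le (z - z'))
  have hx_lip (z z' : Triple T × Path T) : ‖z.1.1 ⊤ - z'.1.1 ⊤‖ ≤ ‖z - z'‖ :=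
    (abs_apply_le_norm (z.1.1 - z'.1.1) ⊤).trans <|
      (norm_fst_le (z.1 - z'.1)).trans (norm_fst_le (z - z'))
  have hone (r : ℝ) : ‖ContinuousLinearMap.toSpanSingleton ℝ (1 : Path T) r‖ ≤ 1 * ‖r‖ := by
    rw [ContinuousLinearMap.toSpanSingleton_apply, norm_smul, mul_comm]
    exact mul_le_mul_of_nonneg_right norm_path_one_le (norm_nonneg r)
  set S := {z : Triple T × Path T | ‖z.1.2.1‖ ≤ P}
  have hp_le : ∀ z ∈ S, ‖z.1.2.1‖ ≤ P := fun _ hz => hz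
  have hterminal := (hG.terminal.isSmallOn_deriv.comp hδ (mapsTo_univ _ S) hx_lip).clm_comp _
    zero_le_one hone
  have hcostate := (hG.cost.isSmallOn_stateDeriv.superpose_profile hδ S).add
    ((hG.dynamics.isSmallOn_stateDeriv.superpose_profile hδ S).mul hp_le hp_lip)
  have hcontrol := (hG.cost.isSmallOn_controlDeriv.superpose_profile hδ S).add
    ((hG.dynamics.isSmallOn_controlDeriv.superpose_profile hδ S).mul hp_le hp_lip)
  have hstate := (hG.dynamics.isSmallOn.superpose_profile hδ S).clm_comp _ hT norm_primitive_le
  have hTδ : 0 ≤ T * δ := by positivity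
  have hPδ : 0 ≤ P * δ := by positivity
  have hTPδ : 0 ≤ T * P * δ := by positivity
  exact (hstate.neg.weaken (by linarith)).prodMk
    (((hterminal.add (hcostate.clm_comp _ hT norm_tailPrimitive_le)).neg.weaken
      (by linarith)).prodMk (hcontrol.weaken (by linarith)))

theorem continuous_pontryaginDefect [Fact (0 ≤ T)] (hG : IsPerturbation κ δ G) :
    Continuous (pontryaginDefect hG) := by
  refine continuous_iff_continuousAt.2 fun z => ?_
  have hp : Continuous fun z : Triple T × Path T => ‖z.1.2.1‖ := by fun_prop
  have hsmall := isSmallOn_pontryaginDefect hG (P := ‖z.1.2.1‖ + 1) (by positivity)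
  exact hsmall.continuousOn.continuousAt
    (hp.continuousAt.preimage_mem_nhds (Iic_mem_nhds (lt_add_one _)))

/-- The left-hand side of the Pontryagin system of a perturbed game, as a function of the initial
point, the triple and the moment. -/
def perturbedPontryagin [Fact (0 ≤ T)] (hG : IsPerturbation κ δ G) (A : Set ℝ) :
    C(A × Triple T × Path T, Triple T) where
  toFun z := (pontryagin κ z.2 - ((z.1 : ℝ) • 1, 0, 0)) + pontryaginDefect hG z.2
  continuous_toFun := by
    have := continuous_pontryaginDefect hG
    have := continuous_pontryagin (T := T) (κ := κ)
    fun_prop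

theorem isExtremal_of_perturbedPontryagin_eq_zero [Fact (0 ≤ T)] (hG : IsPerturbation κ δ G)
    {A : Set ℝ} {a : A} {x p u η : Path T}
    (h : perturbedPontryagin hG A (a, (x, p, u), η) = 0) :
    IsExtremal κ G η a x p u ((-2 : ℝ) • (force.comp x + κ • (η - x)) +
      (superpose hG.cost.isSmallOn_stateDeriv.continuousOn (profile ((x, p, u), η)) +
        p * superpose hG.dynamics.isSmallOn_stateDeriv.continuousOn (profile ((x, p, u), η)))) where
  state t := by
    have hx : x = (a : ℝ) • 1 + primitive T
        (u + superpose hG.dynamics.isSmallOn.continuousOn (profile ((x, p, u), η))) := by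
      refine sub_eq_zero.1 (Eq.trans ?_ (congr_arg Prod.fst h))
      simp only [perturbedPontryagin, pontryagin, pontryaginDefect, map_add, ContinuousMap.coe_mk,
        Prod.fst_add, Prod.fst_sub]
      abel
    refine (DFunLike.congr_fun hx t).trans ?_
    simp only [ContinuousMap.add_apply, ContinuousMap.smul_apply, ContinuousMap.one_apply,
      smul_eq_mul, mul_one, primitive_apply, G.f_eq]
    rfl
  force_eq t := rfl
  costate t := by
    have hp : p = deriv G.ψ (x ⊤) • 1 + tailPrimitive T ((-2 : ℝ) • (force.comp x + κ • (η - x)) +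
        (superpose hG.cost.isSmallOn_stateDeriv.continuousOn (profile ((x, p, u), η)) +
          p * superpose hG.dynamics.isSmallOn_stateDeriv.continuousOn
            (profile ((x, p, u), η)))) := by
      refine sub_eq_zero.1 (Eq.trans ?_ (congr_arg (fun w => w.2.1) h))
      simp only [perturbedPontryagin, pontryagin, pontryaginDefect, map_add, map_smul,
        ContinuousMap.coe_mk, Prod.snd_add, Prod.snd_sub, Prod.fst_add, Prod.fst_sub]
      module
    refine (DFunLike.congr_fun hp t).trans ?_
    rw [ContinuousMap.add_apply, ContinuousMap.smul_apply, ContinuousMap.one_apply, smul_eq_mul,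
      mul_one]
  stationary t := by
    have hu : (2 : ℝ) • u + p +
        (superpose hG.cost.isSmallOn_controlDeriv.continuousOn (profile ((x, p, u), η)) +
          p * superpose hG.dynamics.isSmallOn_controlDeriv.continuousOn
            (profile ((x, p, u), η))) = 0 := by
      refine Eq.trans ?_ (congr_arg (fun w => w.2.2) h)
      simp only [perturbedPontryagin, pontryagin, pontryaginDefect, ContinuousMap.coe_mk,
        Prod.snd_add, Prod.snd_sub]
      abel
    exact DFunLike.congr_fun hu t

end PontryaginSystem

/-! ### Structural stability -/

open Filter Topology

theorem approximatesLinearOn_add {X Y : Type*} [NormedAddCommGroup X] [NormedSpace ℝ X]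
    [NormedAddCommGroup Y] [NormedSpace ℝ Y] {f N : X → Y} {L : X →L[ℝ] Y} {S : Set X} {k c : ℝ}
    (hf : ∀ z ∈ S, ∀ z' ∈ S, ‖f z - f z' - L (z - z')‖ ≤ k * ‖z - z'‖) (hN : IsSmallOn c N S) :
    ApproximatesLinearOn (fun z => f z + N z) L S (k + c).toNNReal := fun z hz z' hz' => by
  calc ‖f z + N z - (f z' + N z') - L (z - z')‖
      = ‖(f z - f z' - L (z - z')) + (N z - N z')‖ := by congr 1; abel
    _ ≤ (k + c) * ‖z - z'‖ :=
        (norm_add_le_of_le (hf z hz z' hz') (hN.norm_sub_le z hz z' hz')).trans_eq (by ring)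
    _ ≤ (k + c).toNNReal * ‖z - z'‖ :=
        mul_le_mul_of_nonneg_right (Real.le_coe_toNNReal _) (norm_nonneg _)

theorem eventually_mul_le (A : ℝ) {B : ℝ} (hB : 0 < B) : ∀ᶠ ε in 𝓝[>] (0 : ℝ), A * ε ≤ B := by
  have hlim : Tendsto (fun ε : ℝ => A * ε) (𝓝[>] 0) (𝓝 (A * 0)) :=
    (continuous_const.mul continuous_id).continuousWithinAt
  rw [mul_zero] at hlim
  exact hlim.eventually_le_const hB

section MomentMap
variable {κ δ : ℝ} {G : ScalarGame T}

/-- The operator `(x, p, u) ↦ φ(t, x(t))` given by the moment function `φ` of a perturbed game. -/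
def momentMap (hG : IsPerturbation κ δ G) : C(Triple T, Path T) where
  toFun z := z.1 + superpose hG.moment.isSmallOn.continuousOn z.1
  continuous_toFun := by
    have := (hG.moment.isSmallOn.superpose hG.nonneg).continuous
    fun_prop

theorem momentMap_apply (hG : IsPerturbation κ δ G) (z : Triple T) (t : Time T) :
    momentMap hG z t = G.φ t (z.1 t) := (G.φ_eq _ _).symm

theorem approximatesLinearOn_momentMap (hG : IsPerturbation κ δ G) (S : Set (Triple T)) :
    ApproximatesLinearOn (momentMap hG) (.fst ℝ (Path T) (Path T × Path T)) S δ.toNNReal := by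
  have hsmall := (hG.moment.isSmallOn.superpose hG.nonneg).comp hG.nonneg (mapsTo_univ _ S)
    fun z z' : Triple T => norm_fst_le (z - z')
  have h := approximatesLinearOn_add (f := Prod.fst)
    (L := .fst ℝ (Path T) (Path T × Path T)) (k := 0) (by simp) hsmall
  rwa [zero_add] at h

theorem norm_sub_momentMap_le (hG : IsPerturbation κ δ G) (z : Triple T) :
    ‖z.1 - momentMap hG z‖ ≤ δ := by
  rw [momentMap, ContinuousMap.coe_mk, sub_add_cancel_left, norm_neg]
  exact (hG.moment.isSmallOn.superpose hG.nonneg).norm_le _ trivial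

theorem isMoment_of_eq_integral_momentMap (hG : IsPerturbation κ δ G) {A : Type*}
    [TopologicalSpace A] [CompactSpace A] {π : Player → A} (hπ : AEStronglyMeasurable π volume)
    {w : C(A, Triple T)} {η : Path T} (hη : η = ∫ ξ, momentMap hG (w (π ξ))) :
    G.IsMoment (fun ξ => (w (π ξ)).1) η := fun t => by
  have hint := integrable_continuousMap_comp hπ ((momentMap hG).comp w)
  simp only [← momentMap_apply hG]
  refine ⟨(ContinuousMap.evalCLM ℝ t).integrable_comp hint, ?_⟩
  rw [hη]
  exact ((ContinuousMap.evalCLM ℝ t).integral_comp_comm hint).symm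

end MomentMap

section PerturbedEquilibrium
variable {κ δ ε : ℝ} {G : ScalarGame T} {y : Path T}

theorem norm_costate_le {z : Triple T} (hz : z ∈ Metric.closedBall (equilibriumTriple y) 1) :
    ‖z.2.1‖ ≤ ‖(equilibriumTriple y).2.1‖ + 1 := by
  have hp : ‖z.2.1 - (equilibriumTriple y).2.1‖ ≤ 1 :=
    (norm_fst_le (z - equilibriumTriple y).2).trans <|
      (norm_snd_le (z - equilibriumTriple y)).trans (mem_closedBall_iff_norm.1 hz)
  linarith [norm_sub_norm_le z.2.1 (equilibriumTriple y).2.1]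

variable [Fact (0 ≤ T)]

/-- The Lipschitz constant, relative to the size of the perturbation, of the defect of the
Pontryagin system near the equilibrium `y`. -/
def defectBound (y : Path T) : ℝ := (1 + T) * (3 + (‖(equilibriumTriple y).2.1‖ + 1))

theorem one_le_defectBound : 1 ≤ defectBound y := by
  have hT : 0 ≤ T := Fact.out
  have := norm_nonneg (equilibriumTriple y).2.1
  exact one_le_mul_of_one_le_of_one_le (by linarith) (by linarith)

theorem isSmallOn_pontryaginDefect_closedBall (hG : IsPerturbation κ δ G) (hε : ε ≤ 1) :
    IsSmallOn (defectBound y * δ) (pontryaginDefect hG)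
      (Metric.closedBall (equilibriumTriple y, y) ε) := by
  refine (isSmallOn_pontryaginDefect hG (by positivity)).subset fun z hz => norm_costate_le ?_
  rw [← closedBall_prod_same] at hz
  exact Metric.closedBall_subset_closedBall hε hz.1

theorem approximatesLinearOn_perturbedPontryagin (hG : IsPerturbation κ δ G) (hε : ε ≤ 1)
    {A : Set ℝ} (a : A) :
    ApproximatesLinearOn (fun z => perturbedPontryagin hG A (a, z))
      ((linearized (stiffness.comp y - κ • 1)).coprod (momentInfluence κ))
      (Metric.closedBall (equilibriumTriple y, y) ε)
      (24 * T * ε + defectBound y * δ).toNNReal := by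
  refine approximatesLinearOn_add (fun z hz z' hz' => ?_)
    (isSmallOn_pontryaginDefect_closedBall hG hε)
  rw [← closedBall_prod_same] at hz hz'
  rw [sub_sub_sub_cancel_right]
  exact norm_pontryagin_sub_sub_le
    ((norm_fst_le (z.1 - equilibriumTriple y)).trans (mem_closedBall_iff_norm.1 hz.1))
    ((norm_fst_le (z'.1 - equilibriumTriple y)).trans (mem_closedBall_iff_norm.1 hz'.1))

theorem norm_perturbedPontryagin_equilibriumTriple_le (hG : IsPerturbation κ δ G)
    (hy : y = green T (force.comp y)) (a : Icc (-δ) δ) :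
    ‖perturbedPontryagin hG _ (a, equilibriumTriple y, y)‖ ≤ (1 + defectBound y) * δ := by
  have hinit : ‖(((a : ℝ) • 1, 0, 0) : Triple T)‖ ≤ δ := by
    rw [Prod.norm_mk, Prod.norm_mk, norm_zero, max_self, max_eq_left (norm_nonneg _), norm_smul]
    exact (mul_le_of_le_one_right (norm_nonneg _) norm_path_one_le).trans (abs_le.2 a.2)
  have hdefect := (isSmallOn_pontryaginDefect_closedBall hG le_rfl).norm_le (equilibriumTriple y, y)
    (Metric.mem_closedBall_self zero_le_one)
  have heq : perturbedPontryagin hG _ (a, equilibriumTriple y, y) =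
      -((a : ℝ) • 1, 0, 0) + pontryaginDefect hG (equilibriumTriple y, y) := by
    rw [perturbedPontryagin, ContinuousMap.coe_mk, pontryagin_equilibriumTriple hy, zero_sub]
  rw [heq, add_mul, one_mul]
  exact norm_add_le_of_le ((norm_neg _).trans_le hinit) hdefect

theorem isNondegenerate_stiffness_comp_sub_smul (hκ : 1 < κ) (y : Path T) :
    IsNondegenerate (stiffness.comp y - κ • 1) :=
  isNondegenerate_of_nonpos fun t => by
    have := (abs_le.1 (abs_stiffness_le (y t))).2
    simp only [ContinuousMap.toFun_eq_coe, ContinuousMap.sub_apply, ContinuousMap.comp_apply,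
      ContinuousMap.coe_smul, ContinuousMap.coe_one, Pi.smul_apply, Pi.one_apply, smul_eq_mul,
      mul_one, ContinuousMap.zero_apply]
    linarith

theorem exists_const_forall_perturbedPontryagin_eq_zero (hκ : 1 < κ)
    (hy : y = green T (force.comp y)) (hnd : IsNondegenerate (stiffness.comp y)) :
    ∃ K : ℝ, ∀ {δ ε : ℝ} {G : ScalarGame T} (hG : IsPerturbation κ δ G) {π : Player → Icc (-δ) δ},
      AEStronglyMeasurable π volume → 0 ≤ ε → ε ≤ 1 →
      K * (24 * T * ε + defectBound y * δ) ≤ 1 / 2 → 2 * K * ((1 + defectBound y) * δ) ≤ ε →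
      ∃ (w : C(Icc (-δ) δ, Triple T)) (η : Path T),
        (∀ a, perturbedPontryagin hG _ (a, w a, η) = 0) ∧ η = ∫ ξ, momentMap hG (w (π ξ)) ∧
          ∀ a, w a ∈ Metric.closedBall (equilibriumTriple y) ε := by
  have hT : 0 ≤ T := Fact.out
  have hcontrol := isNondegenerate_stiffness_comp_sub_smul hκ y
  have hmoment : IsNondegenerate (stiffness.comp y - κ • 1 + κ • 1) := by rwa [sub_add_cancel]
  refine ⟨coupledBound hcontrol.linearizedEquiv (momentInfluence κ) (.fst ℝ _ _)
    (linearizedMomentEquiv hcontrol hmoment), fun {δ ε G} hG π hπ hε0 hε1 hc hb => ?_⟩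
  have hδ : 0 ≤ δ := hG.nonneg
  have hbound : 1 ≤ defectBound y := one_le_defectBound
  have hδ_le : δ ≤ 24 * T * ε + defectBound y * δ :=
    le_add_of_nonneg_of_le (by positivity) (le_mul_of_one_le_left hδ hbound)
  rw [← Real.coe_toNNReal _ (hδ.trans hδ_le)] at hc
  have happrox := approximatesLinearOn_perturbedPontryagin (y := y) hG hε1 (A := Icc (-δ) δ)
  rw [← hcontrol.coe_linearizedEquiv] at happrox
  obtain ⟨w, η, hw, hη, hball⟩ := exists_coupled_eq_zero hπ
    (linearizedMomentEquiv_apply hcontrol hmoment) happrox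
    ((approximatesLinearOn_momentMap hG _).mono_num (Real.toNNReal_le_toNNReal hδ_le))
    (norm_perturbedPontryagin_equilibriumTriple_le hG hy)
    ((norm_sub_momentMap_le hG (equilibriumTriple y)).trans
      (le_mul_of_one_le_left hδ (by linarith))) hc hb
  refine ⟨w, η, hw, hη, fun a => ?_⟩
  have ha := hball a
  rw [← closedBall_prod_same] at ha
  exact ha.1

theorem eventually_exists_perturbedPontryagin_eq_zero (hκ : 1 < κ)
    (hy : y = green T (force.comp y)) (hnd : IsNondegenerate (stiffness.comp y)) (hε : 0 < ε) :
    ∀ᶠ δ in 𝓝[>] (0 : ℝ), ∀ {G : ScalarGame T} (hG : IsPerturbation κ δ G)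
      {π : Player → Icc (-δ) δ}, AEStronglyMeasurable π volume →
      ∃ (w : C(Icc (-δ) δ, Triple T)) (η : Path T),
        (∀ a, perturbedPontryagin hG _ (a, w a, η) = 0) ∧ η = ∫ ξ, momentMap hG (w (π ξ)) ∧
          ∀ a, w a ∈ Metric.closedBall (equilibriumTriple y) ε := by
  obtain ⟨K, hK⟩ := exists_const_forall_perturbedPontryagin_eq_zero hκ hy hnd
  obtain ⟨ρ, hρ0, hρε, hρ1, hρK⟩ := (eventually_mem_nhdsWithin.and <|
    (eventually_mul_le 1 hε).and <| (eventually_mul_le 1 one_pos).and <|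
      eventually_mul_le (K * (24 * T)) (by norm_num : (0 : ℝ) < 1 / 4)).exists
  rw [one_mul] at hρε hρ1
  filter_upwards [eventually_mul_le (K * defectBound y) (by norm_num : (0 : ℝ) < 1 / 4),
    eventually_mul_le (2 * K * (1 + defectBound y)) hρ0] with δ hδK hδρ G hG π hπ
  obtain ⟨w, η, hw, hη, hball⟩ := hK hG hπ (le_of_lt hρ0) hρ1 (by linarith) (by linarith)
  exact ⟨w, η, hw, hη, fun a => Metric.closedBall_subset_closedBall hρε (hball a)⟩

end PerturbedEquilibrium

section StructuralStability
variable {κ δ ε : ℝ} {hT : 0 ≤ T} {G : ScalarGame T} {y : Path T}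

theorem ScalarGame.IsNear.ae_xinit_mem_Icc (h : (barycenterGame κ T hT).IsNear G δ) :
    ∀ᵐ ξ, G.xinit ξ ∈ Icc (-δ) δ := by
  have hnear := h.xinit_near
  rw [eLpNorm_exponent_top] at hnear
  filter_upwards [ae_lt_of_essSup_lt hnear] with ξ hξ
  have hlt : ‖G.xinit ξ‖ₑ < ENNReal.ofReal δ := by simpa [barycenterGame] using hξ
  rw [← ofReal_norm, ENNReal.ofReal_lt_ofReal_iff_of_nonneg (norm_nonneg _)] at hlt
  exact abs_le.1 hlt.le

theorem iSup_integral_abs_sub_le [Fact (0 ≤ T)] {x : Player → Path T} (h : ∀ ξ, ‖x ξ - y‖ ≤ ε) :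
    ⨆ t, ∫ ξ, |x ξ t - y t| ≤ ε :=
  ciSup_le fun t => (le_abs_self _).trans <| by
    simpa using norm_integral_le_of_norm_le_const (μ := (volume : Measure Player))
      (f := fun ξ => |x ξ t - y t|) (.of_forall fun ξ => by
        rw [Real.norm_eq_abs, abs_abs]
        exact (abs_apply_le_norm (x ξ - y) t).trans (h ξ))

theorem IsPerturbation.isSolution [Fact (0 ≤ T)] (hκ : 1 < κ) (hG : IsPerturbation κ δ G)
    (hδ : δ * (1 + (‖(equilibriumTriple y).2.1‖ + 1) + 8 * T) ≤ 1 / 2)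
    (hδκ : δ * (1 + (‖(equilibriumTriple y).2.1‖ + 1) + 8 * T) ≤ (κ - 1) / 2)
    {A : Set ℝ} [CompactSpace A] {π : Player → A} (hπ : AEStronglyMeasurable π volume)
    (hinit : ∀ᵐ ξ, (π ξ : ℝ) = G.xinit ξ) {w : C(A, Triple T)} {η : Path T}
    (hw : ∀ a, perturbedPontryagin hG A (a, w a, η) = 0)
    (hη : η = ∫ ξ, momentMap hG (w (π ξ)))
    (hball : ∀ a, w a ∈ Metric.closedBall (equilibriumTriple y) 1) :
    G.IsSolution fun ξ => (w (π ξ)).1 := by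
  refine ⟨(integrable_continuousMap_comp hπ w).fst, fun ξ => (w (π ξ)).2.2, η,
    isMoment_of_eq_integral_momentMap hG hπ hη, ?_⟩
  filter_upwards [hinit] with ξ hξ
  rw [← hξ]
  exact (isExtremal_of_perturbedPontryagin_eq_zero hG (hw (π ξ))).isOptimal hκ hG
    (norm_costate_le (hball _)) hδ hδκ

theorem isStructurallyStable_of_isNondegenerate (hT0 : 0 < T) (hκ : 1 < κ)
    (hy : y = green T (force.comp y)) (hnd : IsNondegenerate (stiffness.comp y)) :
    (barycenterGame κ T hT).IsStructurallyStable fun _ => y := by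
  have : Fact (0 ≤ T) := ⟨hT⟩
  intro ε hε
  have hρ : 0 < min (ε / 2) 1 := by positivity
  obtain ⟨δ, hδ0, hsolve, hδ, hδκ⟩ := (eventually_mem_nhdsWithin.and <|
    (eventually_exists_perturbedPontryagin_eq_zero hκ hy hnd hρ).and <|
      (eventually_mul_le (1 + (‖(equilibriumTriple y).2.1‖ + 1) + 8 * T) one_half_pos).and <|
        eventually_mul_le (1 + (‖(equilibriumTriple y).2.1‖ + 1) + 8 * T)
          (half_pos (sub_pos.2 hκ))).exists
  refine ⟨δ, hδ0, fun G hnear => ?_⟩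
  have hG := hnear.isPerturbation hT0
  have hπ : AEStronglyMeasurable (fun ξ => projIcc (-δ) δ (neg_le_self hG.nonneg) (G.xinit ξ))
      volume :=
    continuous_projIcc.comp_aestronglyMeasurable hnear.xinit_measurable.aestronglyMeasurable
  obtain ⟨w, η, hw, hη, hball⟩ := hsolve hG hπ
  rw [mul_comm] at hδ hδκ
  refine ⟨_, hG.isSolution hκ hδ hδκ hπ (hnear.ae_xinit_mem_Icc.mono fun ξ hξ => ?_) hw hη
    fun a => Metric.closedBall_subset_closedBall (min_le_right _ _) (hball a), ?_⟩
  · rw [projIcc_of_mem _ hξ]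
  · refine (iSup_integral_abs_sub_le fun ξ => ?_).trans_lt (half_lt_self hε)
    exact (norm_fst_le (w _ - equilibriumTriple y)).trans <|
      (mem_closedBall_iff_norm.1 (hball _)).trans (min_le_left _ _)

end StructuralStability

theorem stiffness_comp_zero : stiffness.comp (0 : Path T) = 1 :=
  ContinuousMap.ext fun t => by simp [stiffness_apply]

theorem stiffness_comp_neg (y : Path T) : stiffness.comp (-y) = stiffness.comp y :=
  ContinuousMap.ext fun t => by simp [stiffness_apply]

theorem cos_ne_zero_of_forall_ne (hT : 0 ≤ T)
    (h : ∀ n : ℕ, 1 ≤ n → T ≠ (2 * (n : ℝ) - 1) * Real.pi / 2) : Real.cos T ≠ 0 := by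
  rw [Real.cos_ne_zero_iff]
  intro k hk
  have hk0 : 0 ≤ k := by
    by_contra! hlt
    have hle : (k : ℝ) ≤ -1 := by exact_mod_cast Int.le_sub_one_of_lt hlt
    nlinarith [Real.pi_pos]
  obtain ⟨m, rfl⟩ := Int.eq_ofNat_of_zero_le hk0
  refine h (m + 1) m.succ_pos ?_
  rw [hk]
  push_cast
  ring

end MFG

end

theorem mainTheorem4_general (κ T : ℝ) (hκ : 1 < κ) (hT : Real.pi / 2 < T) :
    ∃ y₁ : MFG.Path T, StrictMono y₁ ∧
      (MFG.barycenterGame κ T (Real.pi_div_two_pos.trans hT).le).IsSolution (fun _ => 0) ∧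
      (MFG.barycenterGame κ T (Real.pi_div_two_pos.trans hT).le).IsSolution (fun _ => y₁) ∧
      (MFG.barycenterGame κ T (Real.pi_div_two_pos.trans hT).le).IsSolution (fun _ => -y₁) ∧
      ¬ (MFG.barycenterGame κ T (Real.pi_div_two_pos.trans hT).le).IsStable (fun _ => 0) ∧
      ((∀ n : ℕ, 1 ≤ n → T ≠ (2 * (n : ℝ) - 1) * Real.pi / 2) →
        (MFG.barycenterGame κ T (Real.pi_div_two_pos.trans hT).le).IsStructurallyStable
          (fun _ => 0)) ∧
      (MFG.barycenterGame κ T (Real.pi_div_two_pos.trans hT).le).IsStable (fun _ => y₁) ∧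
      (MFG.barycenterGame κ T (Real.pi_div_two_pos.trans hT).le).IsStable (fun _ => -y₁) ∧
      (MFG.barycenterGame κ T (Real.pi_div_two_pos.trans hT).le).IsStructurallyStable
          (fun _ => y₁) ∧
      (MFG.barycenterGame κ T (Real.pi_div_two_pos.trans hT).le).IsStructurallyStable
          (fun _ => -y₁) := by
  have hT0 : 0 < T := Real.pi_div_two_pos.trans hT
  have : Fact (0 ≤ T) := ⟨hT0.le⟩
  obtain ⟨y, hy⟩ := MFG.exists_isPositiveEquilibrium hT
  have hzero := MFG.zero_eq_green_force_comp_zero (T := T)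
  have hneg := MFG.neg_eq_green_force_comp_neg hy.eq_green
  refine ⟨y, hy.strictMono, MFG.barycenterGame.isSolution_const hκ hzero,
    MFG.barycenterGame.isSolution_const hκ hy.eq_green, MFG.barycenterGame.isSolution_const hκ hneg,
    MFG.barycenterGame.not_isStable_zero hT hκ, fun hresonance => ?_,
    MFG.barycenterGame.isStable_of_isPositiveEquilibrium hT0 hκ hy,
    MFG.barycenterGame.isStable_neg_of_isPositiveEquilibrium hT0 hκ hy,
    MFG.isStructurallyStable_of_isNondegenerate hT0 hκ hy.eq_green hy.isNondegenerate,
    MFG.isStructurallyStable_of_isNondegenerate hT0 hκ hneg ?_⟩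
  · refine MFG.isStructurallyStable_of_isNondegenerate hT0 hκ hzero ?_
    rw [MFG.stiffness_comp_zero]
    exact MFG.isNondegenerate_one (MFG.cos_ne_zero_of_forall_ne hT0.le hresonance)
  · rw [MFG.stiffness_comp_neg]
    exact hy.isNondegenerate

theorem mainTheorem4 (κ T : ℝ) (hκ : 1 < κ) (hT : 2 < T) :
    ∃ y₁ : MFG.Path T, StrictMono y₁ ∧
      -- three solutions, independent of the player
      (MFG.barycenterGame κ T (zero_le_two.trans hT.le)).IsSolution (fun _ => 0) ∧
      (MFG.barycenterGame κ T (zero_le_two.trans hT.le)).IsSolution (fun _ => y₁) ∧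
      (MFG.barycenterGame κ T (zero_le_two.trans hT.le)).IsSolution (fun _ => -y₁) ∧
      -- the zero solution
      ¬ (MFG.barycenterGame κ T (zero_le_two.trans hT.le)).IsStable (fun _ => 0) ∧
      ((∀ n : ℕ, 1 ≤ n → T ≠ (2 * (n : ℝ) - 1) * Real.pi / 2) →
        (MFG.barycenterGame κ T (zero_le_two.trans hT.le)).IsStructurallyStable (fun _ => 0)) ∧
      -- the two nonzero solutions
      (MFG.barycenterGame κ T (zero_le_two.trans hT.le)).IsStable (fun _ => y₁) ∧
      (MFG.barycenterGame κ T (zero_le_two.trans hT.le)).IsStable (fun _ => -y₁) ∧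
      (MFG.barycenterGame κ T (zero_le_two.trans hT.le)).IsStructurallyStable (fun _ => y₁) ∧
      (MFG.barycenterGame κ T (zero_le_two.trans hT.le)).IsStructurallyStable (fun _ => -y₁) :=
  mainTheorem4_general κ T hκ (by linarith [Real.pi_lt_four])
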